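/- Let $\bar s,\beta,\rho>0$, $\mu\in\mathbb R$, $0<\lambda<1$, and let $\Gamma,\Lambda\subset\mathbb R$ be compact and non-empty. Let $\mathcal H=L^2(0,\bar s)$ with norm $|\cdot|$ and inner product $\langle\cdot,\cdot\rangle$. **Operators.** Let $A=-\beta\frac{d}{dr}$ with $D(A)=\{f\in H^1(0,\bar s):f(0)=0\}$ and $A^*=\beta\frac{d}{dr}$ with $D(A^*)=\{f\in H^1(0,\bar s):f(\bar s)=0\}$; for $f\in D(A^*)$ put $\delta_0(f)=f(0)$. Let $B=(A^*-\lambda I)^{-1}(A-\lambda I)^{-1}$ and $|x|_B=\sqrt{\langle Bx,x\rangle}$. A function $v:\mathcal H\to\mathbb R$ is $B$-Lipschitz if $|v(x)-v(y)|\le C|x-y|_B$ for some constant $C$ and all $x,y\in\mathcal H$. **Control problem.** Let $\Sigma=\{\gamma\in L^2(0,\bar s):\gamma(r)\in\Lambda \text{ for a.e. } r\}$, let $\mathcal A$ be the set of measurable $a:[0,\infty)\to\Gamma$ and $\mathcal E$ the set of measurable $\alpha:[0,\infty)\to\Sigma\subset\mathcal H$. For $x\in\mathcal H$ and $(\alpha,a)\in\mathcal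 E\times\mathcal A$ let $x(\cdot)$ be the (mild) solution of $$\partial_s x(s,r)+\beta\,\partial_r x(s,r)=-\mu x(s,r)+\alpha(s,r),\qquad x(s,0)=a(s),\qquad x(0,\cdot)=x,$$ that is, for $s\ge 0$, $$x(s)=e^{-\mu s}T(s)x+b_s+\int_0^s e^{-\mu(s-\tau)}T(s-\tau)\alpha(\tau)\,d\tau ,$$ where $(T(s)f)(r)=f(r-\beta s)$ for $r\in[\beta s,\bar s]$ and $0$ for $r<\beta s$, and $b_s(r)=e^{-\frac{\mu}{\beta}r}a(s-r/\beta)$ for $r<\beta s$ and $0$ for $r\ge\beta s$. Let $L:\mathcal H\times\Sigma\times\Gamma\to\mathbb R$ be uniformly continuous and let $C_L\ge0$ be such that for all $x,y\in\mathcal H$, $(\alpha,a)\in\Sigma\times\Gamma$ * (L1) $|L(x,\alpha,a)-L(y,\alpha,a)|\le C_L|x-y|_B$, * (L2) $|L(x,\alpha,a)|\le C_L$. Let $$V(x)=\inf_{(\alpha,a)\in\mathcal E\times\mathcal A}\int_0^\infty e^{-\rho s}L(x(s),\alpha(s),a(s))\,ds .$$ **Viscosity solutions.** $\phi\in C^1(\mathcal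 H)$ is a test function of type 1 if $\phi(x)\le\liminf_n\phi(x_n)$ whenever $x_n\rightharpoonup x$ weakly and $|B(x_n-x)|\to0$, $\nabla\phi(x)\in D(A^*)$ for all $x$, and $x\mapsto A^*\nabla\phi(x)$ is continuous from $\mathcal H$ to $\mathcal H$. $g\in C^2(\mathcal H)$ is a test function of type 2 if $g(x)=g_0(|x|)$ with $g_0:[0,\infty)\to\mathbb R$ nondecreasing. Put $\|\Gamma\|=\sup_{a\in\Gamma}|a|$ and read $g_0'(|x|)/|x|$ at $x=0$ as $\lim_{t\to0^+}g_0'(t)/t$. Let $v\in C(\mathcal H)$ be bounded and $B$-Lipschitz. * $v$ is a subsolution if for all test functions $\phi$ of type 1 and $g$ of type 2 and every local maximum point $x$ of $v-(\phi+g)$, $$\rho v(x)-\langle A^*\nabla\phi(x),x\rangle-\langle\nabla\phi(x)+\nabla g(x),-\mu x\rangle-\inf_{(\alpha,a)\in\Sigma\times\Gamma}\big(\beta\delta_0(\nabla\phi(x))a+\langle\nabla\phi(x)+\nabla g(x),\alpha\rangle+L(x,\alpha,a)\big)\le\frac{g_0'(|x|)}{|x|}\,\beta\,\frac{\|\Gamma\|^2}{2}.$$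 * $v$ is a supersolution if for all such $\phi,g$ and every local minimum point $x$ of $v+(\phi+g)$, $$\rho v(x)+\langle A^*\nabla\phi(x),x\rangle+\langle\nabla\phi(x)+\nabla g(x),-\mu x\rangle-\inf_{(\alpha,a)\in\Sigma\times\Gamma}\big(-\beta\delta_0(\nabla\phi(x))a-\langle\nabla\phi(x)+\nabla g(x),\alpha\rangle+L(x,\alpha,a)\big)\ge-\frac{g_0'(|x|)}{|x|}\,\beta\,\frac{\|\Gamma\|^2}{2}.$$ * $v$ is a solution if it is both a subsolution and a supersolution. **Theorem.** The value function $V$ is bounded and $B$-Lipschitz, and it is a solution (in the above sense) of the HJB equation $$\rho u(x)-\langle\nabla u(x),Ax\rangle-\langle\nabla u(x),-\mu x\rangle-\inf_{(\alpha,a)\in\Sigma\times\Gamma}\big(\beta\delta_0(\nabla u(x))a+\langle\nabla u(x),\alpha\rangle+L(x,\alpha,a)\big)=0 .$$ -/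

import Mathlib

open MeasureTheory Set Filter Topology

noncomputable section

namespace TransportHJB

/-- Lebesgue measure on the interval from `0` to `sbar`. -/
abbrev leb (sbar : ℝ) : Measure ℝ := volume.restrict (Ioc 0 sbar)

/-- The state space `L²(0, sbar)`. -/
abbrev State (sbar : ℝ) : Type := Lp ℝ 2 (leb sbar)

/-- The class in `L²(0, sbar)` of a square integrable function. The `memLp` lemmas below show
that it is only applied to square integrable functions. -/
def toL2 (sbar : ℝ) (f : ℝ → ℝ) : State sbar :=
  open Classical in if h : MemLp f 2 (leb sbar) then h.toLp f else 0

/-! ### The transport semigroup and the trajectories -/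

/-- `r ↦ f (r - β s)` for `r ∈ [β s, sbar]`, and `0` for `r ∈ [0, β s)` (when `s ≥ 0`). -/
def shiftFun (sbar β s : ℝ) (f : ℝ → ℝ) (r : ℝ) : ℝ :=
  (Ioc 0 sbar).indicator f (r - β * s)

/-- The `C₀`-semigroup `T(s)` of right translations with speed `β`. -/
def semigroup (sbar β s : ℝ) (f : State sbar) : State sbar :=
  toL2 sbar (shiftFun sbar β s f)

/-- The contribution of the boundary control `a` at time `s`:
`r ↦ e^{-(μ/β) r} a(s - r/β)` for `r < β s`, and `0` for `r ≥ β s`. -/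
def boundaryFun (β μ : ℝ) (a : ℝ → ℝ) (s r : ℝ) : ℝ :=
  if r < β * s then Real.exp (-(μ / β) * r) * a (s - r / β) else 0

/-- The trajectory starting from `x` with distributed control `α` and boundary control `a`,
at time `s ≥ 0`: the solution of
`∂ₛ x + β ∂ᵣ x = - μ x + α`, `x(s, 0) = a(s)`, `x(0, ·) = x`. -/
def trajectory (sbar β μ : ℝ) (x : State sbar) (α : ℝ → State sbar) (a : ℝ → ℝ) (s : ℝ) :
    State sbar :=
  Real.exp (-μ * s) • semigroup sbar β s x
    + toL2 sbar (boundaryFun β μ a s)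
    + ∫ τ in (0 : ℝ)..s, Real.exp (-μ * (s - τ)) • semigroup sbar β (s - τ) (α τ)

/-! ### Controls, cost and value function -/

/-- The admissible boundary controls: measurable with values in `Γ` on `[0, ∞)`.
Values at negative times are never used. -/
def boundaryControls (Γ : Set ℝ) : Set (ℝ → ℝ) :=
  {a | Measurable a ∧ ∀ t, 0 ≤ t → a t ∈ Γ}

/-- The set `Σ` of the elements of `L²(0, sbar)` with values in `Λ`. -/
def controlValues (sbar : ℝ) (Λ : Set ℝ) : Set (State sbar) :=
  {γ | ∀ᵐ r ∂(leb sbar), γ r ∈ Λ}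

/-- The admissible distributed controls: measurable, with values in `Σ` on `[0, ∞)`.
(`L²(0, sbar)` is separable, so that measurable and strongly measurable are the same.)
Values at negative times are never used. -/
def distributedControls (sbar : ℝ) (Λ : Set ℝ) : Set (ℝ → State sbar) :=
  {α | StronglyMeasurable α ∧ ∀ t, 0 ≤ t → α t ∈ controlValues sbar Λ}

/-- The cost functional `J(x, α, a)`. -/
def cost (sbar β μ ρ : ℝ) (L : State sbar → State sbar → ℝ → ℝ)
    (x : State sbar) (α : ℝ → State sbar) (a : ℝ → ℝ) : ℝ :=
  ∫ s in Ioi (0 : ℝ), Real.exp (-ρ * s) * L (trajectory sbar β μ x α a s) (α s) (a s)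

/-- The value function `V`. -/
def value (sbar β μ ρ : ℝ) (Γ Λ : Set ℝ) (L : State sbar → State sbar → ℝ → ℝ)
    (x : State sbar) : ℝ :=
  sInf {j | ∃ α ∈ distributedControls sbar Λ, ∃ a ∈ boundaryControls Γ,
    j = cost sbar β μ ρ L x α a}

/-! ### The operator `B` and the `B`-norm -/

/-- The explicit form of `(A - lam)⁻¹ f`, i.e. of the solution `v` of
`-β v' - lam v = f`, `v(0) = 0`. -/
def resolventFun (β lam : ℝ) (f : ℝ → ℝ) (r : ℝ) : ℝ :=
  (1 / β) * (-Real.exp (-(lam / β) * r) * ∫ τ in (0 : ℝ)..r, Real.exp ((lam / β) * τ) * f τ)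

/-- The explicit form of `(A* - lam)⁻¹ f`, i.e. of the solution `v` of
`β v' - lam v = f`, `v(sbar) = 0`. -/
def adjResolventFun (sbar β lam : ℝ) (f : ℝ → ℝ) (r : ℝ) : ℝ :=
  (1 / β) * (-Real.exp ((lam / β) * r) * ∫ τ in r..sbar, Real.exp (-(lam / β) * τ) * f τ)

/-- `B = (A* - lam)⁻¹ (A - lam)⁻¹`. -/
def opB (sbar β lam : ℝ) (x : State sbar) : State sbar :=
  toL2 sbar (adjResolventFun sbar β lam (toL2 sbar (resolventFun β lam x)))

/-- The `B`-norm `√⟨B x, x⟩`. -/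
def bNorm (sbar β lam : ℝ) (x : State sbar) : ℝ :=
  √(inner ℝ (opB sbar β lam x) x)

/-- Lipschitz continuity with respect to the `B`-norm. -/
def IsBLipschitz (sbar β lam : ℝ) (v : State sbar → ℝ) : Prop :=
  ∃ C : ℝ, ∀ x y, |v x - v y| ≤ C * bNorm sbar β lam (x - y)

/-- (Sequential) `B`-lower semicontinuity: `φ x ≤ liminf φ (xₙ)` whenever
`xₙ ⇀ x` weakly and `|B (xₙ - x)| → 0`. -/
def IsBLowerSemicontinuous (sbar β lam : ℝ) (φ : State sbar → ℝ) : Prop :=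
  ∀ (x : State sbar) (u : ℕ → State sbar),
    (∀ y : State sbar, Tendsto (fun n => inner ℝ (u n) y) atTop (𝓝 (inner ℝ x y))) →
    Tendsto (fun n => ‖opB sbar β lam (u n - x)‖) atTop (𝓝 0) →
    ∀ c < φ x, ∀ᶠ n in atTop, c < φ (u n)

/-! ### The operator `A*` and the Dirac mass at `0` -/

/-- `p ∈ H¹(0, sbar)` with weak derivative `w ∈ L²(0, sbar)` and (absolutely) continuous
representative `F` on `[0, sbar]`. -/
def IsH1 (sbar : ℝ) (p w : State sbar) (F : ℝ → ℝ) : Prop :=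
  p =ᵐ[leb sbar] F ∧ ∀ r ∈ Icc 0 sbar, F r = F 0 + ∫ t in (0 : ℝ)..r, w t

/-- `D(A*) = {p ∈ H¹(0, sbar) : p(sbar) = 0}`. -/
def domAstar (sbar : ℝ) : Set (State sbar) :=
  {p | ∃ (w : State sbar) (F : ℝ → ℝ), IsH1 sbar p w F ∧ F sbar = 0}

/-- `A* p = β p'` for `p ∈ D(A*)`. -/
def opAstar (sbar β : ℝ) (p : State sbar) : State sbar :=
  open Classical in if h : p ∈ domAstar sbar then β • h.choose else 0

/-- `δ₀ p = p(0)` for `p ∈ D(A*)`. -/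
def delta0 (sbar : ℝ) (p : State sbar) : ℝ :=
  open Classical in if h : p ∈ domAstar sbar then h.choose_spec.choose 0 else 0

/-! ### Well-definedness of `A*` and `δ₀` -/

theorem IsH1.continuousOn {sbar : ℝ} {p w : State sbar} {F : ℝ → ℝ} (h : IsH1 sbar p w F) :
    ContinuousOn F (Icc 0 sbar) := by
  have hi : IntegrableOn (w : ℝ → ℝ) (Icc 0 sbar) :=
    (integrableOn_Icc_iff_integrableOn_Ioc (by simp)).2 ((Lp.memLp w).integrable (by norm_num))
  have h1 := (intervalIntegral.continuousOn_primitive hi).const_add (F 0)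
  refine h1.congr fun r hr => ?_
  rw [h.2 r hr, intervalIntegral.integral_of_le hr.1]

theorem IsH1.unique {sbar : ℝ} (hs : 0 < sbar) {p w w' : State sbar} {F F' : ℝ → ℝ}
    (h : IsH1 sbar p w F) (h' : IsH1 sbar p w' F') : w = w' ∧ EqOn F F' (Icc 0 sbar) := by
  have hE : EqOn F F' (Icc 0 sbar) := by
    refine Measure.eqOn_Icc_of_ae_eq volume hs.ne ?_ h.continuousOn h'.continuousOn
    rw [← Measure.restrict_congr_set Ioc_ae_eq_Icc]
    exact h.1.symm.trans h'.1
  refine ⟨?_, hE⟩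
  have hi : ∀ u : State sbar, IntervalIntegrable (u : ℝ → ℝ) volume 0 sbar := fun u => by
    rw [intervalIntegrable_iff, uIoc_of_le hs.le]
    exact (Lp.memLp u).integrable (by norm_num)
  apply Lp.ext
  have hne : ∀ᵐ r : ℝ, r ≠ sbar := by simp [ae_iff]
  rw [Filter.EventuallyEq, ae_restrict_iff' measurableSet_Ioc]
  filter_upwards [(hi w).ae_hasDerivAt_integral, (hi w').ae_hasDerivAt_integral, hne]
    with r h1 h2 h3 hr
  rw [uIcc_of_le hs.le] at h1 h2
  have hr' := Ioc_subset_Icc_self hr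
  have d1 := h1 hr' 0 ⟨le_rfl, hs.le⟩
  have d2 := h2 hr' 0 ⟨le_rfl, hs.le⟩
  refine d1.unique (d2.congr_of_eventuallyEq ?_)
  filter_upwards [Ioo_mem_nhds hr.1 (lt_of_le_of_ne hr.2 h3)] with t ht
  have ht' := Ioo_subset_Icc_self ht
  have e1 := h.2 t ht'
  have e2 := h'.2 t ht'
  have e3 := hE ht'
  have e4 := hE (⟨le_rfl, hs.le⟩ : (0 : ℝ) ∈ Icc 0 sbar)
  linarith

theorem opAstar_eq {sbar β : ℝ} (hs : 0 < sbar) {p w : State sbar} {F : ℝ → ℝ}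
    (h : IsH1 sbar p w F) (h0 : F sbar = 0) : opAstar sbar β p = β • w := by
  have hp : p ∈ domAstar sbar := ⟨w, F, h, h0⟩
  rw [opAstar, dif_pos hp, (hp.choose_spec.choose_spec.1.unique hs h).1]

theorem delta0_eq {sbar : ℝ} (hs : 0 < sbar) {p w : State sbar} {F : ℝ → ℝ}
    (h : IsH1 sbar p w F) (h0 : F sbar = 0) : delta0 sbar p = F 0 := by
  have hp : p ∈ domAstar sbar := ⟨w, F, h, h0⟩
  rw [delta0, dif_pos hp]
  exact (hp.choose_spec.choose_spec.1.unique hs h).2 ⟨le_rfl, hs.le⟩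

/-! ### Test functions and solutions of the HJB equation -/

/-- Test functions of type 1. -/
def IsTest1 (sbar β lam : ℝ) (φ : State sbar → ℝ) : Prop :=
  ContDiff ℝ 1 φ ∧ IsBLowerSemicontinuous sbar β lam φ ∧
    (∀ x, gradient φ x ∈ domAstar sbar) ∧
    Continuous fun x => opAstar sbar β (gradient φ x)

/-- `g` is a test function of type 2, with radial profile `g₀` on `[0, ∞)`. -/
def IsTest2 (sbar : ℝ) (g : State sbar → ℝ) (g₀ : ℝ → ℝ) : Prop :=
  ContDiff ℝ 2 g ∧ MonotoneOn g₀ (Ici 0) ∧ ∀ x, g x = g₀ ‖x‖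

/-- `g₀'(r) / r`, continuously extended to `r = 0`. (For the profile of a test function of type 2
the limit at `0` exists; it is the second derivative of `g₀` at `0`.) -/
def radialSlope (g₀ : ℝ → ℝ) (r : ℝ) : ℝ :=
  if r = 0 then limUnder (𝓝[>] (0 : ℝ)) (fun t => deriv g₀ t / t) else deriv g₀ r / r

/-- `‖Γ‖ = sup {|a| : a ∈ Γ}`. -/
def setNorm (Γ : Set ℝ) : ℝ := sSup ((fun a => |a|) '' Γ)

/-- `inf` over `(α, a) ∈ Σ × Γ` of `β d a + ⟨p, α⟩ + L(x, α, a)`. -/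
def hamiltonian (sbar β : ℝ) (Γ Λ : Set ℝ) (L : State sbar → State sbar → ℝ → ℝ)
    (x : State sbar) (d : ℝ) (p : State sbar) : ℝ :=
  sInf ((fun c : State sbar × ℝ => β * d * c.2 + inner ℝ p c.1 + L x c.1 c.2) ''
    (controlValues sbar Λ ×ˢ Γ))

/-- Continuous, bounded and `B`-Lipschitz functions. -/
def IsRegular (sbar β lam : ℝ) (u : State sbar → ℝ) : Prop :=
  Continuous u ∧ (∃ M : ℝ, ∀ x, |u x| ≤ M) ∧ IsBLipschitz sbar β lam u

/-- Viscosity subsolutions of the HJB equation. -/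
def IsSubsolution (sbar β μ ρ lam : ℝ) (Γ Λ : Set ℝ) (L : State sbar → State sbar → ℝ → ℝ)
    (u : State sbar → ℝ) : Prop :=
  IsRegular sbar β lam u ∧
  ∀ (φ g : State sbar → ℝ) (g₀ : ℝ → ℝ) (x : State sbar),
    IsTest1 sbar β lam φ → IsTest2 sbar g g₀ → IsLocalMax (fun y => u y - (φ y + g y)) x →
    ρ * u x - inner ℝ (opAstar sbar β (gradient φ x)) x
        - inner ℝ (gradient φ x + gradient g x) (-μ • x)
        - hamiltonian sbar β Γ Λ L x (delta0 sbar (gradient φ x)) (gradient φ x + gradient g x)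
      ≤ radialSlope g₀ ‖x‖ * β * (setNorm Γ ^ 2 / 2)

/-- Viscosity supersolutions of the HJB equation. -/
def IsSupersolution (sbar β μ ρ lam : ℝ) (Γ Λ : Set ℝ) (L : State sbar → State sbar → ℝ → ℝ)
    (v : State sbar → ℝ) : Prop :=
  IsRegular sbar β lam v ∧
  ∀ (φ g : State sbar → ℝ) (g₀ : ℝ → ℝ) (x : State sbar),
    IsTest1 sbar β lam φ → IsTest2 sbar g g₀ → IsLocalMin (fun y => v y + (φ y + g y)) x →
    ρ * v x + inner ℝ (opAstar sbar β (gradient φ x)) x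
        + inner ℝ (gradient φ x + gradient g x) (-μ • x)
        - hamiltonian sbar β Γ Λ L x (-delta0 sbar (gradient φ x))
            (-(gradient φ x + gradient g x))
      ≥ -(radialSlope g₀ ‖x‖ * β * (setNorm Γ ^ 2 / 2))

/-- Viscosity solutions of the HJB equation. -/
def IsSolution (sbar β μ ρ lam : ℝ) (Γ Λ : Set ℝ) (L : State sbar → State sbar → ℝ → ℝ)
    (v : State sbar → ℝ) : Prop :=
  IsSubsolution sbar β μ ρ lam Γ Λ L v ∧ IsSupersolution sbar β μ ρ lam Γ Λ L v

/-! ### Square integrability of the functions to which `toL2` is applied -/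

theorem memLp_shiftFun (sbar β s : ℝ) (f : State sbar) :
    MemLp (shiftFun sbar β s f) 2 (leb sbar) := by
  have h : MemLp ((Ioc 0 sbar).indicator (f : ℝ → ℝ)) 2 volume :=
    (memLp_indicator_iff_restrict measurableSet_Ioc).2 (Lp.memLp f)
  exact (h.comp_measurePreserving (measurePreserving_sub_right volume (β * s))).restrict _

theorem memLp_boundaryFun (sbar β μ : ℝ) (hβ : 0 < β) (Γ : Set ℝ) (hΓ : IsCompact Γ)
    (a : ℝ → ℝ) (ha : a ∈ boundaryControls Γ) (s : ℝ) :
    MemLp (boundaryFun β μ a s) 2 (leb sbar) := by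
  obtain ⟨M, hM⟩ := hΓ.isBounded.exists_norm_le
  have hm : Measurable (boundaryFun β μ a s) := by
    unfold boundaryFun
    refine Measurable.ite measurableSet_Iio ?_ measurable_const
    exact (by fun_prop : Measurable fun r : ℝ => Real.exp (-(μ / β) * r)).mul
      (ha.1.comp (by fun_prop))
  refine MemLp.of_bound hm.aestronglyMeasurable (Real.exp (|μ / β| * |sbar|) * |M|) ?_
  filter_upwards [ae_restrict_mem measurableSet_Ioc] with r hr
  unfold boundaryFun
  split_ifs with h
  · rw [norm_mul]
    have h0 : 0 ≤ s - r / β := by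
      rw [sub_nonneg, div_le_iff₀ hβ]; linarith
    have h1 := (hM _ (ha.2 _ h0)).trans (le_abs_self M)
    have h2 : ‖Real.exp (-(μ / β) * r)‖ ≤ Real.exp (|μ / β| * |sbar|) := by
      rw [Real.norm_eq_abs, Real.abs_exp]
      apply Real.exp_le_exp.2
      have h3 : |r| ≤ |sbar| := by
        rw [abs_of_pos hr.1]; exact hr.2.trans (le_abs_self _)
      calc -(μ / β) * r ≤ |-(μ / β) * r| := le_abs_self _
        _ = |μ / β| * |r| := by rw [abs_mul, abs_neg]
        _ ≤ _ := by gcongr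
    gcongr
  · simp only [norm_zero]; positivity

theorem memLp_of_continuousOn (sbar : ℝ) (f : ℝ → ℝ) (hf : ContinuousOn f (Icc 0 sbar)) :
    MemLp f 2 (leb sbar) := by
  obtain ⟨C, hC⟩ := isCompact_Icc.exists_bound_of_continuousOn hf
  refine MemLp.of_bound ((hf.mono Ioc_subset_Icc_self).aestronglyMeasurable measurableSet_Ioc)
    C ?_
  filter_upwards [ae_restrict_mem measurableSet_Ioc] with r hr
  exact hC r (Ioc_subset_Icc_self hr)

theorem integrableOn_state (sbar : ℝ) (f : State sbar) (k : ℝ → ℝ) (hk : Continuous k) :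
    IntegrableOn (fun t => k t * f t) (Icc 0 sbar) := by
  have h : IntegrableOn (f : ℝ → ℝ) (Icc 0 sbar) :=
    (integrableOn_Icc_iff_integrableOn_Ioc (by simp)).2 ((Lp.memLp f).integrable (by norm_num))
  exact h.continuousOn_mul hk.continuousOn isCompact_Icc

theorem memLp_resolventFun (sbar β lam : ℝ) (f : State sbar) :
    MemLp (resolventFun β lam f) 2 (leb sbar) := by
  apply memLp_of_continuousOn
  unfold resolventFun
  have h := intervalIntegral.continuousOn_primitive
    (integrableOn_state sbar f (fun t => Real.exp ((lam / β) * t)) (by fun_prop))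
  have h' : ContinuousOn (fun r => ∫ τ in (0 : ℝ)..r, Real.exp ((lam / β) * τ) * f τ)
      (Icc 0 sbar) :=
    h.congr fun r hr => intervalIntegral.integral_of_le hr.1
  fun_prop

theorem memLp_adjResolventFun (sbar β lam : ℝ) (f : State sbar) :
    MemLp (adjResolventFun sbar β lam f) 2 (leb sbar) := by
  rcases lt_or_ge sbar 0 with hs | hs
  · simp [leb, Ioc_eq_empty (not_lt.2 hs.le)]
  apply memLp_of_continuousOn
  unfold adjResolventFun
  have hi := integrableOn_state sbar f (fun t => Real.exp (-(lam / β) * t)) (by fun_prop)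
  have h := intervalIntegral.continuousOn_primitive_interval_left (μ := volume)
    (f := fun t => Real.exp (-(lam / β) * t) * f t) (a := 0) (b := sbar)
    (by rwa [uIcc_of_le hs])
  rw [uIcc_of_le hs] at h
  fun_prop

end TransportHJB

end

noncomputable section

namespace TransportHJB

/-! ### The transport semigroup -/

/-! Regularity. Two trajectories driven by the same controls differ by `e^{-μs} T(s)(x - y)`. The
`B`-norm is `|R z|` with `R = (A - lam)⁻¹`, and `R` commutes with the contraction `T(s)`, so `T(s)`
is also a contraction for the `B`-norm. Since `T(s) = 0` once `β s ≥ sbar`, the factor `e^{-μs}`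
only matters for bounded `s`, and the cost is `B`-Lipschitz uniformly in the controls, whatever the
sign of `μ`. The infimum `V` inherits the bound and the Lipschitz constant.

Viscosity property. The flow property and concatenation of controls give dynamic programming for
`V`. At a local extremum, `V` is exchanged for `φ + g` along the trajectory, and the inequality is
divided by `h → 0`. Both the subsolution and the supersolution inequality need only an upper bound
for the increment of `φ + g` over time `h`, with error `o(h)` uniform in the controls; this is
`exists_test_sub_le`.

For `φ`, the mean value theorem gives `⟨∇φ(z), x(h) - x⟩` with `z → x`. As `∇φ(z) ∈ D(A*)`, the
translation is moved onto `A*∇φ(z)`, which converges. The inflow sits in `(0, βh)`, where `∇φ(z)` is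
close to `δ₀(∇φ(x))`, and it contributes `β δ₀ ∫ a` (`IsTest1.isLittleO_sub`).

For the radial `g`, whose gradient need not lie in `D(A*)`, there is only an energy inequality.
Transported state and inflow have disjoint supports, transport does not increase the norm, and the
inflow has squared norm at most `βh‖Γ‖² + o(h)`. Multiplying by half the nonnegative slope
`g₀'(|x|)/|x|` produces the extra term of the definition (`IsTest2.exists_sub_le`).

The subsolution inequality follows with constant controls, the supersolution inequality with
`h²`-optimal controls; the latter vary with `h`, which is why uniformity matters. -/

theorem indicator_ae_eq_of_ae_eq_leb {sbar : ℝ} {f g : ℝ → ℝ} (h : f =ᵐ[leb sbar] g) :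
    (Ioc 0 sbar).indicator f =ᵐ[volume] (Ioc 0 sbar).indicator g :=
  (ae_eq_restrict_iff_indicator_ae_eq measurableSet_Ioc).1 h

theorem measurePreserving_sub_mul (β s : ℝ) :
    MeasurePreserving (fun r : ℝ => r - β * s) volume volume :=
  measurePreserving_sub_right volume (β * s)

theorem shiftFun_congr {sbar β s : ℝ} {f g : ℝ → ℝ} (h : f =ᵐ[leb sbar] g) :
    shiftFun sbar β s f =ᵐ[volume] shiftFun sbar β s g :=
  (measurePreserving_sub_mul β s).quasiMeasurePreserving.ae_eq_comp
    (indicator_ae_eq_of_ae_eq_leb h)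

theorem toL2_coeFn {sbar : ℝ} {f : ℝ → ℝ} (h : MemLp f 2 (leb sbar)) :
    toL2 sbar f =ᵐ[leb sbar] f := by
  rw [toL2, dif_pos h]; exact h.coeFn_toLp

theorem toL2_congr {sbar : ℝ} {f g : ℝ → ℝ} (h : f =ᵐ[leb sbar] g) :
    toL2 sbar f = toL2 sbar g := by
  by_cases hf : MemLp f 2 (leb sbar)
  · have hg : MemLp g 2 (leb sbar) := (memLp_congr_ae h).1 hf
    apply Lp.ext
    exact (toL2_coeFn hf).trans (h.trans (toL2_coeFn hg).symm)
  · have hg : ¬ MemLp g 2 (leb sbar) := fun hg => hf ((memLp_congr_ae h).2 hg)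
    rw [toL2, toL2, dif_neg hf, dif_neg hg]

theorem semigroup_coeFn (sbar β s : ℝ) (f : State sbar) :
    semigroup sbar β s f =ᵐ[leb sbar] shiftFun sbar β s f :=
  toL2_coeFn (memLp_shiftFun sbar β s f)

theorem memLp_zeroExt {sbar : ℝ} (f : State sbar) :
    MemLp ((Ioc 0 sbar).indicator (f : ℝ → ℝ)) 2 volume :=
  (memLp_indicator_iff_restrict measurableSet_Ioc).2 (Lp.memLp f)

/-- The extension by zero of an element of `L²(0, sbar)` to the real line. -/
def zeroExt {sbar : ℝ} (f : State sbar) : Lp ℝ 2 (volume : Measure ℝ) :=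
  (memLp_zeroExt f).toLp _

theorem norm_zeroExt {sbar : ℝ} (f : State sbar) : ‖zeroExt f‖ = ‖f‖ := by
  rw [zeroExt, Lp.norm_toLp, Lp.norm_def, eLpNorm_indicator_eq_eLpNorm_restrict measurableSet_Ioc]

/-- Extend by zero, translate on the whole line, restrict. Contractivity and strong continuity are
thereby inherited from the translation group of `L²(ℝ)`, for `s` of either sign. -/
theorem semigroup_eq_restrict (sbar β s : ℝ) (f : State sbar) :
    semigroup sbar β s f = LpToLpRestrictCLM ℝ ℝ ℝ volume 2 (Ioc 0 sbar)
      (Lp.compMeasurePreserving _ (measurePreserving_sub_mul β s) (zeroExt f)) := by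
  apply Lp.ext
  refine (semigroup_coeFn sbar β s f).trans (EventuallyEq.symm ?_)
  refine (LpToLpRestrictCLM_coeFn ℝ _ _).trans (ae_restrict_of_ae ?_)
  refine (Lp.coeFn_compMeasurePreserving _ (measurePreserving_sub_mul β s)).trans ?_
  exact (measurePreserving_sub_mul β s).quasiMeasurePreserving.ae_eq_comp
    (memLp_zeroExt f).coeFn_toLp

theorem continuous_semigroup_left (sbar β : ℝ) (f : State sbar) :
    Continuous fun s => semigroup sbar β s f := by
  simp_rw [semigroup_eq_restrict]
  refine (LpToLpRestrictCLM ℝ ℝ ℝ volume 2 (Ioc 0 sbar)).continuous.comp ?_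
  let G : C(ℝ, C(ℝ, ℝ)) :=
    ContinuousMap.curry ⟨fun q : ℝ × ℝ => q.2 - β * q.1, by fun_prop⟩
  exact (continuous_const (y := zeroExt f)).compMeasurePreservingLp (p := 2) G.continuous
    (fun s => measurePreserving_sub_mul β s) (by norm_num)

theorem norm_semigroup_le (sbar β s : ℝ) (f : State sbar) :
    ‖semigroup sbar β s f‖ ≤ ‖f‖ := by
  rw [semigroup_eq_restrict, ← norm_zeroExt f,
    ← Lp.norm_compMeasurePreserving (zeroExt f) (measurePreserving_sub_mul β s)]
  exact norm_Lp_toLp_restrict_le _ _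

theorem semigroup_add (sbar β s : ℝ) (f g : State sbar) :
    semigroup sbar β s (f + g) = semigroup sbar β s f + semigroup sbar β s g := by
  apply Lp.ext
  refine (semigroup_coeFn sbar β s _).trans ?_
  filter_upwards [ae_restrict_of_ae (s := Ioc 0 sbar)
      (shiftFun_congr (β := β) (s := s) (Lp.coeFn_add f g)),
    Lp.coeFn_add (semigroup sbar β s f) (semigroup sbar β s g),
    semigroup_coeFn sbar β s f, semigroup_coeFn sbar β s g] with r h0 h1 h2 h3
  rw [h0, h1, Pi.add_apply, h2, h3]
  simp only [shiftFun, indicator_add', Pi.add_apply]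

theorem semigroup_smul (sbar β s c : ℝ) (f : State sbar) :
    semigroup sbar β s (c • f) = c • semigroup sbar β s f := by
  apply Lp.ext
  refine (semigroup_coeFn sbar β s _).trans ?_
  filter_upwards [ae_restrict_of_ae (s := Ioc 0 sbar)
      (shiftFun_congr (β := β) (s := s) (Lp.coeFn_smul c f)),
    Lp.coeFn_smul c (semigroup sbar β s f),
    semigroup_coeFn sbar β s f] with r h0 h1 h2
  rw [h0, h1, Pi.smul_apply, h2]
  simp only [shiftFun, indicator_const_smul_apply, Pi.smul_def]

/-- The transport semigroup as a continuous linear map. -/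
def semigroupL (sbar β s : ℝ) : State sbar →L[ℝ] State sbar :=
  LinearMap.mkContinuous
    { toFun := semigroup sbar β s
      map_add' := semigroup_add sbar β s
      map_smul' := semigroup_smul sbar β s } 1
    (fun f => by rw [one_mul]; exact norm_semigroup_le sbar β s f)

theorem semigroupL_apply (sbar β s : ℝ) (f : State sbar) :
    semigroupL sbar β s f = semigroup sbar β s f := rfl

theorem semigroup_sub (sbar β s : ℝ) (f g : State sbar) :
    semigroup sbar β s (f - g) = semigroup sbar β s f - semigroup sbar β s g :=
  map_sub (semigroupL sbar β s) f g

/-- Strong continuity together with the uniform bound `1` gives joint continuity, which makes the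
Duhamel integrand jointly measurable. -/
theorem continuous_semigroup (sbar β : ℝ) :
    Continuous fun q : ℝ × State sbar => semigroup sbar β q.1 q.2 := by
  rw [continuous_iff_continuousAt]
  rintro ⟨s, f⟩
  rw [ContinuousAt, tendsto_iff_norm_sub_tendsto_zero]
  have h1 : Tendsto (fun q : ℝ × State sbar =>
      ‖q.2 - f‖ + ‖semigroup sbar β q.1 f - semigroup sbar β s f‖) (𝓝 (s, f)) (𝓝 0) := by
    have hc : Continuous fun q : ℝ × State sbar =>
        ‖q.2 - f‖ + ‖semigroup sbar β q.1 f - semigroup sbar β s f‖ :=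
      ((continuous_snd.sub continuous_const).norm).add
        ((((continuous_semigroup_left sbar β f).comp continuous_fst).sub continuous_const).norm)
    simpa using hc.tendsto (s, f)
  refine squeeze_zero (fun _ => norm_nonneg _) (fun q => ?_) h1
  have h2 : semigroup sbar β q.1 q.2 - semigroup sbar β s f
      = semigroup sbar β q.1 (q.2 - f) + (semigroup sbar β q.1 f - semigroup sbar β s f) := by
    rw [semigroup_sub]; abel
  rw [h2]
  exact (norm_add_le _ _).trans (add_le_add (norm_semigroup_le _ _ _ _) le_rfl)

theorem semigroup_zero (sbar β : ℝ) (f : State sbar) : semigroup sbar β 0 f = f := by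
  apply Lp.ext
  filter_upwards [semigroup_coeFn sbar β 0 f, ae_restrict_mem measurableSet_Ioc] with r h1 h2
  rw [h1, shiftFun, mul_zero, sub_zero, indicator_of_mem h2]

/-- Both times must be nonnegative: the intermediate truncation to `(0, sbar]` is harmless only
because mass that has left on the right never returns. -/
theorem semigroup_semigroup {sbar β : ℝ} (hβ : 0 < β) {s t : ℝ} (hs : 0 ≤ s) (ht : 0 ≤ t)
    (f : State sbar) :
    semigroup sbar β s (semigroup sbar β t f) = semigroup sbar β (s + t) f := by
  apply Lp.ext
  filter_upwards [semigroup_coeFn sbar β s (semigroup sbar β t f),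
    semigroup_coeFn sbar β (s + t) f, ae_restrict_mem measurableSet_Ioc,
    ae_restrict_of_ae (shiftFun_congr (s := s) (β := β) (semigroup_coeFn sbar β t f))]
    with r h1 h2 hr h3
  rw [h1, h3, h2]
  have hbs : 0 ≤ β * s := by positivity
  have hbt : 0 ≤ β * t := by positivity
  have e : r - β * (s + t) = r - β * s - β * t := by ring
  simp only [shiftFun, e]
  by_cases h : r - β * s ∈ Ioc 0 sbar
  · rw [indicator_of_mem h]; rfl
  · rw [indicator_of_notMem h, indicator_of_notMem]
    rintro ⟨h4, h5⟩
    exact h ⟨by linarith, by linarith [hr.2]⟩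

theorem semigroup_eq_zero {sbar β s : ℝ} (h : sbar ≤ β * s) (f : State sbar) :
    semigroup sbar β s f = 0 := by
  apply Lp.ext
  filter_upwards [semigroup_coeFn sbar β s f, ae_restrict_mem measurableSet_Ioc,
    Lp.coeFn_zero ℝ 2 (leb sbar)] with r h1 hr h2
  rw [h1, h2, shiftFun, indicator_of_notMem]
  · rfl
  · rintro ⟨h3, -⟩
    linarith [hr.2]

theorem inner_eq_integral {sbar : ℝ} (f g : State sbar) :
    inner ℝ f g = ∫ r, f r * g r ∂(leb sbar) := by
  rw [L2.inner_def]
  refine integral_congr_ae (ae_of_all _ fun r => ?_)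
  simp [mul_comm]

theorem inner_semigroup_left (sbar β s : ℝ) (f g : State sbar) :
    inner ℝ (semigroup sbar β s f) g
      = ∫ r, (Ioc 0 sbar).indicator f (r - β * s) * (Ioc 0 sbar).indicator g r := by
  rw [inner_eq_integral, ← integral_indicator measurableSet_Ioc]
  refine integral_congr_ae ?_
  have h := indicator_ae_eq_of_ae_eq_leb (semigroup_coeFn sbar β s f)
  filter_upwards [h] with r hr
  by_cases h1 : r ∈ Ioc 0 sbar
  · rw [indicator_of_mem h1, indicator_of_mem h1] at hr
    rw [indicator_of_mem h1, indicator_of_mem h1, hr]; rfl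
  · simp [indicator_of_notMem h1]

/-- A change of variable on the line. For negative times `semigroup` is translation to the left, so
`T(-s)` is the adjoint of `T(s)`. -/
theorem inner_semigroup_adjoint (sbar β s : ℝ) (f g : State sbar) :
    inner ℝ (semigroup sbar β s f) g = inner ℝ f (semigroup sbar β (-s) g) := by
  rw [real_inner_comm (semigroup sbar β (-s) g) f, inner_semigroup_left, inner_semigroup_left,
    ← integral_sub_right_eq_self
      (fun r => (Ioc 0 sbar).indicator g (r - β * -s) * (Ioc 0 sbar).indicator f r) (β * s)]
  refine integral_congr_ae (ae_of_all _ fun r => ?_)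
  simp [mul_comm]

/-! ### The `B`-norm -/

theorem inner_toL2_left {sbar : ℝ} {f : ℝ → ℝ} (hf : MemLp f 2 (leb sbar)) (g : State sbar) :
    inner ℝ (toL2 sbar f) g = ∫ r, f r * g r ∂(leb sbar) := by
  rw [inner_eq_integral]
  refine integral_congr_ae ?_
  filter_upwards [toL2_coeFn hf] with r hr
  rw [hr]

theorem inner_toL2_toL2 {sbar : ℝ} {f g : ℝ → ℝ} (hf : MemLp f 2 (leb sbar))
    (hg : MemLp g 2 (leb sbar)) :
    inner ℝ (toL2 sbar f) (toL2 sbar g) = ∫ r, f r * g r ∂(leb sbar) := by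
  rw [inner_toL2_left hf]
  refine integral_congr_ae ?_
  filter_upwards [toL2_coeFn hg] with r hr
  rw [hr]

theorem norm_toL2_sq {sbar : ℝ} {f : ℝ → ℝ} (hf : MemLp f 2 (leb sbar)) :
    ‖toL2 sbar f‖ ^ 2 = ∫ r, f r ^ 2 ∂(leb sbar) := by
  rw [← real_inner_self_eq_norm_sq, inner_toL2_toL2 hf hf]
  simp only [sq]

theorem integrable_state {sbar : ℝ} (f : State sbar) : Integrable f (leb sbar) :=
  (Lp.memLp f).integrable (by norm_num)

theorem integral_abs_state_le {sbar : ℝ} (hs : 0 ≤ sbar) (f : State sbar) :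
    ∫ r, |f r| ∂(leb sbar) ≤ √sbar * ‖f‖ := by
  have h1 : MemLp (fun _ : ℝ => (1 : ℝ)) 2 (leb sbar) := memLp_const 1
  have h2 : ‖toL2 sbar (fun _ => (1 : ℝ))‖ = √sbar := by
    rw [← Real.sqrt_sq (norm_nonneg _), norm_toL2_sq h1]
    simp [hs]
  have h3 : inner ℝ (toL2 sbar (fun _ => (1 : ℝ))) |f| = ∫ r, |f r| ∂(leb sbar) := by
    rw [inner_toL2_left h1]
    refine integral_congr_ae ?_
    filter_upwards [Lp.coeFn_abs f] with r hr
    rw [hr, one_mul]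
  rw [← h3, ← h2, ← norm_abs_eq_norm f]
  exact real_inner_le_norm _ _

/-- The resolvent `(A - lam)⁻¹` on `L²(0, sbar)`. -/
def resolvent (sbar β lam : ℝ) (z : State sbar) : State sbar :=
  toL2 sbar (resolventFun β lam z)

theorem resolvent_coeFn (sbar β lam : ℝ) (z : State sbar) :
    resolvent sbar β lam z =ᵐ[leb sbar] resolventFun β lam z :=
  toL2_coeFn (memLp_resolventFun sbar β lam z)

theorem integrable_mul_state {sbar : ℝ} (f : State sbar) {k : ℝ → ℝ} (hk : Continuous k) :
    Integrable (fun t => k t * f t) (leb sbar) :=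
  (integrableOn_state sbar f k hk).mono_set Ioc_subset_Icc_self

/-- Fubini on the triangle `0 < r < t ≤ sbar`. -/
theorem integral_triangle_swap {sbar : ℝ} {u v : ℝ → ℝ} (hu : Integrable u (leb sbar))
    (hv : Integrable v (leb sbar)) :
    ∫ r, u r * (∫ t in r..sbar, v t) ∂(leb sbar)
      = ∫ t, v t * (∫ r in (0 : ℝ)..t, u r) ∂(leb sbar) := by
  have hS : MeasurableSet {q : ℝ × ℝ | q.1 < q.2} := measurableSet_lt measurable_fst measurable_snd
  have hint : Integrable (Function.uncurry fun r t =>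
      {q : ℝ × ℝ | q.1 < q.2}.indicator (fun q => u q.1 * v q.2) (r, t))
      ((leb sbar).prod (leb sbar)) :=
    (hu.mul_prod hv).indicator hS
  have hsw := integral_integral_swap hint
  refine Eq.trans ?_ (hsw.trans ?_)
  · refine integral_congr_ae ?_
    filter_upwards [ae_restrict_mem measurableSet_Ioc] with r hr
    rw [intervalIntegral.integral_of_le hr.2, ← integral_const_mul]
    have h1 : ∀ t, {q : ℝ × ℝ | q.1 < q.2}.indicator (fun q => u q.1 * v q.2) (r, t)
        = (Ioi r).indicator (fun t => u r * v t) t := by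
      intro t
      simp only [indicator_apply, mem_ofPred_eq, mem_Ioi]
    simp_rw [h1]
    rw [integral_indicator measurableSet_Ioi, Measure.restrict_restrict measurableSet_Ioi]
    congr 2
    ext t
    simp only [mem_inter_iff, mem_Ioi, mem_Ioc]
    constructor
    · exact fun h => ⟨h.1, hr.1.trans h.1, h.2⟩
    · exact fun h => ⟨h.1, h.2.2⟩
  · refine integral_congr_ae ?_
    filter_upwards [ae_restrict_mem measurableSet_Ioc] with t ht
    rw [intervalIntegral.integral_of_le ht.1.le, ← integral_const_mul]
    have h1 : ∀ r, {q : ℝ × ℝ | q.1 < q.2}.indicator (fun q => u q.1 * v q.2) (r, t)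
        = (Iio t).indicator (fun r => v t * u r) r := by
      intro r
      simp only [indicator_apply, mem_ofPred_eq, mem_Iio, mul_comm]
    simp_rw [h1]
    rw [integral_indicator measurableSet_Iio, Measure.restrict_restrict measurableSet_Iio]
    have : Iio t ∩ Ioc 0 sbar = Ioo 0 t := by
      ext r
      simp only [mem_inter_iff, mem_Iio, mem_Ioc, mem_Ioo]
      constructor
      · exact fun h => ⟨h.2.1, h.1⟩
      · exact fun h => ⟨h.2, h.1, h.2.le.trans ht.2⟩
    rw [this, integral_Ioc_eq_integral_Ioo]

theorem inner_adjResolvent (sbar β lam : ℝ) (g z : State sbar) :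
    inner ℝ (toL2 sbar (adjResolventFun sbar β lam g)) z = inner ℝ g (resolvent sbar β lam z) := by
  rw [inner_toL2_left (memLp_adjResolventFun sbar β lam g), real_inner_comm, resolvent,
    inner_toL2_left (memLp_resolventFun sbar β lam z)]
  have h := integral_triangle_swap
    (integrable_mul_state z (k := fun t => Real.exp (lam / β * t)) (by fun_prop))
    (integrable_mul_state g (k := fun t => Real.exp (-(lam / β) * t)) (by fun_prop))
  have h' := congrArg (fun c => -(1 / β) * c) h
  simp only [← integral_const_mul] at h'
  refine Eq.trans (integral_congr_ae (ae_of_all _ fun r => ?_))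
    (h'.trans (integral_congr_ae (ae_of_all _ fun r => ?_)))
  · simp only [adjResolventFun]
    ring
  · simp only [resolventFun]
    ring

/-- The two explicit resolvents have transposed Volterra kernels, so `B = R* R`. All later estimates
of the `B`-norm go through this form. -/
theorem bNorm_eq (sbar β lam : ℝ) (z : State sbar) :
    bNorm sbar β lam z = ‖resolvent sbar β lam z‖ := by
  rw [bNorm, opB, inner_adjResolvent]
  change √(inner ℝ (resolvent sbar β lam z) (resolvent sbar β lam z)) = _
  rw [real_inner_self_eq_norm_sq, Real.sqrt_sq (norm_nonneg _)]

theorem resolvent_smul (sbar β lam c : ℝ) (z : State sbar) :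
    resolvent sbar β lam (c • z) = c • resolvent sbar β lam z := by
  apply Lp.ext
  filter_upwards [resolvent_coeFn sbar β lam (c • z), resolvent_coeFn sbar β lam z,
    Lp.coeFn_smul c (resolvent sbar β lam z), ae_restrict_mem measurableSet_Ioc] with r h1 h2 h3 hr
  rw [h1, h3, Pi.smul_apply, h2, smul_eq_mul, resolventFun, resolventFun]
  have h4 : ∫ τ in (0 : ℝ)..r, Real.exp (lam / β * τ) * (c • z : State sbar) τ
      = c * ∫ τ in (0 : ℝ)..r, Real.exp (lam / β * τ) * z τ := by
    rw [← intervalIntegral.integral_const_mul, intervalIntegral.integral_of_le hr.1.le,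
      intervalIntegral.integral_of_le hr.1.le]
    refine integral_congr_ae ?_
    have h5 := ae_restrict_of_ae_restrict_of_subset (Ioc_subset_Ioc_right hr.2)
      (Lp.coeFn_smul c z)
    filter_upwards [h5] with t ht
    rw [ht, Pi.smul_apply, smul_eq_mul]
    ring
  rw [h4]
  ring

theorem bNorm_smul (sbar β lam c : ℝ) (z : State sbar) :
    bNorm sbar β lam (c • z) = |c| * bNorm sbar β lam z := by
  rw [bNorm_eq, bNorm_eq, resolvent_smul, norm_smul, Real.norm_eq_abs]

theorem bNorm_nonneg (sbar β lam : ℝ) (z : State sbar) : 0 ≤ bNorm sbar β lam z :=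
  Real.sqrt_nonneg _

/-- A generator's resolvent commutes with its semigroup. Here it is checked on the kernel:
substituting `τ - β s` in the integral produces the factor `e^{lam s}` that turns `e^{-(lam/β) r}`
into `e^{-(lam/β)(r - β s)}`. -/
theorem resolvent_semigroup {sbar β s : ℝ} (lam : ℝ) (hβ : 0 < β) (hs : 0 ≤ s) (z : State sbar) :
    resolvent sbar β lam (semigroup sbar β s z) = semigroup sbar β s (resolvent sbar β lam z) := by
  have hbs : 0 ≤ β * s := by positivity
  apply Lp.ext
  filter_upwards [resolvent_coeFn sbar β lam (semigroup sbar β s z),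
    semigroup_coeFn sbar β s (resolvent sbar β lam z),
    ae_restrict_of_ae (s := Ioc 0 sbar)
      (shiftFun_congr (s := s) (β := β) (resolvent_coeFn sbar β lam z)),
    ae_restrict_mem measurableSet_Ioc] with r h1 h2 h3 hr
  rw [h1, h2, h3]
  have h4 : ∫ τ in (0 : ℝ)..r, Real.exp (lam / β * τ) * semigroup sbar β s z τ
      = ∫ τ in (0 : ℝ)..r, Real.exp (lam / β * τ) * (Ioc 0 sbar).indicator z (τ - β * s) := by
    rw [intervalIntegral.integral_of_le hr.1.le, intervalIntegral.integral_of_le hr.1.le]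
    refine integral_congr_ae ?_
    have h5 := ae_restrict_of_ae_restrict_of_subset (Ioc_subset_Ioc_right hr.2)
      (semigroup_coeFn sbar β s z)
    filter_upwards [h5] with t ht
    rw [ht]; rfl
  have h6 := intervalIntegral.integral_comp_sub_right (a := 0) (b := r)
    (fun τ => Real.exp (lam / β * (τ + β * s)) * (Ioc 0 sbar).indicator z τ) (β * s)
  simp only [sub_add_cancel] at h6
  rw [resolventFun, h4, h6, shiftFun]
  by_cases h : r - β * s ∈ Ioc 0 sbar
  · rw [indicator_of_mem h, resolventFun]
    have h7 : ∫ τ in (0 - β * s)..(r - β * s),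
        Real.exp (lam / β * (τ + β * s)) * (Ioc 0 sbar).indicator z τ
        = ∫ τ in (0 : ℝ)..(r - β * s), Real.exp (lam / β * (β * s)) *
          (Real.exp (lam / β * τ) * z τ) := by
      rw [intervalIntegral.integral_of_le (by linarith [hr.1]),
        intervalIntegral.integral_of_le h.1.le,
        ← integral_indicator measurableSet_Ioc, ← integral_indicator measurableSet_Ioc]
      congr 1
      ext τ
      by_cases hτ : τ ∈ Ioc 0 (r - β * s)
      · rw [indicator_of_mem hτ,
          indicator_of_mem (show τ ∈ Ioc (0 - β * s) (r - β * s) from ⟨by linarith [hτ.1], hτ.2⟩),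
          indicator_of_mem (show τ ∈ Ioc 0 sbar from ⟨hτ.1, hτ.2.trans h.2⟩), mul_add, Real.exp_add]
        ring
      · rw [indicator_of_notMem hτ]
        by_cases hτ2 : τ ∈ Ioc (0 - β * s) (r - β * s)
        · rw [indicator_of_mem hτ2, indicator_of_notMem, mul_zero]
          exact fun h8 => hτ ⟨h8.1, hτ2.2⟩
        · rw [indicator_of_notMem hτ2]
    rw [h7, intervalIntegral.integral_const_mul]
    have h8 : Real.exp (-(lam / β) * (r - β * s))
        = Real.exp (-(lam / β) * r) * Real.exp (lam / β * (β * s)) := by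
      rw [← Real.exp_add]
      ring_nf
    rw [h8]
    ring
  -- Here `r ≤ β s`, so the integral only sees nonpositive points, where the extension of `z`
  -- vanishes.
  · rw [indicator_of_notMem h]
    have h7 : ∫ τ in (0 - β * s)..(r - β * s),
        Real.exp (lam / β * (τ + β * s)) * (Ioc 0 sbar).indicator z τ = 0 := by
      rw [intervalIntegral.integral_of_le (by linarith [hr.1])]
      refine (setIntegral_congr_fun (E := ℝ) (g := fun _ => (0 : ℝ)) measurableSet_Ioc
        fun τ hτ => ?_).trans (by simp)
      have : r - β * s ≤ 0 := by
        by_contra h9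
        exact h ⟨not_le.1 h9, by linarith [hr.2]⟩
      simp only
      rw [indicator_of_notMem, mul_zero]
      exact fun h8 => by linarith [h8.1, hτ.2]
    rw [h7]
    simp

theorem bNorm_semigroup_le {sbar β s : ℝ} (lam : ℝ) (hβ : 0 < β) (hs : 0 ≤ s) (z : State sbar) :
    bNorm sbar β lam (semigroup sbar β s z) ≤ bNorm sbar β lam z := by
  rw [bNorm_eq, bNorm_eq, resolvent_semigroup lam hβ hs]
  exact norm_semigroup_le _ _ _ _

theorem bNorm_zero (sbar β lam : ℝ) : bNorm sbar β lam 0 = 0 := by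
  simpa using bNorm_smul sbar β lam 0 0

/-- The kernel is bounded, so `R z` is bounded pointwise by a multiple of `‖z‖`, and the interval
has finite length. This turns `B`-Lipschitz estimates into continuity for the norm. -/
theorem exists_bNorm_le {sbar β lam : ℝ} (hs : 0 ≤ sbar) (hβ : 0 < β) (hlam : 0 < lam) :
    ∃ C : ℝ, 0 ≤ C ∧ ∀ z : State sbar, bNorm sbar β lam z ≤ C * ‖z‖ := by
  have hk : 0 ≤ lam / β := by positivity
  obtain ⟨M, hM⟩ : ∃ M : ℝ, M = 1 / β * (Real.exp (lam / β * sbar) * √sbar) := ⟨_, rfl⟩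
  have hM0 : 0 ≤ M := by rw [hM]; positivity
  refine ⟨(√sbar) * M, by positivity, fun z => ?_⟩
  have hb : ∀ᵐ r ∂(leb sbar), |resolventFun β lam z r| ≤ M * ‖z‖ := by
    filter_upwards [ae_restrict_mem measurableSet_Ioc] with r hr
    have h1 : |∫ τ in (0 : ℝ)..r, Real.exp (lam / β * τ) * z τ|
        ≤ Real.exp (lam / β * sbar) * (√sbar * ‖z‖) := by
      rw [intervalIntegral.integral_of_le hr.1.le]
      refine (norm_integral_le_integral_norm (G := ℝ) _).trans ?_
      calc ∫ τ in Ioc 0 r, ‖Real.exp (lam / β * τ) * z τ‖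
          ≤ ∫ τ in Ioc 0 sbar, ‖Real.exp (lam / β * τ) * z τ‖ :=
            setIntegral_mono_set (μ := volume)
              (integrable_mul_state z (k := fun t => Real.exp (lam / β * t)) (by fun_prop)).norm
              (ae_of_all _ fun _ => norm_nonneg _)
              (Ioc_subset_Ioc_right hr.2).eventuallyLE
        _ ≤ ∫ τ in Ioc 0 sbar, Real.exp (lam / β * sbar) * |z τ| := by
            refine setIntegral_mono_on
              (integrable_mul_state z (k := fun t => Real.exp (lam / β * t)) (by fun_prop)).norm
              ((integrable_state z).abs.const_mul _) measurableSet_Ioc fun τ hτ => ?_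
            rw [norm_mul, Real.norm_eq_abs, Real.norm_eq_abs, Real.abs_exp]
            gcongr
            exact hτ.2
        _ ≤ _ := by
            rw [integral_const_mul]
            gcongr
            exact integral_abs_state_le hs z
    rw [resolventFun, abs_mul, abs_mul, abs_neg, Real.abs_exp,
      abs_of_pos (by positivity : 0 < 1 / β)]
    have h2 : Real.exp (-(lam / β) * r) ≤ 1 := by
      rw [Real.exp_le_one_iff]
      nlinarith [mul_nonneg hk hr.1.le]
    calc _ ≤ 1 / β * (1 * (Real.exp (lam / β * sbar) * (√sbar * ‖z‖))) := by gcongr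
      _ = M * ‖z‖ := by rw [hM]; ring
  rw [bNorm_eq, ← abs_of_nonneg (norm_nonneg (resolvent sbar β lam z))]
  refine abs_le_of_sq_le_sq ?_ (by positivity)
  rw [resolvent, norm_toL2_sq (memLp_resolventFun sbar β lam z)]
  calc ∫ r, resolventFun β lam z r ^ 2 ∂(leb sbar) ≤ ∫ _r, (M * ‖z‖) ^ 2 ∂(leb sbar) := by
        refine integral_mono_ae (memLp_resolventFun sbar β lam z).integrable_sq
          (integrable_const _) ?_
        filter_upwards [hb] with r hr
        exact sq_le_sq' (by linarith [neg_abs_le (resolventFun β lam z r)])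
          ((le_abs_self _).trans hr)
    _ = (√sbar * M * ‖z‖) ^ 2 := by
        simp only [integral_const, smul_eq_mul]
        rw [mul_assoc, mul_pow (√sbar), Real.sq_sqrt hs]
        simp [hs]

/-! ### Bounds on the controls -/

theorem exists_norm_controlValues_le (sbar : ℝ) {Λ : Set ℝ} (hΛ : IsCompact Λ) :
    ∃ M : ℝ, 0 ≤ M ∧ ∀ γ ∈ controlValues sbar Λ, ‖γ‖ ≤ M := by
  obtain ⟨K, hK⟩ := hΛ.isBounded.exists_norm_le
  refine ⟨(leb sbar).real univ ^ (ENNReal.toReal 2)⁻¹ * |K|, by positivity, fun γ hγ => ?_⟩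
  refine Lp.norm_le_of_ae_bound (abs_nonneg K) ?_
  filter_upwards [hγ] with r hr
  exact (hK _ hr).trans (le_abs_self K)

theorem abs_le_setNorm {Γ : Set ℝ} (hΓ : IsCompact Γ) {a : ℝ} (ha : a ∈ Γ) : |a| ≤ setNorm Γ :=
  le_csSup (hΓ.image continuous_abs).bddAbove ⟨a, ha, rfl⟩

theorem setNorm_nonneg {Γ : Set ℝ} : 0 ≤ setNorm Γ := by
  refine Real.sSup_nonneg ?_
  rintro _ ⟨a, -, rfl⟩
  exact abs_nonneg a

theorem const_mem_controlValues (sbar : ℝ) {Λ : Set ℝ} {c : ℝ} (hc : c ∈ Λ) :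
    toL2 sbar (fun _ => c) ∈ controlValues sbar Λ := by
  have h : MemLp (fun _ : ℝ => c) 2 (leb sbar) := memLp_const c
  filter_upwards [toL2_coeFn h] with r hr
  rw [hr]; exact hc

theorem const_mem_distributedControls {sbar : ℝ} {Λ : Set ℝ} {γ : State sbar}
    (h : γ ∈ controlValues sbar Λ) : (fun _ => γ) ∈ distributedControls sbar Λ :=
  ⟨stronglyMeasurable_const, fun _ _ => h⟩

theorem const_mem_boundaryControls {Γ : Set ℝ} {c : ℝ} (h : c ∈ Γ) :
    (fun _ => c) ∈ boundaryControls Γ :=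
  ⟨measurable_const, fun _ _ => h⟩

theorem shift_mem_distributedControls {sbar : ℝ} {Λ : Set ℝ} {α : ℝ → State sbar}
    (h : α ∈ distributedControls sbar Λ) {t : ℝ} (ht : 0 ≤ t) :
    (fun s => α (t + s)) ∈ distributedControls sbar Λ :=
  ⟨h.1.comp_measurable (measurable_const_add t), fun _ hs => h.2 _ (add_nonneg ht hs)⟩

theorem shift_mem_boundaryControls {Γ : Set ℝ} {a : ℝ → ℝ}
    (h : a ∈ boundaryControls Γ) {t : ℝ} (ht : 0 ≤ t) :
    (fun s => a (t + s)) ∈ boundaryControls Γ :=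
  ⟨h.1.comp (measurable_const_add t), fun _ hs => h.2 _ (add_nonneg ht hs)⟩

/-- Follow the first control up to time `h` and the second one, restarted, from then on. -/
def concat {X : Type*} (h : ℝ) (u v : ℝ → X) (s : ℝ) : X :=
  open Classical in if s < h then u s else v (s - h)

theorem concat_of_lt {X : Type*} {h s : ℝ} (hs : s < h) (u v : ℝ → X) :
    concat h u v s = u s := by rw [concat, if_pos hs]

theorem concat_add {X : Type*} {h s : ℝ} (hs : 0 ≤ s) (u v : ℝ → X) :
    concat h u v (h + s) = v s := by
  rw [concat, if_neg (by linarith), add_sub_cancel_left]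

theorem concat_mem_distributedControls {sbar : ℝ} {Λ : Set ℝ} {α α' : ℝ → State sbar}
    (h : α ∈ distributedControls sbar Λ) (h' : α' ∈ distributedControls sbar Λ) (t : ℝ) :
    concat t α α' ∈ distributedControls sbar Λ := by
  refine ⟨?_, fun s hs => ?_⟩
  · exact StronglyMeasurable.ite measurableSet_Iio h.1
      (h'.1.comp_measurable (measurable_sub_const t))
  · unfold concat
    split_ifs with h1
    · exact h.2 s hs
    · exact h'.2 _ (by linarith)

theorem concat_mem_boundaryControls {Γ : Set ℝ} {a a' : ℝ → ℝ}
    (h : a ∈ boundaryControls Γ) (h' : a' ∈ boundaryControls Γ) (t : ℝ) :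
    concat t a a' ∈ boundaryControls Γ := by
  refine ⟨?_, fun s hs => ?_⟩
  · exact Measurable.ite measurableSet_Iio h.1 (h'.1.comp (measurable_sub_const t))
  · unfold concat
    split_ifs with h1
    · exact h.2 s hs
    · exact h'.2 _ (by linarith)

/-! ### The Duhamel term -/

/-- The contribution of the distributed control at time `s`. -/
def duhamel (sbar β μ : ℝ) (α : ℝ → State sbar) (s : ℝ) : State sbar :=
  ∫ τ in (0 : ℝ)..s, Real.exp (-μ * (s - τ)) • semigroup sbar β (s - τ) (α τ)

theorem trajectory_eq (sbar β μ : ℝ) (x : State sbar) (α : ℝ → State sbar) (a : ℝ → ℝ) (s : ℝ) :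
    trajectory sbar β μ x α a s = Real.exp (-μ * s) • semigroup sbar β s x
      + toL2 sbar (boundaryFun β μ a s) + duhamel sbar β μ α s := rfl

theorem stronglyMeasurable_duhamel_integrand (sbar β μ : ℝ) {α : ℝ → State sbar}
    (hα : StronglyMeasurable α) :
    StronglyMeasurable fun q : ℝ × ℝ =>
      Real.exp (-μ * (q.1 - q.2)) • semigroup sbar β (q.1 - q.2) (α q.2) := by
  have h1 : StronglyMeasurable fun q : ℝ × ℝ => (q.1 - q.2, α q.2) :=
    (by fun_prop : Continuous fun q : ℝ × ℝ => q.1 - q.2).stronglyMeasurable.prodMk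
      (hα.comp_measurable measurable_snd)
  have h2 := (continuous_semigroup sbar β).comp_stronglyMeasurable h1
  exact (by fun_prop : Continuous fun q : ℝ × ℝ =>
    Real.exp (-μ * (q.1 - q.2))).stronglyMeasurable.smul h2

theorem norm_duhamel_integrand_le {sbar β μ s τ M h : ℝ} (h1 : 0 ≤ s - τ) (h2 : s - τ ≤ h)
    {γ : State sbar} (hγ : ‖γ‖ ≤ M) :
    ‖Real.exp (-μ * (s - τ)) • semigroup sbar β (s - τ) γ‖ ≤ Real.exp (|μ| * h) * M := by
  rw [norm_smul, Real.norm_eq_abs, Real.abs_exp]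
  have h3 : -μ * (s - τ) ≤ |μ| * h := by
    calc -μ * (s - τ) ≤ |μ| * (s - τ) := by gcongr; exact neg_le_abs μ
      _ ≤ |μ| * h := by gcongr
  have h4 := (norm_semigroup_le sbar β (s - τ) γ).trans hγ
  gcongr

theorem intervalIntegrable_duhamel {sbar β μ : ℝ} {Λ : Set ℝ}
    (hΛ : IsCompact Λ) {α : ℝ → State sbar} (hα : α ∈ distributedControls sbar Λ)
    {s t u : ℝ} (ht : 0 ≤ t) (htu : t ≤ u) (hus : u ≤ s) :
    IntervalIntegrable (fun τ => Real.exp (-μ * (s - τ)) • semigroup sbar β (s - τ) (α τ))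
      volume t u := by
  obtain ⟨M, hM0, hM⟩ := exists_norm_controlValues_le sbar hΛ
  rw [intervalIntegrable_iff, uIoc_of_le htu]
  refine Measure.integrableOn_of_bounded (M := Real.exp (|μ| * s) * M) (by simp)
    ((stronglyMeasurable_duhamel_integrand sbar β μ hα.1).comp_measurable
      (measurable_prodMk_left (x := s))).aestronglyMeasurable ?_
  filter_upwards [ae_restrict_mem measurableSet_Ioc] with τ hτ
  exact norm_duhamel_integrand_le (by linarith [hτ.2]) (by linarith [hτ.1])
    (hM _ (hα.2 τ (by linarith [hτ.1])))

theorem norm_duhamel_le {sbar β μ M : ℝ} {Λ : Set ℝ}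
    (hM : ∀ γ ∈ controlValues sbar Λ, ‖γ‖ ≤ M) {α : ℝ → State sbar}
    (hα : α ∈ distributedControls sbar Λ) {s : ℝ} (h0 : 0 ≤ s) :
    ‖duhamel sbar β μ α s‖ ≤ Real.exp (|μ| * s) * M * s := by
  have h := intervalIntegral.norm_integral_le_of_norm_le_const (a := 0) (b := s)
    (f := fun τ => Real.exp (-μ * (s - τ)) • semigroup sbar β (s - τ) (α τ))
    (C := Real.exp (|μ| * s) * M) (fun τ hτ => by
      rw [uIoc_of_le h0] at hτ
      exact norm_duhamel_integrand_le (by linarith [hτ.2]) (by linarith [hτ.1])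
        (hM _ (hα.2 τ hτ.1.le)))
  rwa [sub_zero, abs_of_nonneg h0] at h

/-- Split the integral at `t`; in the first piece `e^{-μs} T(s)` factors out by the semigroup law.
-/
theorem duhamel_add {sbar β μ : ℝ} (hβ : 0 < β) {Λ : Set ℝ}
    (hΛ : IsCompact Λ) {α : ℝ → State sbar} (hα : α ∈ distributedControls sbar Λ)
    {t s : ℝ} (ht : 0 ≤ t) (h0 : 0 ≤ s) :
    duhamel sbar β μ α (t + s) = Real.exp (-μ * s) • semigroup sbar β s (duhamel sbar β μ α t)
      + duhamel sbar β μ (fun τ => α (t + τ)) s := by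
  have h1 := intervalIntegral.integral_add_adjacent_intervals (μ := volume)
    (intervalIntegrable_duhamel (β := β) (μ := μ) hΛ hα le_rfl ht
      (le_add_of_nonneg_right h0 : t ≤ t + s))
    (intervalIntegrable_duhamel (β := β) (μ := μ) hΛ hα ht (le_add_of_nonneg_right h0)
      (le_refl (t + s)))
  rw [duhamel, ← h1]
  congr 1
  · rw [duhamel, ← semigroupL_apply, ← ContinuousLinearMap.intervalIntegral_comp_comm _
      (intervalIntegrable_duhamel hΛ hα le_rfl ht le_rfl), ← intervalIntegral.integral_smul]
    refine intervalIntegral.integral_congr fun τ hτ => ?_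
    rw [uIcc_of_le ht] at hτ
    simp only [map_smul, semigroupL_apply]
    rw [semigroup_semigroup hβ h0 (by linarith [hτ.2]), smul_smul, ← Real.exp_add]
    ring_nf
  · have h2 := intervalIntegral.integral_comp_add_left (a := 0) (b := s)
      (fun τ => Real.exp (-μ * (t + s - τ)) • semigroup sbar β (t + s - τ) (α τ)) t
    rw [add_zero] at h2
    rw [← h2, duhamel]
    simp only [add_sub_add_left_eq_sub]

theorem duhamel_congr {sbar β μ s : ℝ} (h0 : 0 ≤ s) {α α' : ℝ → State sbar}
    (h : ∀ τ, 0 ≤ τ → τ < s → α τ = α' τ) :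
    duhamel sbar β μ α s = duhamel sbar β μ α' s := by
  rw [duhamel, duhamel, intervalIntegral.integral_of_le h0, intervalIntegral.integral_of_le h0,
    integral_Ioc_eq_integral_Ioo, integral_Ioc_eq_integral_Ioo]
  refine setIntegral_congr_fun measurableSet_Ioo fun τ hτ => ?_
  rw [h τ hτ.1.le hτ.2]

/-- The integral is a partial integral of a jointly measurable function cut off to `0 < τ ≤ s`;
measurability in `s` is all that the cost requires. -/
theorem aestronglyMeasurable_duhamel {sbar β μ : ℝ} {α : ℝ → State sbar}
    (hα : StronglyMeasurable α) :
    AEStronglyMeasurable (duhamel sbar β μ α) (volume.restrict (Ioi 0)) := by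
  have hS : MeasurableSet {q : ℝ × ℝ | 0 < q.2 ∧ q.2 ≤ q.1} :=
    (measurableSet_lt measurable_const measurable_snd).inter
      (measurableSet_le measurable_snd measurable_fst)
  have h := ((stronglyMeasurable_duhamel_integrand sbar β μ hα).indicator hS).integral_prod_right'
    (ν := volume)
  refine ⟨_, h, ?_⟩
  filter_upwards [ae_restrict_mem measurableSet_Ioi] with s hs
  rw [duhamel, intervalIntegral.integral_of_le (le_of_lt hs),
    ← integral_indicator measurableSet_Ioc]
  rfl

/-! ### The boundary term -/

theorem boundaryFun_congr {β μ s : ℝ} (sbar : ℝ) (hβ : 0 < β) {a a' : ℝ → ℝ}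
    (h : ∀ τ, 0 ≤ τ → τ < s → a τ = a' τ) :
    toL2 sbar (boundaryFun β μ a s) = toL2 sbar (boundaryFun β μ a' s) := by
  refine toL2_congr ?_
  filter_upwards [ae_restrict_mem measurableSet_Ioc] with r hr
  unfold boundaryFun
  split_ifs with h1
  · have h2 : 0 < r / β := div_pos hr.1 hβ
    have h3 : r / β < s := by rw [div_lt_iff₀ hβ]; linarith
    rw [h _ (by linarith) (by linarith)]
  · rfl

/-- What entered before time `t` has been carried into `r > β s` and damped by `e^{-μs}`; what
entered afterwards fills `r < β s`. -/
theorem toL2_boundaryFun_add {sbar β μ : ℝ} (hβ : 0 < β) {Γ : Set ℝ} (hΓ : IsCompact Γ)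
    {a : ℝ → ℝ} (ha : a ∈ boundaryControls Γ) {t s : ℝ} (ht : 0 ≤ t) (h0 : 0 ≤ s) :
    toL2 sbar (boundaryFun β μ a (t + s))
      = Real.exp (-μ * s) • semigroup sbar β s (toL2 sbar (boundaryFun β μ a t))
        + toL2 sbar (boundaryFun β μ (fun τ => a (t + τ)) s) := by
  have hbs : 0 ≤ β * s := by positivity
  have hbt : 0 ≤ β * t := by positivity
  have m1 := memLp_boundaryFun sbar β μ hβ Γ hΓ a ha (t + s)
  have m2 := memLp_boundaryFun sbar β μ hβ Γ hΓ a ha t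
  have m3 := memLp_boundaryFun sbar β μ hβ Γ hΓ _ (shift_mem_boundaryControls ha ht) s
  -- At `r = β s` both terms on the right vanish, by the half-open conventions, while the left side
  -- need not.
  have hne : ∀ᵐ r ∂(leb sbar), r ≠ β * s := ae_restrict_of_ae (by simp [ae_iff])
  apply Lp.ext
  refine (toL2_coeFn m1).trans (EventuallyEq.symm ?_)
  refine (Lp.coeFn_add _ _).trans ?_
  filter_upwards [Lp.coeFn_smul (Real.exp (-μ * s))
      (semigroup sbar β s (toL2 sbar (boundaryFun β μ a t))),
    semigroup_coeFn sbar β s (toL2 sbar (boundaryFun β μ a t)),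
    ae_restrict_of_ae (s := Ioc 0 sbar) (shiftFun_congr (s := s) (β := β) (toL2_coeFn m2)),
    toL2_coeFn m3, ae_restrict_mem measurableSet_Ioc, hne] with r h1 h2 h3 h4 hr hrne
  rw [Pi.add_apply, h1, Pi.smul_apply, h2, h3, h4, smul_eq_mul]
  unfold shiftFun boundaryFun
  by_cases h5 : r < β * s
  · rw [indicator_of_notMem (fun h => by linarith [h.1]), if_pos h5,
      if_pos (by rw [mul_add]; linarith)]
    ring_nf
  · have h6 : 0 < r - β * s := by
      rcases lt_or_eq_of_le (not_lt.1 h5) with h | h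
      · linarith
      · exact absurd h.symm hrne
    rw [indicator_of_mem (show r - β * s ∈ Ioc 0 sbar from ⟨h6, by linarith [hr.2]⟩),
      if_neg h5, add_zero]
    by_cases h7 : r < β * (t + s)
    · rw [if_pos h7, if_pos (by rw [mul_add] at h7; linarith), ← mul_assoc, ← Real.exp_add]
      congr 2
      · field_simp; ring
      · field_simp; ring
    · rw [if_neg h7, if_neg (by rw [mul_add] at h7; linarith), mul_zero]

/-- The inflow is bounded and lives on an interval of length `β s`. Its norm is thus only of order
`√s`, and its square contributes at first order: this is the origin of the term `β‖Γ‖²/2`. -/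
theorem norm_boundary_sq_le {sbar β μ : ℝ} (hβ : 0 < β) {Γ : Set ℝ} (hΓ : IsCompact Γ)
    {a : ℝ → ℝ} (ha : a ∈ boundaryControls Γ) {s : ℝ} (h0 : 0 ≤ s) :
    ‖toL2 sbar (boundaryFun β μ a s)‖ ^ 2
      ≤ Real.exp (|μ| * s) ^ 2 * setNorm Γ ^ 2 * (β * s) := by
  have hbs : 0 ≤ β * s := by positivity
  have m := memLp_boundaryFun sbar β μ hβ Γ hΓ a ha s
  rw [norm_toL2_sq m]
  have hint : IntegrableOn (fun _ : ℝ => Real.exp (|μ| * s) ^ 2 * setNorm Γ ^ 2)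
      (Ioc 0 (β * s)) := integrableOn_const (by simp)
  calc ∫ r in Ioc 0 sbar, boundaryFun β μ a s r ^ 2
      ≤ ∫ r in Ioc 0 sbar, (Ioc 0 (β * s)).indicator
          (fun _ => Real.exp (|μ| * s) ^ 2 * setNorm Γ ^ 2) r := by
        refine integral_mono_ae m.integrable_sq
          ((integrable_const _).indicator measurableSet_Ioc) ?_
        filter_upwards [ae_restrict_mem measurableSet_Ioc] with r hr
        unfold boundaryFun
        split_ifs with h1
        · rw [indicator_of_mem (show r ∈ Ioc 0 (β * s) from ⟨hr.1, h1.le⟩), mul_pow]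
          have h2 : 0 < r / β := div_pos hr.1 hβ
          have h3 : r / β < s := by rw [div_lt_iff₀ hβ]; linarith
          have h4 := abs_le_setNorm hΓ (ha.2 (s - r / β) (by linarith))
          have h5 : -(μ / β) * r ≤ |μ| * s := by
            calc -(μ / β) * r = -μ * (r / β) := by ring
              _ ≤ |μ| * (r / β) := by gcongr; exact neg_le_abs μ
              _ ≤ |μ| * s := by gcongr
          rw [← sq_abs (a _)]
          gcongr
        · rw [zero_pow two_ne_zero]
          exact indicator_nonneg (fun _ _ => by positivity) r
    _ ≤ ∫ r, (Ioc 0 (β * s)).indicator (fun _ => Real.exp (|μ| * s) ^ 2 * setNorm Γ ^ 2) r :=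
        setIntegral_le_integral (hint.integrable_indicator measurableSet_Ioc)
          (ae_of_all _ fun r => indicator_nonneg (fun _ _ => by positivity) r)
    _ = _ := by
        rw [integral_indicator measurableSet_Ioc]
        simp only [integral_const, smul_eq_mul]
        simp [hbs, mul_comm]

/-! ### Regularity in time and the flow property of the trajectories -/

theorem continuous_boundary {sbar β μ : ℝ} (hβ : 0 < β) {Γ : Set ℝ} (hΓ : IsCompact Γ)
    {a : ℝ → ℝ} (ha : a ∈ boundaryControls Γ) :
    Continuous fun s => toL2 sbar (boundaryFun β μ a s) := by
  rw [continuous_iff_continuousAt]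
  intro s₀
  obtain ⟨S, hS⟩ : ∃ S : ℝ, S = s₀ + 1 := ⟨_, rfl⟩
  -- The boundary control is read as a profile waiting on the negative half line: the inflow at time
  -- `s` is `e^{-μs}` times the translate of `ψ` by `β s`. The cutoff at `-β S` makes `ψ` square
  -- integrable and is invisible for `s < S`.
  obtain ⟨ψ, hψ⟩ : ∃ ψ : ℝ → ℝ, ψ = (Ioo (-(β * S)) 0).indicator
    (fun y => Real.exp (-(μ / β) * y) * a (-y / β)) := ⟨_, rfl⟩
  have hψm : MemLp ψ 2 volume := by
    rw [hψ, memLp_indicator_iff_restrict measurableSet_Ioo]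
    have : IsFiniteMeasure (volume.restrict (Ioo (-(β * S)) 0)) := ⟨by simp⟩
    have hm : Measurable fun y => Real.exp (-(μ / β) * y) * a (-y / β) :=
      (by fun_prop : Measurable fun r : ℝ => Real.exp (-(μ / β) * r)).mul
        (ha.1.comp (by fun_prop))
    refine MemLp.of_bound hm.aestronglyMeasurable (Real.exp (|μ / β| * (β * S)) * setNorm Γ) ?_
    filter_upwards [ae_restrict_mem measurableSet_Ioo] with y hy
    rw [norm_mul, Real.norm_eq_abs, Real.norm_eq_abs, Real.abs_exp]
    have h1 := abs_le_setNorm hΓ (ha.2 (-y / β) (div_nonneg (by linarith [hy.2]) hβ.le))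
    have h2 : -(μ / β) * y ≤ |μ / β| * (β * S) := by
      calc -(μ / β) * y = (μ / β) * (-y) := by ring
        _ ≤ |μ / β| * (-y) := by
          refine mul_le_mul_of_nonneg_right (le_abs_self _) ?_
          linarith [hy.2]
        _ ≤ |μ / β| * (β * S) := by gcongr; linarith [hy.1]
    gcongr
  have hc : Continuous fun s => Real.exp (-μ * s) • LpToLpRestrictCLM ℝ ℝ ℝ volume 2 (Ioc 0 sbar)
      (Lp.compMeasurePreserving _ (measurePreserving_sub_mul β s) (hψm.toLp ψ)) := by
    refine (by fun_prop : Continuous fun s : ℝ => Real.exp (-μ * s)).smul ?_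
    refine (LpToLpRestrictCLM ℝ ℝ ℝ volume 2 (Ioc 0 sbar)).continuous.comp ?_
    let G : C(ℝ, C(ℝ, ℝ)) :=
      ContinuousMap.curry ⟨fun q : ℝ × ℝ => q.2 - β * q.1, by fun_prop⟩
    exact (continuous_const (y := hψm.toLp ψ)).compMeasurePreservingLp (p := 2) G.continuous
      (fun s => measurePreserving_sub_mul β s) (by norm_num)
  refine hc.continuousAt.congr ?_
  filter_upwards [Iio_mem_nhds (show s₀ < S by linarith)] with s hs
  apply Lp.ext
  refine EventuallyEq.trans ?_ (toL2_coeFn (memLp_boundaryFun sbar β μ hβ Γ hΓ a ha s)).symm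
  filter_upwards [Lp.coeFn_smul (Real.exp (-μ * s)) (LpToLpRestrictCLM ℝ ℝ ℝ volume 2 (Ioc 0 sbar)
      (Lp.compMeasurePreserving _ (measurePreserving_sub_mul β s) (hψm.toLp ψ))),
    LpToLpRestrictCLM_coeFn ℝ (Ioc 0 sbar)
      (Lp.compMeasurePreserving _ (measurePreserving_sub_mul β s) (hψm.toLp ψ)),
    ae_restrict_of_ae (s := Ioc 0 sbar)
      (Lp.coeFn_compMeasurePreserving (hψm.toLp ψ) (measurePreserving_sub_mul β s)),
    ae_restrict_of_ae (s := Ioc 0 sbar)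
      ((measurePreserving_sub_mul β s).quasiMeasurePreserving.ae_eq_comp hψm.coeFn_toLp),
    ae_restrict_mem measurableSet_Ioc] with r h1 h2 h3 h4 hr
  rw [h1, Pi.smul_apply, h2, h3, h4, smul_eq_mul, hψ]
  unfold boundaryFun
  have hs' : β * s < β * S := mul_lt_mul_of_pos_left hs hβ
  by_cases h5 : r < β * s
  · rw [if_pos h5, Function.comp_apply,
      indicator_of_mem (show r - β * s ∈ Ioo (-(β * S)) 0 from ⟨by linarith [hr.1], by linarith⟩),
      ← mul_assoc, ← Real.exp_add]
    congr 2
    · field_simp; ring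
    · field_simp; ring
  · rw [if_neg h5, Function.comp_apply, indicator_of_notMem (fun h => h5 (by linarith [h.2])),
      mul_zero]

theorem aestronglyMeasurable_trajectory {sbar β μ : ℝ} (hβ : 0 < β) {Γ Λ : Set ℝ}
    (hΓ : IsCompact Γ) (x : State sbar) {α : ℝ → State sbar}
    (hα : α ∈ distributedControls sbar Λ) {a : ℝ → ℝ} (ha : a ∈ boundaryControls Γ) :
    AEStronglyMeasurable (trajectory sbar β μ x α a) (volume.restrict (Ioi 0)) := by
  have h1 : Continuous fun s => Real.exp (-μ * s) • semigroup sbar β s x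
      + toL2 sbar (boundaryFun β μ a s) :=
    ((by fun_prop : Continuous fun s : ℝ => Real.exp (-μ * s)).smul
      (continuous_semigroup_left sbar β x)).add (continuous_boundary hβ hΓ ha)
  exact h1.aestronglyMeasurable.add (aestronglyMeasurable_duhamel hα.1)

theorem trajectory_add {sbar β μ : ℝ} (hβ : 0 < β) {Γ Λ : Set ℝ}
    (hΓ : IsCompact Γ) (hΛ : IsCompact Λ) (x : State sbar) {α : ℝ → State sbar}
    (hα : α ∈ distributedControls sbar Λ) {a : ℝ → ℝ} (ha : a ∈ boundaryControls Γ)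
    {t s : ℝ} (ht : 0 ≤ t) (hs : 0 ≤ s) :
    trajectory sbar β μ x α a (t + s) = trajectory sbar β μ (trajectory sbar β μ x α a t)
      (fun τ => α (t + τ)) (fun τ => a (t + τ)) s := by
  rw [trajectory_eq, trajectory_eq, trajectory_eq sbar β μ x, duhamel_add hβ hΛ hα ht hs,
    toL2_boundaryFun_add hβ hΓ ha ht hs, semigroup_add, semigroup_add, semigroup_smul,
    semigroup_semigroup hβ hs ht, smul_add, smul_add, smul_smul, ← Real.exp_add, add_comm s t]
  have : -μ * s + -μ * t = -μ * (t + s) := by ring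
  rw [this]
  abel

theorem trajectory_congr {sbar β μ s : ℝ} (hβ : 0 < β) (hs : 0 ≤ s) (x : State sbar)
    {α α' : ℝ → State sbar} (hα : ∀ τ, 0 ≤ τ → τ < s → α τ = α' τ)
    {a a' : ℝ → ℝ} (ha : ∀ τ, 0 ≤ τ → τ < s → a τ = a' τ) :
    trajectory sbar β μ x α a s = trajectory sbar β μ x α' a' s := by
  rw [trajectory_eq, trajectory_eq, boundaryFun_congr sbar hβ ha, duhamel_congr hs hα]

theorem trajectory_sub (sbar β μ : ℝ) (x y : State sbar) (α : ℝ → State sbar) (a : ℝ → ℝ)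
    (s : ℝ) : trajectory sbar β μ x α a s - trajectory sbar β μ y α a s
      = Real.exp (-μ * s) • semigroup sbar β s (x - y) := by
  rw [trajectory_eq, trajectory_eq, semigroup_sub, smul_sub]
  abel

/-- After time `sbar / β` the initial data have left the interval, so the bound is uniform in `s`
even for `μ < 0` and no condition relating `ρ` and `μ` arises. -/
theorem bNorm_trajectory_sub_le {sbar β : ℝ} (μ lam : ℝ) (hβ : 0 < β)
    (x y : State sbar) (α : ℝ → State sbar) (a : ℝ → ℝ) {s : ℝ} (hs : 0 ≤ s) :
    bNorm sbar β lam (trajectory sbar β μ x α a s - trajectory sbar β μ y α a s)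
      ≤ Real.exp (|μ| * (sbar / β)) * bNorm sbar β lam (x - y) := by
  rw [trajectory_sub]
  rcases le_or_gt sbar (β * s) with h | h
  · rw [semigroup_eq_zero h, smul_zero, bNorm_zero]
    exact mul_nonneg (Real.exp_pos _).le (bNorm_nonneg _ _ _ _)
  · rw [bNorm_smul, Real.abs_exp]
    have h1 : s ≤ sbar / β := by rw [le_div_iff₀ hβ]; linarith
    have h2 : -μ * s ≤ |μ| * (sbar / β) := by
      calc -μ * s ≤ |μ| * s := by gcongr; exact neg_le_abs μ
        _ ≤ _ := by gcongr
    have h3 := bNorm_semigroup_le lam hβ hs (x - y)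
    have h4 := bNorm_nonneg sbar β lam (semigroup sbar β s (x - y))
    gcongr

/-- Small positive times, uniformly with respect to the admissible controls. -/
def smallTime (sbar : ℝ) (Γ Λ : Set ℝ) : Filter (ℝ × (ℝ → State sbar) × (ℝ → ℝ)) :=
  𝓝[>] 0 ×ˢ 𝓟 (distributedControls sbar Λ ×ˢ boundaryControls Γ)

theorem eventually_smallTime {sbar : ℝ} {Γ Λ : Set ℝ}
    {P : ℝ × (ℝ → State sbar) × (ℝ → ℝ) → Prop} :
    (∀ᶠ q in smallTime sbar Γ Λ, P q) ↔ ∃ δ > 0, ∀ h, 0 < h → h < δ →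
      ∀ α ∈ distributedControls sbar Λ, ∀ a ∈ boundaryControls Γ, P (h, α, a) := by
  rw [smallTime, eventually_prod_principal_iff]
  constructor
  · intro h
    obtain ⟨δ, hδ, h1⟩ := mem_nhdsGT_iff_exists_Ioo_subset.1 h
    exact ⟨δ, hδ, fun s h0 hs α hα a ha => h1 ⟨h0, hs⟩ (α, a) ⟨hα, ha⟩⟩
  · rintro ⟨δ, hδ, h1⟩
    filter_upwards [Ioo_mem_nhdsGT hδ] with s hs q hq
    exact h1 s hs.1 hs.2 q.1 hq.1 q.2 hq.2

theorem eventually_admissible (sbar : ℝ) (Γ Λ : Set ℝ) :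
    ∀ᶠ q in smallTime sbar Γ Λ,
      0 < q.1 ∧ q.2.1 ∈ distributedControls sbar Λ ∧ q.2.2 ∈ boundaryControls Γ :=
  eventually_smallTime.2 ⟨1, one_pos, fun _ h _ _ hα _ ha => ⟨h, hα, ha⟩⟩

/-- The neighbourhoods in `smallTime` are full intervals `(0, δ)`, uniform in the controls, so they
also contain all earlier times. -/
theorem Eventually.forall_earlier {sbar : ℝ} {Γ Λ : Set ℝ}
    {P : ℝ × (ℝ → State sbar) × (ℝ → ℝ) → Prop} (hP : ∀ᶠ q in smallTime sbar Γ Λ, P q) :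
    ∀ᶠ q in smallTime sbar Γ Λ, ∀ τ, 0 < τ → τ ≤ q.1 → P (τ, q.2) := by
  rw [eventually_smallTime] at hP ⊢
  obtain ⟨δ, hδ, h⟩ := hP
  exact ⟨δ, hδ, fun s _ hs α hα a ha τ h0 hτ => h τ h0 (hτ.trans_lt hs) α hα a ha⟩

theorem tendsto_fst_smallTime (sbar : ℝ) (Γ Λ : Set ℝ) :
    Tendsto Prod.fst (smallTime sbar Γ Λ) (𝓝 0) :=
  tendsto_fst.mono_right nhdsWithin_le_nhds

theorem tendsto_boundary {sbar β μ : ℝ} (hβ : 0 < β) {Γ Λ : Set ℝ} (hΓ : IsCompact Γ) :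
    Tendsto (fun q : ℝ × (ℝ → State sbar) × (ℝ → ℝ) => toL2 sbar (boundaryFun β μ q.2.2 q.1))
      (smallTime sbar Γ Λ) (𝓝 0) := by
  rw [tendsto_zero_iff_norm_tendsto_zero]
  have hc : Continuous fun s : ℝ => √(Real.exp (|μ| * s) ^ 2 * setNorm Γ ^ 2 * (β * s)) := by
    fun_prop
  have h0 := (hc.tendsto 0).comp (tendsto_fst_smallTime sbar Γ Λ)
  simp only [mul_zero, Real.sqrt_zero] at h0
  refine squeeze_zero' (Eventually.of_forall fun _ => norm_nonneg _) ?_ h0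
  filter_upwards [eventually_admissible sbar Γ Λ] with q hq
  exact Real.le_sqrt_of_sq_le (norm_boundary_sq_le hβ hΓ hq.2.2 hq.1.le)

theorem tendsto_duhamel {sbar β μ : ℝ} {Γ Λ : Set ℝ} (hΛ : IsCompact Λ) :
    Tendsto (fun q : ℝ × (ℝ → State sbar) × (ℝ → ℝ) => duhamel sbar β μ q.2.1 q.1)
      (smallTime sbar Γ Λ) (𝓝 0) := by
  obtain ⟨M, hM0, hM⟩ := exists_norm_controlValues_le sbar hΛ
  rw [tendsto_zero_iff_norm_tendsto_zero]
  have hc : Continuous fun s : ℝ => Real.exp (|μ| * s) * M * s := by fun_prop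
  have h0 := (hc.tendsto 0).comp (tendsto_fst_smallTime sbar Γ Λ)
  simp only [mul_zero] at h0
  refine squeeze_zero' (Eventually.of_forall fun _ => norm_nonneg _) ?_ h0
  filter_upwards [eventually_admissible sbar Γ Λ] with q hq
  exact norm_duhamel_le hM hq.2.1 hq.1.le

theorem tendsto_trajectory {sbar β μ : ℝ} (hβ : 0 < β) {Γ Λ : Set ℝ} (hΓ : IsCompact Γ)
    (hΛ : IsCompact Λ) (x : State sbar) :
    Tendsto (fun q : ℝ × (ℝ → State sbar) × (ℝ → ℝ) => trajectory sbar β μ x q.2.1 q.2.2 q.1)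
      (smallTime sbar Γ Λ) (𝓝 x) := by
  have hc : Continuous fun s => Real.exp (-μ * s) • semigroup sbar β s x :=
    (by fun_prop : Continuous fun s : ℝ => Real.exp (-μ * s)).smul
      (continuous_semigroup_left sbar β x)
  have h1 := (hc.tendsto 0).comp (tendsto_fst_smallTime sbar Γ Λ)
  rw [semigroup_zero, mul_zero, Real.exp_zero, one_smul] at h1
  have h2 := (h1.add (tendsto_boundary (μ := μ) hβ hΓ)).add (tendsto_duhamel (β := β) (μ := μ) hΛ)
  rwa [add_zero, add_zero] at h2

/-! ### The cost functional and the value function -/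

/-- The standing assumptions on the data of the control problem. -/
structure Assumptions (sbar β ρ lam : ℝ) (Γ Λ : Set ℝ)
    (L : State sbar → State sbar → ℝ → ℝ) (CL : ℝ) : Prop where
  sbar_pos : 0 < sbar
  beta_pos : 0 < β
  rho_pos : 0 < ρ
  lam_pos : 0 < lam
  compact_boundary : IsCompact Γ
  nonempty_boundary : Γ.Nonempty
  compact_distributed : IsCompact Λ
  nonempty_distributed : Λ.Nonempty
  uniformContinuousOn : UniformContinuousOn
    (fun q : State sbar × State sbar × ℝ => L q.1 q.2.1 q.2.2)
    (univ ×ˢ controlValues sbar Λ ×ˢ Γ)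
  lipschitz : ∀ x y, ∀ α ∈ controlValues sbar Λ, ∀ a ∈ Γ,
    |L x α a - L y α a| ≤ CL * bNorm sbar β lam (x - y)
  bounded : ∀ x, ∀ α ∈ controlValues sbar Λ, ∀ a ∈ Γ, |L x α a| ≤ CL

theorem integral_exp_neg_mul_Ioi {ρ : ℝ} (hρ : 0 < ρ) :
    ∫ s in Ioi (0 : ℝ), Real.exp (-ρ * s) = 1 / ρ := by
  rw [integral_exp_mul_Ioi (by linarith) 0]
  simp [neg_div_neg_eq]

namespace Assumptions

variable {sbar β ρ lam CL : ℝ} (μ : ℝ) {Γ Λ : Set ℝ} {L : State sbar → State sbar → ℝ → ℝ}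

theorem bound_nonneg (H : Assumptions sbar β ρ lam Γ Λ L CL) : 0 ≤ CL := by
  obtain ⟨c, hc⟩ := H.nonempty_distributed
  obtain ⟨a, ha⟩ := H.nonempty_boundary
  exact (abs_nonneg _).trans (H.bounded 0 _ (const_mem_controlValues sbar hc) a ha)

/-- `L` is continuous only on the admissible triples, so the path is lifted to that subtype, with an
arbitrary admissible point at times `s ≤ 0`. -/
theorem aestronglyMeasurable_lagrangian (H : Assumptions sbar β ρ lam Γ Λ L CL)
    {α : ℝ → State sbar} (hα : α ∈ distributedControls sbar Λ) {a : ℝ → ℝ}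
    (ha : a ∈ boundaryControls Γ) {X : ℝ → State sbar}
    (hX : AEStronglyMeasurable X (volume.restrict (Ioi 0))) :
    AEStronglyMeasurable (fun s => L (X s) (α s) (a s)) (volume.restrict (Ioi 0)) := by
  obtain ⟨q, hq⟩ : ∃ q : ℝ → (univ ×ˢ controlValues sbar Λ ×ˢ Γ : Set (State sbar × State sbar × ℝ)),
      ∀ s ∈ Ioi (0 : ℝ), (q s : State sbar × State sbar × ℝ) = (X s, α s, a s) := by
    have h0 : ∀ s, ∃ p : (univ ×ˢ controlValues sbar Λ ×ˢ Γ : Set (State sbar × State sbar × ℝ)),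
        s ∈ Ioi (0 : ℝ) → (p : State sbar × State sbar × ℝ) = (X s, α s, a s) := by
      intro s
      by_cases hs : s ∈ Ioi (0 : ℝ)
      · exact ⟨⟨(X s, α s, a s), mem_univ _, hα.2 s (le_of_lt hs), ha.2 s (le_of_lt hs)⟩,
          fun _ => rfl⟩
      · obtain ⟨c, hc⟩ := H.nonempty_distributed
        obtain ⟨b, hb⟩ := H.nonempty_boundary
        exact ⟨⟨(0, toL2 sbar (fun _ => c), b), mem_univ _, const_mem_controlValues sbar hc, hb⟩,
          fun h => absurd h hs⟩
    choose q hq using h0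
    exact ⟨q, hq⟩
  have h1 : AEStronglyMeasurable (fun s => (X s, α s, a s)) (volume.restrict (Ioi 0)) :=
    hX.prodMk (hα.1.aestronglyMeasurable.prodMk ha.1.aestronglyMeasurable)
  have h2 : AEStronglyMeasurable (fun s => (q s : State sbar × State sbar × ℝ))
      (volume.restrict (Ioi 0)) := by
    refine h1.congr ?_
    filter_upwards [ae_restrict_mem measurableSet_Ioi] with s hs
    exact (hq s hs).symm
  have h3 : AEStronglyMeasurable q (volume.restrict (Ioi 0)) :=
    Topology.IsEmbedding.subtypeVal.aestronglyMeasurable_comp_iff.1 h2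
  refine ((continuousOn_iff_continuous_domRestrict.1
    H.uniformContinuousOn.continuousOn).comp_aestronglyMeasurable h3).congr ?_
  filter_upwards [ae_restrict_mem measurableSet_Ioi] with s hs
  simp only [domRestrict_apply, hq s hs]

theorem intervalIntegrable_lagrangian (H : Assumptions sbar β ρ lam Γ Λ L CL) (x : State sbar)
    {α : ℝ → State sbar} (hα : α ∈ distributedControls sbar Λ) {a : ℝ → ℝ}
    (ha : a ∈ boundaryControls Γ) {h : ℝ} (hh : 0 ≤ h) :
    IntervalIntegrable (fun s => L x (α s) (a s)) volume 0 h := by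
  rw [intervalIntegrable_iff, uIoc_of_le hh]
  refine Integrable.of_bound ((H.aestronglyMeasurable_lagrangian hα ha
    (aestronglyMeasurable_const (b := x))).mono_measure
      (Measure.restrict_mono Ioc_subset_Ioi_self le_rfl)) CL ?_
  filter_upwards [ae_restrict_mem measurableSet_Ioc] with τ hτ
  exact H.bounded x _ (hα.2 τ hτ.1.le) _ (ha.2 τ hτ.1.le)

theorem aestronglyMeasurable_running (H : Assumptions sbar β ρ lam Γ Λ L CL) (x : State sbar)
    {α : ℝ → State sbar} (hα : α ∈ distributedControls sbar Λ) {a : ℝ → ℝ}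
    (ha : a ∈ boundaryControls Γ) :
    AEStronglyMeasurable
      (fun s => Real.exp (-ρ * s) * L (trajectory sbar β μ x α a s) (α s) (a s))
      (volume.restrict (Ioi 0)) :=
  ((by fun_prop : Continuous fun s : ℝ => Real.exp (-ρ * s)).aestronglyMeasurable).mul
    (H.aestronglyMeasurable_lagrangian hα ha
      (aestronglyMeasurable_trajectory H.beta_pos H.compact_boundary x hα ha))

theorem abs_running_le (H : Assumptions sbar β ρ lam Γ Λ L CL) (X : ℝ → State sbar)
    {α : ℝ → State sbar} (hα : α ∈ distributedControls sbar Λ) {a : ℝ → ℝ}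
    (ha : a ∈ boundaryControls Γ) {s : ℝ} (hs : 0 ≤ s) :
    |Real.exp (-ρ * s) * L (X s) (α s) (a s)| ≤ CL * Real.exp (-ρ * s) := by
  rw [abs_mul, Real.abs_exp, mul_comm]
  have := H.bounded (X s) _ (hα.2 s hs) _ (ha.2 s hs)
  gcongr

theorem integrableOn_running (H : Assumptions sbar β ρ lam Γ Λ L CL) (x : State sbar)
    {α : ℝ → State sbar} (hα : α ∈ distributedControls sbar Λ) {a : ℝ → ℝ}
    (ha : a ∈ boundaryControls Γ) :
    IntegrableOn (fun s => Real.exp (-ρ * s) * L (trajectory sbar β μ x α a s) (α s) (a s))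
      (Ioi 0) := by
  refine Integrable.mono' ((exp_neg_integrableOn_Ioi 0 H.rho_pos).const_mul CL)
    (H.aestronglyMeasurable_running μ x hα ha) ?_
  filter_upwards [ae_restrict_mem measurableSet_Ioi] with s hs
  exact H.abs_running_le _ hα ha (le_of_lt hs)

/-! ### Boundedness and `B`-Lipschitz continuity of the value function. -/

theorem abs_cost_le (H : Assumptions sbar β ρ lam Γ Λ L CL) (x : State sbar)
    {α : ℝ → State sbar} (hα : α ∈ distributedControls sbar Λ) {a : ℝ → ℝ}
    (ha : a ∈ boundaryControls Γ) : |cost sbar β μ ρ L x α a| ≤ CL * (1 / ρ) := by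
  rw [← integral_exp_neg_mul_Ioi H.rho_pos, ← integral_const_mul]
  refine norm_integral_le_of_norm_le (f := fun s =>
    Real.exp (-ρ * s) * L (trajectory sbar β μ x α a s) (α s) (a s))
    ((exp_neg_integrableOn_Ioi 0 H.rho_pos).const_mul CL) ?_
  filter_upwards [ae_restrict_mem measurableSet_Ioi] with s hs
  exact H.abs_running_le _ hα ha (le_of_lt hs)

theorem bddBelow_costs (H : Assumptions sbar β ρ lam Γ Λ L CL) (x : State sbar) :
    BddBelow {j | ∃ α ∈ distributedControls sbar Λ, ∃ a ∈ boundaryControls Γ,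
      j = cost sbar β μ ρ L x α a} := by
  refine ⟨-(CL * (1 / ρ)), ?_⟩
  rintro _ ⟨α, hα, a, ha, rfl⟩
  exact (abs_le.1 (H.abs_cost_le μ x hα ha)).1

theorem nonempty_costs (H : Assumptions sbar β ρ lam Γ Λ L CL) (x : State sbar) :
    {j | ∃ α ∈ distributedControls sbar Λ, ∃ a ∈ boundaryControls Γ,
      j = cost sbar β μ ρ L x α a}.Nonempty := by
  obtain ⟨c, hc⟩ := H.nonempty_distributed
  obtain ⟨a, ha⟩ := H.nonempty_boundary
  exact ⟨_, _, const_mem_distributedControls (const_mem_controlValues sbar hc), _,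
    const_mem_boundaryControls ha, rfl⟩

theorem value_le_cost (H : Assumptions sbar β ρ lam Γ Λ L CL) (x : State sbar)
    {α : ℝ → State sbar} (hα : α ∈ distributedControls sbar Λ) {a : ℝ → ℝ}
    (ha : a ∈ boundaryControls Γ) :
    value sbar β μ ρ Γ Λ L x ≤ cost sbar β μ ρ L x α a :=
  csInf_le (H.bddBelow_costs μ x) ⟨α, hα, a, ha, rfl⟩

theorem exists_cost_lt (H : Assumptions sbar β ρ lam Γ Λ L CL) (x : State sbar) {ε : ℝ}
    (hε : 0 < ε) : ∃ α ∈ distributedControls sbar Λ, ∃ a ∈ boundaryControls Γ,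
      cost sbar β μ ρ L x α a < value sbar β μ ρ Γ Λ L x + ε := by
  obtain ⟨_, ⟨α, hα, a, ha, rfl⟩, h⟩ := exists_lt_of_csInf_lt (H.nonempty_costs μ x)
    (lt_add_of_pos_right (value sbar β μ ρ Γ Λ L x) hε)
  exact ⟨α, hα, a, ha, h⟩

theorem abs_value_le (H : Assumptions sbar β ρ lam Γ Λ L CL) (x : State sbar) :
    |value sbar β μ ρ Γ Λ L x| ≤ CL * (1 / ρ) := by
  rw [abs_le]
  constructor
  · refine le_csInf (H.nonempty_costs μ x) ?_
    rintro _ ⟨α, hα, a, ha, rfl⟩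
    exact (abs_le.1 (H.abs_cost_le μ x hα ha)).1
  · obtain ⟨_, α, hα, a, ha, -⟩ := H.nonempty_costs μ x
    exact (H.value_le_cost μ x hα ha).trans (abs_le.1 (H.abs_cost_le μ x hα ha)).2

theorem cost_sub_le (H : Assumptions sbar β ρ lam Γ Λ L CL) (x y : State sbar)
    {α : ℝ → State sbar} (hα : α ∈ distributedControls sbar Λ) {a : ℝ → ℝ}
    (ha : a ∈ boundaryControls Γ) :
    |cost sbar β μ ρ L x α a - cost sbar β μ ρ L y α a|
      ≤ CL * Real.exp (|μ| * (sbar / β)) * (1 / ρ) * bNorm sbar β lam (x - y) := by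
  have hCL := H.bound_nonneg
  rw [cost, cost, ← integral_sub (H.integrableOn_running μ x hα ha)
    (H.integrableOn_running μ y hα ha)]
  have h : CL * Real.exp (|μ| * (sbar / β)) * (1 / ρ) * bNorm sbar β lam (x - y)
      = ∫ s in Ioi (0 : ℝ), CL * Real.exp (|μ| * (sbar / β)) * bNorm sbar β lam (x - y)
        * Real.exp (-ρ * s) := by
    rw [integral_const_mul, integral_exp_neg_mul_Ioi H.rho_pos]
    ring
  rw [h]
  refine norm_integral_le_of_norm_le (f := fun s =>
    Real.exp (-ρ * s) * L (trajectory sbar β μ x α a s) (α s) (a s)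
      - Real.exp (-ρ * s) * L (trajectory sbar β μ y α a s) (α s) (a s))
    ((exp_neg_integrableOn_Ioi 0 H.rho_pos).const_mul _) ?_
  filter_upwards [ae_restrict_mem measurableSet_Ioi] with s hs
  rw [← mul_sub, norm_mul, Real.norm_eq_abs, Real.norm_eq_abs, Real.abs_exp, mul_comm]
  refine mul_le_mul_of_nonneg_right ?_ (Real.exp_pos _).le
  refine (H.lipschitz _ _ _ (hα.2 s (le_of_lt hs)) _ (ha.2 s (le_of_lt hs))).trans ?_
  rw [mul_assoc]
  exact mul_le_mul_of_nonneg_left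
    (bNorm_trajectory_sub_le μ lam H.beta_pos x y α a (le_of_lt hs)) hCL

theorem value_sub_le (H : Assumptions sbar β ρ lam Γ Λ L CL) (x y : State sbar) :
    value sbar β μ ρ Γ Λ L x - value sbar β μ ρ Γ Λ L y
      ≤ CL * Real.exp (|μ| * (sbar / β)) * (1 / ρ) * bNorm sbar β lam (x - y) := by
  refine le_of_forall_pos_le_add fun ε hε => ?_
  obtain ⟨α, hα, a, ha, h⟩ := H.exists_cost_lt μ y hε
  have h1 := H.value_le_cost μ x hα ha
  have h2 := (abs_le.1 (H.cost_sub_le μ x y hα ha)).2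
  linarith

theorem isBLipschitz_value (H : Assumptions sbar β ρ lam Γ Λ L CL) :
    IsBLipschitz sbar β lam (value sbar β μ ρ Γ Λ L) := by
  refine ⟨CL * Real.exp (|μ| * (sbar / β)) * (1 / ρ), fun x y => ?_⟩
  have hsym : bNorm sbar β lam (y - x) = bNorm sbar β lam (x - y) := by
    have := bNorm_smul sbar β lam (-1) (x - y)
    rwa [neg_one_smul, neg_sub, abs_neg, abs_one, one_mul] at this
  rw [abs_le]
  constructor
  · have := H.value_sub_le μ y x
    rw [hsym] at this
    linarith
  · exact H.value_sub_le μ x y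

theorem isRegular_value (H : Assumptions sbar β ρ lam Γ Λ L CL) :
    IsRegular sbar β lam (value sbar β μ ρ Γ Λ L) := by
  refine ⟨?_, ⟨_, H.abs_value_le μ⟩, H.isBLipschitz_value μ⟩
  obtain ⟨C, hC⟩ := H.isBLipschitz_value μ
  obtain ⟨K, hK0, hK⟩ := exists_bNorm_le (lam := lam) H.sbar_pos.le H.beta_pos H.lam_pos
  refine LipschitzWith.continuous (K := (|C| * K).toNNReal) (LipschitzWith.of_dist_le_mul ?_)
  intro x y
  rw [Real.dist_eq, dist_eq_norm, Real.coe_toNNReal _ (by positivity), mul_assoc]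
  refine (hC x y).trans ?_
  have h1 := hK (x - y)
  have h2 := bNorm_nonneg sbar β lam (x - y)
  have h3 := le_abs_self C
  gcongr

/-! ### Dynamic programming. -/

theorem cost_split (H : Assumptions sbar β ρ lam Γ Λ L CL) (x : State sbar)
    {α : ℝ → State sbar} (hα : α ∈ distributedControls sbar Λ) {a : ℝ → ℝ}
    (ha : a ∈ boundaryControls Γ) {h : ℝ} (hh : 0 ≤ h) :
    cost sbar β μ ρ L x α a
      = (∫ s in (0 : ℝ)..h, Real.exp (-ρ * s) * L (trajectory sbar β μ x α a s) (α s) (a s))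
        + Real.exp (-ρ * h) * cost sbar β μ ρ L (trajectory sbar β μ x α a h)
            (fun s => α (h + s)) (fun s => a (h + s)) := by
  have hint := H.integrableOn_running μ x hα ha
  rw [cost, ← intervalIntegral.integral_interval_add_Ioi hint (hint.mono_set (Ioi_subset_Ioi hh))]
  congr 1
  rw [cost, ← integral_const_mul]
  have h1 := (measurePreserving_add_left volume h).setIntegral_preimage_emb
    (measurableEmbedding_addLeft h)
    (fun s => Real.exp (-ρ * s) * L (trajectory sbar β μ x α a s) (α s) (a s)) (Ioi h)
  rw [preimage_const_add_Ioi, sub_self] at h1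
  rw [← h1]
  refine setIntegral_congr_fun measurableSet_Ioi fun s hs => ?_
  rw [trajectory_add H.beta_pos H.compact_boundary H.compact_distributed x hα ha hh (le_of_lt hs),
    ← mul_assoc, ← Real.exp_add]
  ring_nf

/-- The remaining cost is that of the shifted controls started at `x(h)`, hence at least the value
there. -/
theorem running_add_value_le_cost (H : Assumptions sbar β ρ lam Γ Λ L CL) (x : State sbar)
    {α : ℝ → State sbar} (hα : α ∈ distributedControls sbar Λ) {a : ℝ → ℝ}
    (ha : a ∈ boundaryControls Γ) {h : ℝ} (hh : 0 ≤ h) :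
    (∫ s in (0 : ℝ)..h, Real.exp (-ρ * s) * L (trajectory sbar β μ x α a s) (α s) (a s))
        + Real.exp (-ρ * h) * value sbar β μ ρ Γ Λ L (trajectory sbar β μ x α a h)
      ≤ cost sbar β μ ρ L x α a := by
  rw [H.cost_split μ x hα ha hh]
  have := H.value_le_cost μ (trajectory sbar β μ x α a h) (shift_mem_distributedControls hα hh)
    (shift_mem_boundaryControls ha hh)
  gcongr

theorem cost_congr (hβ : 0 < β) (ρ : ℝ) (L : State sbar → State sbar → ℝ → ℝ) (x : State sbar)
    {α α' : ℝ → State sbar} (hα : ∀ s, 0 ≤ s → α s = α' s) {a a' : ℝ → ℝ}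
    (ha : ∀ s, 0 ≤ s → a s = a' s) :
    cost sbar β μ ρ L x α a = cost sbar β μ ρ L x α' a' := by
  refine setIntegral_congr_fun measurableSet_Ioi fun s hs => ?_
  have hs' : 0 ≤ s := le_of_lt hs
  rw [trajectory_congr hβ hs' x (fun τ h _ => hα τ h) (fun τ h _ => ha τ h), hα s hs', ha s hs']

/-- The dynamic programming inequality. -/
theorem value_le_running_add_value (H : Assumptions sbar β ρ lam Γ Λ L CL) (x : State sbar)
    {α : ℝ → State sbar} (hα : α ∈ distributedControls sbar Λ) {a : ℝ → ℝ}
    (ha : a ∈ boundaryControls Γ) {h : ℝ} (hh : 0 ≤ h) :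
    value sbar β μ ρ Γ Λ L x ≤
      (∫ s in (0 : ℝ)..h, Real.exp (-ρ * s) * L (trajectory sbar β μ x α a s) (α s) (a s))
        + Real.exp (-ρ * h) * value sbar β μ ρ Γ Λ L (trajectory sbar β μ x α a h) := by
  refine le_of_forall_pos_le_add fun ε hε => ?_
  obtain ⟨α', hα', a', ha', h1⟩ := H.exists_cost_lt μ (trajectory sbar β μ x α a h) hε
  have hc := concat_mem_distributedControls hα hα' h
  have hd := concat_mem_boundaryControls ha ha' h
  refine (H.value_le_cost μ x hc hd).trans ?_
  have hβ := H.beta_pos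
  have h2 : trajectory sbar β μ x (concat h α α') (concat h a a') h
      = trajectory sbar β μ x α a h :=
    trajectory_congr hβ hh x (fun τ _ hτ => concat_of_lt hτ _ _) (fun τ _ hτ => concat_of_lt hτ _ _)
  have h3 : (∫ s in (0 : ℝ)..h, Real.exp (-ρ * s) *
        L (trajectory sbar β μ x (concat h α α') (concat h a a') s) (concat h α α' s)
          (concat h a a' s))
      = ∫ s in (0 : ℝ)..h, Real.exp (-ρ * s) * L (trajectory sbar β μ x α a s) (α s) (a s) := by
    -- The endpoint is dropped because at `s = h` the concatenation already follows the second
    -- control.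
    rw [intervalIntegral.integral_of_le hh, intervalIntegral.integral_of_le hh,
      integral_Ioc_eq_integral_Ioo, integral_Ioc_eq_integral_Ioo]
    refine setIntegral_congr_fun measurableSet_Ioo fun s hs => ?_
    rw [concat_of_lt hs.2, concat_of_lt hs.2, trajectory_congr hβ hs.1.le x
      (fun τ _ hτ => concat_of_lt (hτ.trans hs.2) _ _)
      (fun τ _ hτ => concat_of_lt (hτ.trans hs.2) _ _)]
  have h4 : cost sbar β μ ρ L (trajectory sbar β μ x α a h) (fun s => concat h α α' (h + s))
      (fun s => concat h a a' (h + s)) = cost sbar β μ ρ L (trajectory sbar β μ x α a h) α' a' :=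
    cost_congr μ hβ ρ L _ (fun s hs => concat_add hs _ _) (fun s hs => concat_add hs _ _)
  rw [H.cost_split μ x hc hd hh, h2, h3, h4]
  have h5 : Real.exp (-ρ * h) ≤ 1 := by
    rw [Real.exp_le_one_iff]; nlinarith [H.rho_pos]
  have h6 := Real.exp_pos (-ρ * h)
  nlinarith [mul_le_mul_of_nonneg_left h1.le h6.le]

end Assumptions

/-! ### First order expansions for small times, uniform in the controls -/

theorem intervalIntegrable_boundaryControl {Γ : Set ℝ} (hΓ : IsCompact Γ) {a : ℝ → ℝ}
    (ha : a ∈ boundaryControls Γ) {h : ℝ} (hh : 0 ≤ h) : IntervalIntegrable a volume 0 h := by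
  rw [intervalIntegrable_iff, uIoc_of_le hh]
  refine Measure.integrableOn_of_bounded (M := setNorm Γ) (by simp) ha.1.aestronglyMeasurable ?_
  filter_upwards [ae_restrict_mem measurableSet_Ioc] with τ hτ
  exact abs_le_setNorm hΓ (ha.2 τ hτ.1.le)

theorem intervalIntegrable_distributedControl {sbar : ℝ} {Λ : Set ℝ} (hΛ : IsCompact Λ)
    {α : ℝ → State sbar} (hα : α ∈ distributedControls sbar Λ) {h : ℝ} (hh : 0 ≤ h) :
    IntervalIntegrable α volume 0 h := by
  obtain ⟨M, hM0, hM⟩ := exists_norm_controlValues_le sbar hΛ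
  rw [intervalIntegrable_iff, uIoc_of_le hh]
  refine Measure.integrableOn_of_bounded (M := M) (by simp) hα.1.aestronglyMeasurable ?_
  filter_upwards [ae_restrict_mem measurableSet_Ioc] with τ hτ
  exact hM _ (hα.2 τ hτ.1.le)

theorem intervalIntegrable_inner_control {sbar : ℝ} {Λ : Set ℝ} (hΛ : IsCompact Λ)
    (p : State sbar) {α : ℝ → State sbar} (hα : α ∈ distributedControls sbar Λ) {h : ℝ}
    (hh : 0 ≤ h) : IntervalIntegrable (fun τ => inner ℝ p (α τ)) volume 0 h := by
  have h1 := intervalIntegrable_distributedControl hΛ hα hh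
  rw [intervalIntegrable_iff] at h1 ⊢
  exact h1.const_inner p

/-- The source of the integral expansions below: an integrand that is small uniformly in time and
controls integrates to `o(h)`. -/
theorem isLittleO_integral {sbar : ℝ} {Γ Λ : Set ℝ}
    {f : ℝ × (ℝ → State sbar) × (ℝ → ℝ) → ℝ → ℝ}
    (hf : ∀ ε > 0, ∀ᶠ q in smallTime sbar Γ Λ, ∀ τ, 0 < τ → τ ≤ q.1 → |f q τ| ≤ ε) :
    (fun q => ∫ τ in (0 : ℝ)..q.1, f q τ) =o[smallTime sbar Γ Λ] fun q => q.1 := by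
  rw [Asymptotics.isLittleO_iff]
  intro ε hε
  filter_upwards [hf ε hε, eventually_admissible sbar Γ Λ] with q hq hadm
  have h := intervalIntegral.norm_integral_le_of_norm_le_const (a := 0) (b := q.1) (f := f q)
    (C := ε) (fun τ hτ => by
      rw [uIoc_of_le hadm.1.le] at hτ
      exact hq τ hτ.1 hτ.2)
  rwa [sub_zero] at h

/-! ### Pairing the trajectory with elements of `D(A*)`. -/

theorem IsH1.eq_neg_integral {sbar : ℝ} (hs : 0 ≤ sbar) {p w : State sbar} {F : ℝ → ℝ}
    (h : IsH1 sbar p w F) (h0 : F sbar = 0) {r : ℝ} (hr : r ∈ Icc 0 sbar) :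
    F r = -∫ t in r..sbar, w t := by
  have hi : ∀ a b, 0 ≤ a → a ≤ b → b ≤ sbar → IntervalIntegrable (w : ℝ → ℝ) volume a b :=
    fun a b ha hab hb => by
      rw [intervalIntegrable_iff, uIoc_of_le hab]
      exact IntegrableOn.mono_set (integrable_state w) (Ioc_subset_Ioc ha hb)
  have h1 := h.2 r hr
  have h2 := h.2 sbar ⟨hs, le_rfl⟩
  have h3 := intervalIntegral.integral_add_adjacent_intervals (hi 0 r le_rfl hr.1 hr.2)
    (hi r sbar hr.1 hr.2 le_rfl)
  linarith

theorem integrable_zeroExt {sbar : ℝ} (f : State sbar) :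
    Integrable ((Ioc 0 sbar).indicator (f : ℝ → ℝ)) volume :=
  IntegrableOn.integrable_indicator (integrable_state f) measurableSet_Ioc

/-- Since `F sbar = 0`, the extension by zero creates no jump at `sbar`. It may jump at `0`, hence
the restriction to `r > 0`. -/
theorem IsH1.eq_neg_integral_Ioi {sbar : ℝ} (hs : 0 ≤ sbar) {p w : State sbar} {F : ℝ → ℝ}
    (h : IsH1 sbar p w F) (h0 : F sbar = 0) :
    ∀ᵐ r : ℝ, 0 < r → (Ioc 0 sbar).indicator p r = -∫ t in Ioi r, (Ioc 0 sbar).indicator w t := by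
  have h1 := h.1
  rw [Filter.EventuallyEq, ae_restrict_iff' measurableSet_Ioc] at h1
  filter_upwards [h1] with r hr h0r
  rw [integral_indicator measurableSet_Ioc, Measure.restrict_restrict measurableSet_Ioc]
  by_cases hrs : r ≤ sbar
  · have e : Ioc 0 sbar ∩ Ioi r = Ioc r sbar := by
      ext t
      simp only [mem_inter_iff, mem_Ioi, mem_Ioc]
      exact ⟨fun h => ⟨h.2, h.1.2⟩, fun h => ⟨⟨h0r.trans h.1, h.2⟩, h.1⟩⟩
    rw [e, indicator_of_mem (show r ∈ Ioc 0 sbar from ⟨h0r, hrs⟩), hr ⟨h0r, hrs⟩,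
      h.eq_neg_integral hs h0 ⟨h0r.le, hrs⟩, intervalIntegral.integral_of_le hrs]
  · have e : Ioc 0 sbar ∩ Ioi r = ∅ := by
      ext t
      simp only [mem_inter_iff, mem_Ioi, mem_Ioc, mem_empty_iff_false, iff_false]
      exact fun h => hrs (h.2.le.trans h.1.2)
    rw [e, indicator_of_notMem (fun h => hrs h.2)]
    simp

/-- The weak form of the transport equation: `A*` generates the adjoint semigroup. -/
theorem IsH1.inner_semigroup_sub {sbar β h : ℝ} (hs : 0 ≤ sbar) (hβ : 0 < β) (hh : 0 ≤ h)
    {p w : State sbar} {F : ℝ → ℝ} (hp : IsH1 sbar p w F) (h0 : F sbar = 0) (x : State sbar) :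
    inner ℝ p (semigroup sbar β h x - x)
      = ∫ σ in (0 : ℝ)..h, β * inner ℝ w (semigroup sbar β σ x) := by
  have hbh : 0 ≤ β * h := by positivity
  obtain ⟨X, hX⟩ : ∃ X, X = (Ioc 0 sbar).indicator (x : ℝ → ℝ) := ⟨_, rfl⟩
  obtain ⟨W, hW⟩ : ∃ W, W = (Ioc 0 sbar).indicator (w : ℝ → ℝ) := ⟨_, rfl⟩
  have hXi : Integrable X volume := hX ▸ integrable_zeroExt x
  have hWi : Integrable W volume := hW ▸ integrable_zeroExt w
  have hP := hp.eq_neg_integral_Ioi hs h0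
  rw [← hW] at hP
  have hshift : ∀ᵐ r : ℝ, 0 < r + β * h → (Ioc 0 sbar).indicator p (r + β * h)
      = -∫ t in Ioi (r + β * h), W t :=
    (measurePreserving_add_right volume (β * h)).quasiMeasurePreserving.ae hP
  have hi1 : Integrable (fun r => X r * (Ioc 0 sbar).indicator p (r + β * h)) volume := by
    have h1 : MemLp X 2 volume := hX ▸ memLp_zeroExt x
    have h2 := (memLp_zeroExt p).comp_measurePreserving
      (measurePreserving_add_right volume (β * h))
    exact h1.integrable_mul h2
  have hi2 : Integrable (fun r => X r * (Ioc 0 sbar).indicator p r) volume := by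
    have h1 : MemLp X 2 volume := hX ▸ memLp_zeroExt x
    exact h1.integrable_mul (memLp_zeroExt p)
  have e1 : inner ℝ p (semigroup sbar β h x) = ∫ r, X r * (Ioc 0 sbar).indicator p (r + β * h) := by
    rw [real_inner_comm, inner_semigroup_left, ← integral_sub_right_eq_self
      (fun r => X r * (Ioc 0 sbar).indicator p (r + β * h)) (β * h)]
    simp only [sub_add_cancel, hX]
  have e2 : inner ℝ p x = ∫ r, X r * (Ioc 0 sbar).indicator p r := by
    have := inner_semigroup_left sbar β 0 x p
    rw [semigroup_zero, real_inner_comm] at this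
    simpa only [mul_zero, sub_zero, hX] using this
  -- The increment `p(r + β h) - p(r)` is the integral of `w` over that interval when `r > 0`; for
  -- `r ≤ 0`, where the jump at `0` could interfere, `X` vanishes.
  have e3 : inner ℝ p (semigroup sbar β h x - x)
      = ∫ r, ∫ u in Ioc 0 (β * h), X r * W (r + u) := by
    rw [inner_sub_right, e1, e2, ← integral_sub hi1 hi2]
    refine integral_congr_ae ?_
    filter_upwards [hP, hshift] with r h1 h2
    rw [integral_const_mul, ← mul_sub]
    by_cases hr : 0 < r
    · rw [h1 hr, h2 (by linarith)]
      have h3 := intervalIntegral.integral_interval_add_Ioi (hWi.integrableOn (s := Ioi r))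
        (hWi.integrableOn (s := Ioi (r + β * h)))
      have h4 := intervalIntegral.integral_comp_add_left (a := 0) (b := β * h) W r
      rw [add_zero] at h4
      rw [← intervalIntegral.integral_of_le hbh, h4]
      congr 1
      linarith
    · have : X r = 0 := by
        rw [hX, indicator_of_notMem]
        exact fun h => hr h.1
      rw [this, zero_mul, zero_mul]
  have hint : Integrable (Function.uncurry fun r u => X r * W (r + u))
      (volume.prod (volume.restrict (Ioc 0 (β * h)))) := by
    have h1 := (measurePreserving_prod_add (volume : Measure ℝ) volume).integrable_comp_of_integrable
      (hXi.mul_prod hWi)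
    have h2 : (volume : Measure ℝ).prod (volume.restrict (Ioc 0 (β * h)))
        = ((volume : Measure ℝ).prod volume).restrict (univ ×ˢ Ioc 0 (β * h)) := by
      rw [← Measure.prod_restrict, Measure.restrict_univ]
    rw [h2]
    exact Integrable.restrict h1
  rw [e3, integral_integral_swap hint, ← intervalIntegral.integral_of_le hbh]
  -- After Fubini the inner integral is a pairing with the state translated by `u`, that is at time
  -- `u / β`; the change to time gives the factor `β`.
  have e4 : ∀ u, ∫ r, X r * W (r + u) = inner ℝ w (semigroup sbar β (u / β) x) := by
    intro u
    rw [real_inner_comm, inner_semigroup_left, ← integral_sub_right_eq_self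
      (fun r => X r * W (r + u)) u]
    simp only [sub_add_cancel, hX, hW, mul_div_cancel₀ u hβ.ne']
  simp_rw [e4]
  rw [intervalIntegral.integral_comp_div (fun σ => inner ℝ w (semigroup sbar β σ x)) hβ.ne',
    intervalIntegral.integral_const_mul, zero_div, mul_div_cancel_left₀ h hβ.ne', smul_eq_mul]

theorem eventually_forall_earlier_of_tendsto {sbar : ℝ} {Γ Λ : Set ℝ} {f : ℝ → ℝ}
    (hf : Tendsto f (𝓝 0) (𝓝 0)) {ε : ℝ} (hε : 0 < ε) :
    ∀ᶠ q in smallTime sbar Γ Λ, ∀ τ, 0 ≤ τ → τ ≤ q.1 → |f τ| ≤ ε := by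
  rw [eventually_smallTime]
  obtain ⟨δ, hδ, h⟩ := Metric.tendsto_nhds_nhds.1 hf ε hε
  refine ⟨δ, hδ, fun s _ hs α _ a _ τ h0 hτ => ?_⟩
  have := h (x := τ) (by rw [Real.dist_eq, sub_zero, abs_of_nonneg h0]; exact hτ.trans_lt hs)
  rw [Real.dist_eq, sub_zero] at this
  exact this.le

theorem eventually_abs_le_of_tendsto {ι : Type*} {l : Filter ι} {f : ι → ℝ}
    (hf : Tendsto f l (𝓝 0)) {ε : ℝ} (hε : 0 < ε) : ∀ᶠ q in l, |f q| ≤ ε := by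
  filter_upwards [hf.eventually (Metric.ball_mem_nhds 0 hε)] with q hq
  rw [dist_zero_right] at hq
  exact hq.le

/-- The vectors `p q` and `w q` vary with time and controls because they will be gradients at mean
value points. The weak equation removes `p`, so convergence of `w` suffices. -/
theorem isLittleO_inner_semigroup_sub {sbar β : ℝ} (hs : 0 ≤ sbar) (hβ : 0 < β) {Γ Λ : Set ℝ}
    {p w : ℝ × (ℝ → State sbar) × (ℝ → ℝ) → State sbar}
    {F : ℝ × (ℝ → State sbar) × (ℝ → ℝ) → ℝ → ℝ} (hH : ∀ q, IsH1 sbar (p q) (w q) (F q))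
    (h0 : ∀ q, F q sbar = 0) {w₀ : State sbar}
    (hw : Tendsto w (smallTime sbar Γ Λ) (𝓝 w₀)) (x : State sbar) :
    (fun q => inner ℝ (p q) (semigroup sbar β q.1 x - x) - q.1 * (β * inner ℝ w₀ x))
      =o[smallTime sbar Γ Λ] fun q => q.1 := by
  have key : (fun q : ℝ × (ℝ → State sbar) × (ℝ → ℝ) => ∫ σ in (0 : ℝ)..q.1,
      (β * inner ℝ (w q) (semigroup sbar β σ x) - β * inner ℝ w₀ x))
      =o[smallTime sbar Γ Λ] fun q => q.1 := by
    apply isLittleO_integral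
    intro ε hε
    have h1 : Tendsto (fun q => β * (‖w q - w₀‖ * ‖x‖)) (smallTime sbar Γ Λ) (𝓝 0) := by
      have := ((tendsto_iff_norm_sub_tendsto_zero.1 hw).mul_const ‖x‖).const_mul β
      simpa using this
    have h2 : Tendsto (fun σ => β * (‖w₀‖ * ‖semigroup sbar β σ x - x‖)) (𝓝 0) (𝓝 0) := by
      have hc : Continuous fun σ => β * (‖w₀‖ * ‖semigroup sbar β σ x - x‖) :=
        (((continuous_semigroup_left sbar β x).sub continuous_const).norm.const_mul _).const_mul _
      simpa [semigroup_zero] using hc.tendsto 0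
    filter_upwards [eventually_abs_le_of_tendsto h1 (half_pos hε),
      eventually_forall_earlier_of_tendsto h2 (half_pos hε)] with q hq1 hq2 σ hσ0 hσ
    have e : β * inner ℝ (w q) (semigroup sbar β σ x) - β * inner ℝ w₀ x
        = β * (inner ℝ (w q - w₀) (semigroup sbar β σ x)
          + inner ℝ w₀ (semigroup sbar β σ x - x)) := by
      rw [inner_sub_left, inner_sub_right]; ring
    rw [e, abs_mul, abs_of_pos hβ]
    have h3 : |inner ℝ (w q - w₀) (semigroup sbar β σ x)| ≤ ‖w q - w₀‖ * ‖x‖ :=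
      (abs_real_inner_le_norm _ _).trans
        (mul_le_mul_of_nonneg_left (norm_semigroup_le _ _ _ _) (norm_nonneg _))
    have h4 := abs_real_inner_le_norm w₀ (semigroup sbar β σ x - x)
    have h5 := (le_abs_self _).trans hq1
    have h6 := (le_abs_self _).trans (hq2 σ hσ0.le hσ)
    calc β * |inner ℝ (w q - w₀) (semigroup sbar β σ x)
          + inner ℝ w₀ (semigroup sbar β σ x - x)|
        ≤ β * (‖w q - w₀‖ * ‖x‖ + ‖w₀‖ * ‖semigroup sbar β σ x - x‖) := by
          gcongr
          exact (abs_add_le _ _).trans (add_le_add h3 h4)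
      _ ≤ ε := by linarith
  refine key.congr' ?_ EventuallyEq.rfl
  filter_upwards [eventually_admissible sbar Γ Λ] with q hq
  have hc : Continuous fun σ => β * inner ℝ (w q) (semigroup sbar β σ x) :=
    (continuous_const.inner (continuous_semigroup_left sbar β x)).const_mul β
  rw [(hH q).inner_semigroup_sub hs hβ hq.1.le (h0 q),
    intervalIntegral.integral_sub (hc.intervalIntegrable _ _) intervalIntegrable_const,
    intervalIntegral.integral_const, sub_zero, smul_eq_mul]

theorem isLittleO_exp_sub_one {sbar : ℝ} {Γ Λ : Set ℝ} (c : ℝ) :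
    (fun q : ℝ × (ℝ → State sbar) × (ℝ → ℝ) => Real.exp (c * q.1) - 1 - c * q.1)
      =o[smallTime sbar Γ Λ] fun q => q.1 := by
  have h : HasDerivAt (fun s : ℝ => Real.exp (c * s)) c 0 := by
    have := ((hasDerivAt_id (0 : ℝ)).const_mul c).exp
    simpa using this
  have h1 := (hasDerivAt_iff_isLittleO.1 h).comp_tendsto (tendsto_fst_smallTime sbar Γ Λ)
  refine h1.congr (fun q => ?_) (fun q => ?_)
  · simp [mul_comm]
  · simp

theorem isLittleO_mul_of_tendsto_zero {ι : Type*} {l : Filter ι} {f g : ι → ℝ}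
    (hf : Tendsto f l (𝓝 0)) : (fun q => g q * f q) =o[l] g := by
  have := (Asymptotics.isBigO_refl g l).mul_isLittleO
    ((Asymptotics.isLittleO_one_iff ℝ).2 hf)
  simpa using this

theorem isLittleO_inner_free {sbar β μ : ℝ} (hs : 0 ≤ sbar) (hβ : 0 < β) {Γ Λ : Set ℝ}
    {p w : ℝ × (ℝ → State sbar) × (ℝ → ℝ) → State sbar}
    {F : ℝ × (ℝ → State sbar) × (ℝ → ℝ) → ℝ → ℝ} (hH : ∀ q, IsH1 sbar (p q) (w q) (F q))
    (h0 : ∀ q, F q sbar = 0) {p₀ w₀ : State sbar}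
    (hp : Tendsto p (smallTime sbar Γ Λ) (𝓝 p₀))
    (hw : Tendsto w (smallTime sbar Γ Λ) (𝓝 w₀)) (x : State sbar) :
    (fun q => inner ℝ (p q) (Real.exp (-μ * q.1) • semigroup sbar β q.1 x - x)
        - q.1 * (β * inner ℝ w₀ x - μ * inner ℝ p₀ x))
      =o[smallTime sbar Γ Λ] fun q => q.1 := by
  have h1 := isLittleO_inner_semigroup_sub hs hβ hH h0 hw x
  have h2 : Tendsto (fun q => inner ℝ (p q) (semigroup sbar β q.1 x))
      (smallTime sbar Γ Λ) (𝓝 (inner ℝ p₀ x)) := by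
    refine hp.inner ?_
    have := ((continuous_semigroup_left sbar β x).tendsto 0).comp
      (tendsto_fst_smallTime sbar Γ Λ)
    rwa [semigroup_zero] at this
  have h3 := (isLittleO_exp_sub_one (sbar := sbar) (Γ := Γ) (Λ := Λ) (-μ)).mul_isBigO
    (h2.isBigO_one ℝ)
  have h4 : Tendsto (fun q => -μ * (inner ℝ (p q) (semigroup sbar β q.1 x) - inner ℝ p₀ x))
      (smallTime sbar Γ Λ) (𝓝 0) := by
    have := (h2.sub_const (inner ℝ p₀ x)).const_mul (-μ)
    simpa using this
  have h5 := isLittleO_mul_of_tendsto_zero (g := fun q => q.1) h4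
  simp only [mul_one] at h3
  -- Write `e^{-μh}T(h)x - x` as `T(h)x - x` plus `(e^{-μh} - 1)T(h)x`; `h3` linearises the
  -- exponential and `h5` replaces `⟨p, T(h)x⟩` by its limit.
  refine ((h1.add h3).add h5).congr_left fun q => ?_
  simp only [inner_sub_right, inner_smul_right]
  ring

/-- `T(σ)γ - γ` is not assumed uniformly small over the control values `γ`. The semigroup is
therefore moved by duality onto the fixed vector `p₀`, where strong continuity suffices, and the
controls enter only through their norm bound. -/
theorem isLittleO_inner_duhamel {sbar β μ : ℝ} {Γ Λ : Set ℝ} (hΛ : IsCompact Λ)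
    {p : ℝ × (ℝ → State sbar) × (ℝ → ℝ) → State sbar} {p₀ : State sbar}
    (hp : Tendsto p (smallTime sbar Γ Λ) (𝓝 p₀)) :
    (fun q => inner ℝ (p q) (duhamel sbar β μ q.2.1 q.1)
        - ∫ τ in (0 : ℝ)..q.1, inner ℝ p₀ (q.2.1 τ))
      =o[smallTime sbar Γ Λ] fun q => q.1 := by
  obtain ⟨M, hM0, hM⟩ := exists_norm_controlValues_le sbar hΛ
  have key : (fun q : ℝ × (ℝ → State sbar) × (ℝ → ℝ) => ∫ τ in (0 : ℝ)..q.1,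
      (inner ℝ (p q) (Real.exp (-μ * (q.1 - τ)) • semigroup sbar β (q.1 - τ) (q.2.1 τ))
        - inner ℝ p₀ (q.2.1 τ))) =o[smallTime sbar Γ Λ] fun q => q.1 := by
    apply isLittleO_integral
    intro ε hε
    have h1 : Tendsto (fun q => ‖p q - p₀‖ * (Real.exp (|μ| * q.1) * M))
        (smallTime sbar Γ Λ) (𝓝 0) := by
      have hc : Continuous fun s : ℝ => Real.exp (|μ| * s) * M := by fun_prop
      have := (tendsto_iff_norm_sub_tendsto_zero.1 hp).mul
        ((hc.tendsto 0).comp (tendsto_fst_smallTime sbar Γ Λ))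
      simpa using this
    have h2 : Tendsto (fun σ => ‖Real.exp (-μ * σ) • semigroup sbar β (-σ) p₀ - p₀‖ * M)
        (𝓝 0) (𝓝 0) := by
      have hc : Continuous fun σ =>
          ‖Real.exp (-μ * σ) • semigroup sbar β (-σ) p₀ - p₀‖ * M :=
        ((((by fun_prop : Continuous fun s : ℝ => Real.exp (-μ * s)).smul
          ((continuous_semigroup_left sbar β p₀).comp continuous_neg)).sub
          continuous_const).norm).mul_const M
      simpa [semigroup_zero] using hc.tendsto 0
    filter_upwards [eventually_abs_le_of_tendsto h1 (half_pos hε),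
      eventually_forall_earlier_of_tendsto h2 (half_pos hε),
      eventually_admissible sbar Γ Λ] with q hq1 hq2 hadm τ hτ0 hτ
    have hα := hM _ (hadm.2.1.2 τ hτ0.le)
    have e : inner ℝ (p q) (Real.exp (-μ * (q.1 - τ)) • semigroup sbar β (q.1 - τ) (q.2.1 τ))
        - inner ℝ p₀ (q.2.1 τ)
        = inner ℝ (p q - p₀) (Real.exp (-μ * (q.1 - τ)) • semigroup sbar β (q.1 - τ) (q.2.1 τ))
          + inner ℝ (Real.exp (-μ * (q.1 - τ)) • semigroup sbar β (-(q.1 - τ)) p₀ - p₀)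
            (q.2.1 τ) := by
      rw [inner_sub_left, inner_sub_left, real_inner_smul_left, inner_semigroup_adjoint, neg_neg,
        inner_smul_right, inner_smul_right]
      ring
    rw [e]
    have h3 := (abs_real_inner_le_norm (p q - p₀)
      (Real.exp (-μ * (q.1 - τ)) • semigroup sbar β (q.1 - τ) (q.2.1 τ))).trans
      (mul_le_mul_of_nonneg_left (norm_duhamel_integrand_le (β := β) (μ := μ) (s := q.1) (τ := τ)
        (h := q.1) (by linarith) (by linarith) hα) (norm_nonneg _))
    have h4 := (abs_real_inner_le_norm
      (Real.exp (-μ * (q.1 - τ)) • semigroup sbar β (-(q.1 - τ)) p₀ - p₀) (q.2.1 τ)).trans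
      (mul_le_mul_of_nonneg_left hα (norm_nonneg _))
    have h5 := (le_abs_self _).trans hq1
    have h6 := (le_abs_self _).trans (hq2 (q.1 - τ) (by linarith) (by linarith))
    exact (abs_add_le _ _).trans (by linarith)
  refine key.congr' ?_ EventuallyEq.rfl
  filter_upwards [eventually_admissible sbar Γ Λ] with q hq
  have h1 := intervalIntegrable_duhamel (β := β) (μ := μ) hΛ hq.2.1 le_rfl hq.1.le le_rfl
  have h2 : IntervalIntegrable (fun τ => inner ℝ (p q)
      (Real.exp (-μ * (q.1 - τ)) • semigroup sbar β (q.1 - τ) (q.2.1 τ))) volume 0 q.1 := by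
    rw [intervalIntegrable_iff] at h1 ⊢
    exact h1.const_inner (p q)
  have h3 := (innerSL ℝ (p q)).intervalIntegral_comp_comm h1
  simp only [innerSL_apply_apply] at h3
  rw [intervalIntegral.integral_sub h2 (intervalIntegrable_inner_control hΛ p₀ hq.2.1 hq.1.le),
    h3, duhamel]

/-- Both representatives vanish at `sbar`, so Cauchy–Schwarz on the derivatives gives a uniform
bound: convergence of `A* p` forces convergence of the traces at `0`. -/
theorem IsH1.abs_sub_le {sbar : ℝ} (hs : 0 ≤ sbar) {p w p' w' : State sbar} {F F' : ℝ → ℝ}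
    (h : IsH1 sbar p w F) (h0 : F sbar = 0) (h' : IsH1 sbar p' w' F') (h0' : F' sbar = 0)
    {r : ℝ} (hr : r ∈ Icc 0 sbar) : |F r - F' r| ≤ √sbar * ‖w - w'‖ := by
  have hi : ∀ u : State sbar, IntegrableOn (u : ℝ → ℝ) (Ioc r sbar) volume := fun u =>
    IntegrableOn.mono_set (integrable_state u) (Ioc_subset_Ioc_left hr.1)
  refine le_trans ?_ (integral_abs_state_le hs (w - w'))
  rw [h.eq_neg_integral hs h0 hr, h'.eq_neg_integral hs h0' hr, ← neg_sub', abs_neg,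
    intervalIntegral.integral_of_le hr.2, intervalIntegral.integral_of_le hr.2,
    ← integral_sub (hi w) (hi w')]
  have e : ∫ t in Ioc r sbar, (w t - w' t) = ∫ t in Ioc r sbar, (w - w' : State sbar) t := by
    refine integral_congr_ae ?_
    filter_upwards [ae_restrict_of_ae_restrict_of_subset (Ioc_subset_Ioc_left hr.1)
      (Lp.coeFn_sub w w')] with t ht
    rw [ht, Pi.sub_apply]
  rw [e]
  refine (norm_integral_le_integral_norm (G := ℝ) _).trans ?_
  exact setIntegral_mono_set (μ := volume) (integrable_state (w - w')).norm
    (ae_of_all _ fun _ => norm_nonneg _) (Ioc_subset_Ioc_left hr.1).eventuallyLE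

/-- The position `r` holds what entered at time `τ = h - r / β`, and `dr = β dτ`. The condition `β h
≤ sbar` says that no inflow has left yet. -/
theorem inner_boundary {sbar β μ : ℝ} (hβ : 0 < β) {Γ : Set ℝ} (hΓ : IsCompact Γ)
    {a : ℝ → ℝ} (ha : a ∈ boundaryControls Γ) {h : ℝ} (hh : 0 ≤ h) (hle : β * h ≤ sbar)
    {p w : State sbar} {F : ℝ → ℝ} (hp : IsH1 sbar p w F) :
    inner ℝ p (toL2 sbar (boundaryFun β μ a h))
      = ∫ τ in (0 : ℝ)..h, β * (F (β * (h - τ)) * Real.exp (-μ * (h - τ)) * a τ) := by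
  have hbh : 0 ≤ β * h := by positivity
  have e1 : inner ℝ p (toL2 sbar (boundaryFun β μ a h))
      = ∫ r in (0 : ℝ)..(β * h), F r * Real.exp (-(μ / β) * r) * a (h - r / β) := by
    rw [real_inner_comm, inner_toL2_left (memLp_boundaryFun sbar β μ hβ Γ hΓ a ha h),
      intervalIntegral.integral_of_le hbh, integral_Ioc_eq_integral_Ioo (x := 0) (y := β * h),
      ← integral_indicator measurableSet_Ioo, ← integral_indicator measurableSet_Ioc]
    refine integral_congr_ae ?_
    have h1 := hp.1
    rw [Filter.EventuallyEq, ae_restrict_iff' measurableSet_Ioc] at h1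
    filter_upwards [h1] with r hr
    by_cases hr1 : r ∈ Ioc 0 sbar
    · rw [indicator_of_mem hr1, hr hr1]
      unfold boundaryFun
      by_cases hr2 : r < β * h
      · rw [if_pos hr2, indicator_of_mem (show r ∈ Ioo 0 (β * h) from ⟨hr1.1, hr2⟩)]
        ring
      · rw [if_neg hr2, zero_mul, indicator_of_notMem (fun h => hr2 h.2)]
    · rw [indicator_of_notMem hr1,
        indicator_of_notMem (fun h => hr1 ⟨h.1, h.2.le.trans hle⟩)]
  have e2 := intervalIntegral.integral_comp_sub_left (a := 0) (b := h)
    (fun u => β * (F (β * u) * Real.exp (-μ * u) * a (h - u))) h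
  simp only [sub_sub_cancel, sub_self, sub_zero] at e2
  have e3 := intervalIntegral.mul_integral_comp_mul_left (a := 0) (b := h)
    (f := fun r => F r * Real.exp (-(μ / β) * r) * a (h - r / β)) β
  rw [mul_zero] at e3
  rw [e1, e2, ← e3, ← intervalIntegral.integral_const_mul]
  refine intervalIntegral.integral_congr fun u _ => ?_
  have h1 : -(μ / β) * (β * u) = -μ * u := by field_simp
  simp only [h1, mul_div_cancel_left₀ u hβ.ne']

/-- The inflow occupies `(0, β h)`, where `F q` is uniformly close to `F₀ 0`; boundedness of `a` is
enough. This produces `δ₀`. -/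
theorem isLittleO_inner_boundary {sbar β μ : ℝ} (hs : 0 < sbar) (hβ : 0 < β) {Γ Λ : Set ℝ}
    (hΓ : IsCompact Γ)
    {p w : ℝ × (ℝ → State sbar) × (ℝ → ℝ) → State sbar}
    {F : ℝ × (ℝ → State sbar) × (ℝ → ℝ) → ℝ → ℝ} (hH : ∀ q, IsH1 sbar (p q) (w q) (F q))
    (h0 : ∀ q, F q sbar = 0) {p₀ w₀ : State sbar} {F₀ : ℝ → ℝ} (hH₀ : IsH1 sbar p₀ w₀ F₀)
    (h0' : F₀ sbar = 0) (hw : Tendsto w (smallTime sbar Γ Λ) (𝓝 w₀)) :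
    (fun q => inner ℝ (p q) (toL2 sbar (boundaryFun β μ q.2.2 q.1))
        - ∫ τ in (0 : ℝ)..q.1, β * F₀ 0 * q.2.2 τ)
      =o[smallTime sbar Γ Λ] fun q => q.1 := by
  have hsmall : ∀ᶠ q in smallTime sbar Γ Λ, β * q.1 ≤ sbar := by
    have hc : Tendsto (fun q : ℝ × (ℝ → State sbar) × (ℝ → ℝ) => β * q.1)
        (smallTime sbar Γ Λ) (𝓝 0) := by
      simpa using (tendsto_fst_smallTime sbar Γ Λ).const_mul β
    exact (hc.eventually (gt_mem_nhds hs)).mono fun q hq => le_of_lt hq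
  have key : (fun q : ℝ × (ℝ → State sbar) × (ℝ → ℝ) => ∫ τ in (0 : ℝ)..q.1,
      (β * (F q (β * (q.1 - τ)) * Real.exp (-μ * (q.1 - τ)) * q.2.2 τ) - β * F₀ 0 * q.2.2 τ))
      =o[smallTime sbar Γ Λ] fun q => q.1 := by
    apply isLittleO_integral
    intro ε hε
    have h1 : Tendsto (fun q => β * setNorm Γ * (√sbar * ‖w q - w₀‖ * Real.exp (|μ| * q.1)))
        (smallTime sbar Γ Λ) (𝓝 0) := by
      have hc : Continuous fun s : ℝ => Real.exp (|μ| * s) := by fun_prop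
      have := (((tendsto_iff_norm_sub_tendsto_zero.1 hw).const_mul (√sbar)).mul
        ((hc.tendsto 0).comp (tendsto_fst_smallTime sbar Γ Λ))).const_mul (β * setNorm Γ)
      simpa using this
    -- `F₀` is controlled only on `[0, sbar]`; clamping the argument gives a continuous function on
    -- the line.
    obtain ⟨G, hG⟩ : ∃ G : ℝ → ℝ, G = fun r => F₀ (max 0 (min r sbar)) := ⟨_, rfl⟩
    have hGc : Continuous G := by
      rw [hG]
      refine hH₀.continuousOn.comp_continuous (by fun_prop) fun r => ?_
      exact ⟨le_max_left _ _, max_le hs.le (min_le_right _ _)⟩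
    have hGe : ∀ r ∈ Icc 0 sbar, G r = F₀ r := fun r hr => by
      rw [hG]; simp only [min_eq_left hr.2, max_eq_right hr.1]
    have h2 : Tendsto (fun σ => β * setNorm Γ * |G (β * σ) * Real.exp (-μ * σ) - F₀ 0|)
        (𝓝 0) (𝓝 0) := by
      have hc : Continuous fun σ =>
          β * setNorm Γ * |G (β * σ) * Real.exp (-μ * σ) - F₀ 0| := by fun_prop
      have := hc.tendsto 0
      simpa [hGe 0 ⟨le_rfl, hs.le⟩] using this
    filter_upwards [eventually_abs_le_of_tendsto h1 (half_pos hε),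
      eventually_forall_earlier_of_tendsto h2 (half_pos hε), hsmall,
      eventually_admissible sbar Γ Λ] with q hq1 hq2 hqs hadm τ hτ0 hτ
    obtain ⟨σ, hσ⟩ : ∃ σ, σ = q.1 - τ := ⟨_, rfl⟩
    have hσ0 : 0 ≤ σ := by linarith
    have hσ1 : σ ≤ q.1 := by linarith
    have hr : β * σ ∈ Icc 0 sbar :=
      ⟨by positivity, (mul_le_mul_of_nonneg_left hσ1 hβ.le).trans hqs⟩
    rw [← hσ]
    have e : β * (F q (β * σ) * Real.exp (-μ * σ) * q.2.2 τ) - β * F₀ 0 * q.2.2 τ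
        = β * q.2.2 τ * ((F q (β * σ) - F₀ (β * σ)) * Real.exp (-μ * σ)
          + (G (β * σ) * Real.exp (-μ * σ) - F₀ 0)) := by
      rw [hGe _ hr]; ring
    rw [e, abs_mul, abs_mul, abs_of_pos hβ]
    have h3 := abs_le_setNorm hΓ (hadm.2.2.2 τ hτ0.le)
    have h4 := (hH q).abs_sub_le hs.le (h0 q) hH₀ h0' hr
    have h5 := (le_abs_self _).trans hq1
    have h6 := (le_abs_self _).trans (hq2 σ hσ0 hσ1)
    have h7 : -μ * σ ≤ |μ| * q.1 := by
      calc -μ * σ ≤ |μ| * σ := by gcongr; exact neg_le_abs μ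
        _ ≤ _ := by gcongr
    calc β * |q.2.2 τ| * |(F q (β * σ) - F₀ (β * σ)) * Real.exp (-μ * σ)
          + (G (β * σ) * Real.exp (-μ * σ) - F₀ 0)|
        ≤ β * setNorm Γ * (√sbar * ‖w q - w₀‖ * Real.exp (|μ| * q.1)
          + |G (β * σ) * Real.exp (-μ * σ) - F₀ 0|) := by
          refine mul_le_mul (mul_le_mul_of_nonneg_left h3 hβ.le) ?_ (abs_nonneg _)
            (mul_nonneg hβ.le setNorm_nonneg)
          refine (abs_add_le _ _).trans (add_le_add ?_ le_rfl)
          rw [abs_mul, Real.abs_exp]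
          gcongr
      _ ≤ ε := by linarith
  refine key.congr' ?_ EventuallyEq.rfl
  filter_upwards [eventually_admissible sbar Γ Λ, hsmall] with q hq hqs
  have hai := intervalIntegrable_boundaryControl hΓ hq.2.2 hq.1.le
  have hFc : ContinuousOn (fun τ => β * (F q (β * (q.1 - τ)) * Real.exp (-μ * (q.1 - τ))))
      (uIcc 0 q.1) := by
    rw [uIcc_of_le hq.1.le]
    refine ContinuousOn.mul continuousOn_const (ContinuousOn.mul ?_ (by fun_prop))
    refine (hH q).continuousOn.comp (by fun_prop) fun τ hτ => ⟨?_, ?_⟩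
    · exact mul_nonneg hβ.le (by linarith [hτ.2])
    · exact (mul_le_mul_of_nonneg_left (by linarith [hτ.1]) hβ.le).trans hqs
  have hi := hai.continuousOn_mul hFc
  simp only [mul_assoc] at hi
  rw [inner_boundary hβ hΓ hq.2.2 hq.1.le hqs (hH q), ← intervalIntegral.integral_sub
    (by simpa only [mul_assoc] using hi) (hai.const_mul _)]

/-! ### Radial test functions -/

theorem exists_norm_eq_one_state {sbar : ℝ} (hs : 0 < sbar) : ∃ e : State sbar, ‖e‖ = 1 := by
  have h1 : MemLp (fun _ : ℝ => (1 : ℝ)) 2 (leb sbar) := memLp_const 1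
  have h2 : ‖toL2 sbar (fun _ => (1 : ℝ))‖ ^ 2 = sbar := by
    rw [norm_toL2_sq h1]
    simp [hs.le]
  have h3 : toL2 sbar (fun _ => (1 : ℝ)) ≠ 0 := by
    intro h
    rw [h, norm_zero] at h2
    simp at h2
    exact hs.ne h2
  exact ⟨_, norm_smul_inv_norm (𝕜 := ℝ) h3⟩

/-- The even `C²` profile of a test function of type 2 and its radial slope. -/
structure RadialProfile (sbar : ℝ) (g : State sbar → ℝ) (g₀ ψ : ℝ → ℝ) : Prop where
  contDiff : ContDiff ℝ 2 ψ
  eq_norm : ∀ x, g x = ψ ‖x‖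
  deriv_eq : ∀ r, 0 ≤ r → deriv ψ r = r * radialSlope g₀ r
  slope_nonneg : ∀ r, 0 ≤ r → 0 ≤ radialSlope g₀ r
  slope_continuous : ContinuousOn (radialSlope g₀) (Ici 0)

/-- Restrict `g` to a line through `0`. The result is `C²` and even, so its derivative vanishes at
`0` and `ψ'(t)/t` tends to `ψ''(0)`; this extends the slope continuously. Its sign comes from the
monotonicity of `g₀`. As `g₀` matters only on `[0, ∞)`, its derivative is compared with `ψ'` for `t
> 0` alone. -/
theorem IsTest2.exists_profile {sbar : ℝ} (hs : 0 < sbar) {g : State sbar → ℝ} {g₀ : ℝ → ℝ}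
    (hg : IsTest2 sbar g g₀) : ∃ ψ, RadialProfile sbar g g₀ ψ := by
  obtain ⟨e, he⟩ := exists_norm_eq_one_state hs
  obtain ⟨hg2, hmono, hrad⟩ := hg
  obtain ⟨ψ, hψ⟩ : ∃ ψ : ℝ → ℝ, ψ = fun t => g (t • e) := ⟨_, rfl⟩
  have hval : ∀ t, ψ t = g₀ |t| := fun t => by
    rw [hψ]; simp only [hrad, norm_smul, he, mul_one, Real.norm_eq_abs]
  have hc : ContDiff ℝ 2 ψ := by
    rw [hψ]; exact hg2.comp (contDiff_id.smul contDiff_const)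
  have heven : ∀ t, ψ (-t) = ψ t := fun t => by rw [hval, hval, abs_neg]
  have hd0 : deriv ψ 0 = 0 := by
    have h := deriv_comp_neg ψ 0
    simp only [heven, neg_zero] at h
    linarith
  have hdiff : Differentiable ℝ ψ := hc.differentiable (by norm_num)
  have hc1 : ContDiff ℝ 1 (deriv ψ) := by
    have h : ContDiff ℝ (1 + 1) ψ := by
      rw [one_add_one_eq_two]; exact hc
    exact (contDiff_succ_iff_deriv.1 h).2.2
  have hderiv : ∀ t, 0 < t → deriv g₀ t = deriv ψ t := fun t ht => by
    refine Filter.EventuallyEq.deriv_eq ?_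
    filter_upwards [Ioi_mem_nhds ht] with u hu
    rw [hval, abs_of_pos hu]
  have hlim : Tendsto (fun t => deriv g₀ t / t) (𝓝[>] 0) (𝓝 (deriv (deriv ψ) 0)) := by
    have h1 := hasDerivAt_iff_tendsto_slope.1
      ((hc1.differentiable (by norm_num)) 0).hasDerivAt
    have h2 := h1.mono_left (nhdsWithin_mono 0 (fun t (ht : 0 < t) => ht.ne'))
    refine h2.congr' ?_
    filter_upwards [self_mem_nhdsWithin] with t ht
    rw [slope_def_field, hd0, sub_zero, sub_zero, hderiv t ht]
  have hslope : ∀ t, 0 < t → radialSlope g₀ t = deriv ψ t / t := fun t ht => by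
    rw [radialSlope, if_neg ht.ne', hderiv t ht]
  have hslope0 : radialSlope g₀ 0 = deriv (deriv ψ) 0 := by
    rw [radialSlope, if_pos rfl]; exact hlim.limUnder_eq
  have hpos : ∀ t, 0 < t → 0 ≤ deriv ψ t := fun t ht => by
    have hm : MonotoneOn ψ (Ioi 0) := fun u hu v hv huv => by
      rw [hval, hval, abs_of_pos hu, abs_of_pos hv]
      exact hmono (Ioi_subset_Ici_self hu) (Ioi_subset_Ici_self hv) huv
    have := hm.derivWithin_nonneg (x := t)
    rwa [derivWithin_of_isOpen isOpen_Ioi ht] at this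
  have hpos' : ∀ t, 0 < t → 0 ≤ radialSlope g₀ t := fun t ht => by
    rw [hslope t ht]; exact div_nonneg (hpos t ht) ht.le
  have htend : Tendsto (radialSlope g₀) (𝓝[>] 0) (𝓝 (radialSlope g₀ 0)) := by
    rw [hslope0]
    refine hlim.congr' ?_
    filter_upwards [self_mem_nhdsWithin] with t ht
    rw [hslope t ht, hderiv t ht]
  refine ⟨ψ, hc, fun x => ?_, fun r hr => ?_, fun r hr => ?_, fun r hr => ?_⟩
  · rw [hval, abs_of_nonneg (norm_nonneg x), hrad]
  · rcases hr.eq_or_lt with h | h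
    · rw [← h, hd0, zero_mul]
    · rw [hslope r h, mul_div_cancel₀ _ h.ne']
  · rcases hr.eq_or_lt with h | h
    · rw [← h]
      refine ge_of_tendsto htend ?_
      filter_upwards [self_mem_nhdsWithin] with t ht using hpos' t ht
    · exact hpos' r h
  · rcases (mem_Ici.1 hr).eq_or_lt with h | h
    · rw [← h]
      exact continuousWithinAt_Ioi_iff_Ici.1 htend
    · have h1 : ContinuousAt (fun t => deriv ψ t / t) r :=
        hc1.continuous.continuousAt.div continuousAt_id h.ne'
      refine (h1.congr ?_).continuousWithinAt
      filter_upwards [Ioi_mem_nhds h] with t ht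
      rw [hslope t ht]

namespace RadialProfile

variable {sbar : ℝ} {g : State sbar → ℝ} {g₀ ψ : ℝ → ℝ}

theorem differentiable (h : RadialProfile sbar g g₀ ψ) : Differentiable ℝ ψ :=
  h.contDiff.differentiable (by norm_num)

/-- Cauchy's mean value theorem against `t²`: increments of `g` become slopes times increments of
the squared norm, which the energy inequality controls, also at `x = 0`. -/
theorem exists_mean_value_of_lt (h : RadialProfile sbar g g₀ ψ) {r r' : ℝ} (hr : 0 ≤ r)
    (hlt : r < r') :
    ∃ ξ, r ≤ ξ ∧ ξ ≤ r' ∧ ψ r' - ψ r = radialSlope g₀ ξ / 2 * (r' ^ 2 - r ^ 2) := by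
  obtain ⟨c, hc, he⟩ := exists_ratio_hasDerivAt_eq_ratio_slope ψ (deriv ψ) hlt
    h.differentiable.continuous.continuousOn (fun t _ => (h.differentiable t).hasDerivAt)
    (fun t => t ^ 2) (fun t => 2 * t) (by fun_prop)
    (fun t _ => by simpa using hasDerivAt_pow 2 t)
  have hc0 : 0 < c := hr.trans_lt hc.1
  refine ⟨c, hc.1.le, hc.2.le, ?_⟩
  rw [h.deriv_eq c hc0.le] at he
  have h1 : c * ((r' ^ 2 - r ^ 2) * radialSlope g₀ c) = c * ((ψ r' - ψ r) * 2) := by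
    linear_combination he
  have h2 := mul_left_cancel₀ hc0.ne' h1
  linarith

theorem exists_mean_value (h : RadialProfile sbar g g₀ ψ) {r r' : ℝ} (hr : 0 ≤ r) (hr' : 0 ≤ r') :
    ∃ ξ, 0 ≤ ξ ∧ |ξ - r| ≤ |r' - r| ∧
      ψ r' - ψ r = radialSlope g₀ ξ / 2 * (r' ^ 2 - r ^ 2) := by
  rcases lt_trichotomy r r' with h1 | h1 | h1
  · obtain ⟨ξ, h2, h3, h4⟩ := h.exists_mean_value_of_lt hr h1
    refine ⟨ξ, hr.trans h2, ?_, h4⟩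
    rw [abs_of_nonneg (by linarith), abs_of_pos (by linarith)]
    linarith
  · exact ⟨r, hr, by simp, by rw [h1]; ring⟩
  · obtain ⟨ξ, h2, h3, h4⟩ := h.exists_mean_value_of_lt hr' h1
    refine ⟨ξ, hr'.trans h2, ?_, by linarith⟩
    rw [abs_of_nonpos (by linarith), abs_of_neg (by linarith)]
    linarith

theorem gradient_eq (h : RadialProfile sbar g g₀ ψ) (x : State sbar) :
    gradient g x = radialSlope g₀ ‖x‖ • x := by
  apply HasGradientAt.gradient
  rw [hasGradientAt_iff_hasFDerivAt]
  have hd := (h.differentiable ‖x‖).hasDerivAt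
  rw [h.deriv_eq _ (norm_nonneg x)] at hd
  have hg : g = fun y => ψ ‖y‖ := funext h.eq_norm
  rw [hg]
  by_cases hx : x = 0
  · subst hx
    rw [norm_zero, zero_mul] at hd
    rw [smul_zero, map_zero, hasFDerivAt_iff_isLittleO_nhds_zero]
    have h1 := (hasDerivAt_iff_isLittleO_nhds_zero.1 hd).comp_tendsto
      (tendsto_norm_zero (E := State sbar))
    refine (h1.congr_left fun y => ?_).of_norm_right
    simp
  · have hn : ‖x‖ ≠ 0 := norm_ne_zero_iff.2 hx
    have h1 := ((hasStrictFDerivAt_norm_sq x).hasFDerivAt).sqrt (pow_ne_zero 2 hn)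
    simp only [Real.sqrt_sq (norm_nonneg _)] at h1
    convert! hd.comp_hasFDerivAt x h1 using 1
    ext y
    simp
    field_simp

end RadialProfile

/-! ### Expansion of the test functions along the trajectories -/

theorem continuous_gradient {sbar : ℝ} {φ : State sbar → ℝ} (hφ : ContDiff ℝ 1 φ) :
    Continuous (gradient φ) :=
  (InnerProductSpace.toDual ℝ (State sbar)).symm.continuous.comp
    (hφ.continuous_fderiv (by norm_num))

theorem exists_mean_value_gradient {sbar : ℝ} {φ : State sbar → ℝ} (hφ : ContDiff ℝ 1 φ)
    (x y : State sbar) :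
    ∃ z, ‖z - x‖ ≤ ‖y - x‖ ∧ φ y - φ x = inner ℝ (gradient φ z) (y - x) := by
  have hd : Differentiable ℝ φ := hφ.differentiable (by norm_num)
  obtain ⟨z, hz, he⟩ := domain_mvt (s := univ) (fun u _ => (hd u).hasFDerivAt.hasFDerivWithinAt)
    convex_univ (mem_univ x) (mem_univ y)
  exact ⟨z, norm_sub_le_of_mem_segment hz, by rw [he, inner_gradient_left]⟩

/-- A first order Taylor expansion at `x` would not do, since `‖x(h) - x‖` need not be `O(h)`. The
exact mean value formula keeps a gradient in `D(A*)`, and free transport, inflow and Duhamel term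
are expanded separately. -/
theorem IsTest1.isLittleO_sub {sbar β μ lam : ℝ} (hs : 0 < sbar) (hβ : 0 < β) {Γ Λ : Set ℝ}
    (hΓ : IsCompact Γ) (hΛ : IsCompact Λ) {φ : State sbar → ℝ} (hφ : IsTest1 sbar β lam φ)
    (x : State sbar) :
    (fun q : ℝ × (ℝ → State sbar) × (ℝ → ℝ) => φ (trajectory sbar β μ x q.2.1 q.2.2 q.1) - φ x
        - (q.1 * (inner ℝ (opAstar sbar β (gradient φ x)) x + inner ℝ (gradient φ x) (-μ • x))
          + ((∫ τ in (0 : ℝ)..q.1, β * delta0 sbar (gradient φ x) * q.2.2 τ)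
            + ∫ τ in (0 : ℝ)..q.1, inner ℝ (gradient φ x) (q.2.1 τ))))
      =o[smallTime sbar Γ Λ] fun q => q.1 := by
  obtain ⟨hφ1, -, hdom, hcont⟩ := hφ
  choose W F hWF hF0 using hdom
  choose Z hZ hZe using exists_mean_value_gradient hφ1 x
  have hA : ∀ z, opAstar sbar β (gradient φ z) = β • W z := fun z =>
    opAstar_eq hs (hWF z) (hF0 z)
  -- The chosen weak derivatives are unique, so continuity of `A*∇φ` passes to them.
  have hWc : Continuous W := by
    have : W = fun z => β⁻¹ • opAstar sbar β (gradient φ z) := by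
      ext1 z
      rw [hA, smul_smul, inv_mul_cancel₀ hβ.ne', one_smul]
    rw [this]
    exact hcont.const_smul (β⁻¹ : ℝ)
  have hzt : Tendsto (fun q : ℝ × (ℝ → State sbar) × (ℝ → ℝ) =>
      Z (trajectory sbar β μ x q.2.1 q.2.2 q.1)) (smallTime sbar Γ Λ) (𝓝 x) := by
    rw [tendsto_iff_norm_sub_tendsto_zero]
    exact squeeze_zero (fun _ => norm_nonneg _) (fun q => hZ _)
      (tendsto_iff_norm_sub_tendsto_zero.1 (tendsto_trajectory hβ hΓ hΛ x))
  have hp := ((continuous_gradient hφ1).tendsto x).comp hzt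
  have hw := (hWc.tendsto x).comp hzt
  have h1 := isLittleO_inner_free (μ := μ) hs.le hβ
    (fun q => hWF (Z (trajectory sbar β μ x q.2.1 q.2.2 q.1)))
    (fun q => hF0 _) hp hw x
  have h2 := isLittleO_inner_boundary (μ := μ) hs hβ hΓ
    (fun q => hWF (Z (trajectory sbar β μ x q.2.1 q.2.2 q.1))) (fun q => hF0 _) (hWF x) (hF0 x) hw
  have h3 := isLittleO_inner_duhamel (β := β) (μ := μ) hΛ hp
  refine ((h1.add h2).add h3).congr_left fun q => ?_
  rw [hZe, hA, delta0_eq hs (hWF x) (hF0 x)]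
  have e : trajectory sbar β μ x q.2.1 q.2.2 q.1 - x
      = (Real.exp (-μ * q.1) • semigroup sbar β q.1 x - x)
        + toL2 sbar (boundaryFun β μ q.2.2 q.1) + duhamel sbar β μ q.2.1 q.1 := by
    rw [trajectory_eq]; abel
  rw [e, inner_add_right, inner_add_right, real_inner_smul_left, inner_smul_right]
  simp only [Function.comp_apply]
  ring

/-! ### Energy estimate and increments of radial test functions. -/

theorem inner_semigroup_boundary {sbar β μ : ℝ} (hβ : 0 < β) {Γ : Set ℝ} (hΓ : IsCompact Γ)
    {a : ℝ → ℝ} (ha : a ∈ boundaryControls Γ) (h : ℝ) (x : State sbar) :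
    inner ℝ (semigroup sbar β h x) (toL2 sbar (boundaryFun β μ a h)) = 0 := by
  rw [semigroup, inner_toL2_toL2 (memLp_shiftFun sbar β h x)
    (memLp_boundaryFun sbar β μ hβ Γ hΓ a ha h)]
  have e : ∀ r, shiftFun sbar β h x r * boundaryFun β μ a h r = 0 := by
    intro r
    unfold shiftFun boundaryFun
    by_cases hr : r < β * h
    · rw [indicator_of_notMem (fun h' => by linarith [h'.1]), zero_mul]
    · rw [if_neg hr, mul_zero]
  simp only [e, integral_zero]

/-- The energy inequality, up to higher order terms. -/
theorem exists_norm_sq_trajectory_le {sbar β μ : ℝ} (hβ : 0 < β) {Γ Λ : Set ℝ}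
    (hΓ : IsCompact Γ) (hΛ : IsCompact Λ) (x : State sbar) :
    ∃ e : ℝ × (ℝ → State sbar) × (ℝ → ℝ) → ℝ, (e =o[smallTime sbar Γ Λ] fun q => q.1) ∧
      ∀ᶠ q in smallTime sbar Γ Λ,
        ‖trajectory sbar β μ x q.2.1 q.2.2 q.1‖ ^ 2 - ‖x‖ ^ 2
          ≤ (q.1 * (β * setNorm Γ ^ 2 - 2 * μ * ‖x‖ ^ 2)
            + 2 * ∫ τ in (0 : ℝ)..q.1, inner ℝ x (q.2.1 τ)) + e q := by
  obtain ⟨M, hM0, hM⟩ := exists_norm_controlValues_le sbar hΛ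
  have hdO : (fun q : ℝ × (ℝ → State sbar) × (ℝ → ℝ) => duhamel sbar β μ q.2.1 q.1)
      =O[smallTime sbar Γ Λ] fun q => q.1 := by
    have h1 : (fun q : ℝ × (ℝ → State sbar) × (ℝ → ℝ) => Real.exp (|μ| * q.1) * M)
        =O[smallTime sbar Γ Λ] fun _ => (1 : ℝ) := by
      have hc : Continuous fun s : ℝ => Real.exp (|μ| * s) * M := by fun_prop
      exact ((hc.tendsto 0).comp (tendsto_fst_smallTime sbar Γ Λ)).isBigO_one ℝ
    have h2 := h1.mul (Asymptotics.isBigO_refl (fun q : ℝ × (ℝ → State sbar) × (ℝ → ℝ) => q.1) _)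
    simp only [one_mul] at h2
    refine (Asymptotics.IsBigO.of_bound 1 ?_).trans h2
    filter_upwards [eventually_admissible sbar Γ Λ] with q hq
    rw [one_mul]
    exact (norm_duhamel_le hM hq.2.1 hq.1.le).trans (le_abs_self _)
  have hy : Tendsto (fun q : ℝ × (ℝ → State sbar) × (ℝ → ℝ) =>
      Real.exp (-μ * q.1) • semigroup sbar β q.1 x) (smallTime sbar Γ Λ) (𝓝 x) := by
    have hc : Continuous fun s => Real.exp (-μ * s) • semigroup sbar β s x :=
      (by fun_prop : Continuous fun s : ℝ => Real.exp (-μ * s)).smul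
        (continuous_semigroup_left sbar β x)
    have h1 := (hc.tendsto 0).comp (tendsto_fst_smallTime sbar Γ Λ)
    rwa [semigroup_zero, mul_zero, Real.exp_zero, one_smul] at h1
  have o1 := (isLittleO_exp_sub_one (sbar := sbar) (Γ := Γ) (Λ := Λ) (-2 * μ)).const_mul_left
    (‖x‖ ^ 2)
  have o2 : (fun q : ℝ × (ℝ → State sbar) × (ℝ → ℝ) =>
      q.1 * (setNorm Γ ^ 2 * β * (Real.exp (|μ| * q.1) ^ 2 - 1)))
      =o[smallTime sbar Γ Λ] fun q => q.1 := by
    refine isLittleO_mul_of_tendsto_zero ?_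
    have hc : Continuous fun s : ℝ => setNorm Γ ^ 2 * β * (Real.exp (|μ| * s) ^ 2 - 1) := by
      fun_prop
    simpa [Function.comp_def] using (hc.tendsto 0).comp (tendsto_fst_smallTime sbar Γ Λ)
  have o3 : (fun q : ℝ × (ℝ → State sbar) × (ℝ → ℝ) =>
      ‖duhamel sbar β μ q.2.1 q.1‖ * ‖duhamel sbar β μ q.2.1 q.1‖)
      =o[smallTime sbar Γ Λ] fun q => q.1 := by
    have h1 := hdO.norm_left.mul_isLittleO ((Asymptotics.isLittleO_one_iff ℝ).2
      (tendsto_zero_iff_norm_tendsto_zero.1 (tendsto_duhamel (β := β) (μ := μ) (Γ := Γ) hΛ)))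
    simpa only [mul_one] using h1
  -- The Duhamel term is `O(h)` and the inflow tends to `0`, so their cross term is negligible.
  have o4 : (fun q : ℝ × (ℝ → State sbar) × (ℝ → ℝ) =>
      ‖duhamel sbar β μ q.2.1 q.1‖ * ‖toL2 sbar (boundaryFun β μ q.2.2 q.1)‖)
      =o[smallTime sbar Γ Λ] fun q => q.1 := by
    have h1 := hdO.norm_left.mul_isLittleO ((Asymptotics.isLittleO_one_iff ℝ).2
      (tendsto_zero_iff_norm_tendsto_zero.1
        (tendsto_boundary (sbar := sbar) (μ := μ) (Λ := Λ) hβ hΓ)))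
    simpa only [mul_one] using h1
  have o5 := (isLittleO_inner_duhamel (β := β) (μ := μ) hΛ hy).const_mul_left 2
  refine ⟨_, (((o1.add o2).add o3).add (o4.const_mul_left 2)).add o5, ?_⟩
  filter_upwards [eventually_admissible sbar Γ Λ] with q hq
  obtain ⟨y, hydef⟩ : ∃ y, y = Real.exp (-μ * q.1) • semigroup sbar β q.1 x := ⟨_, rfl⟩
  obtain ⟨b, hb⟩ : ∃ b, b = toL2 sbar (boundaryFun β μ q.2.2 q.1) := ⟨_, rfl⟩
  obtain ⟨d, hd⟩ : ∃ d, d = duhamel sbar β μ q.2.1 q.1 := ⟨_, rfl⟩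
  -- Disjoint supports. The norm bound on `b` alone would leave a cross term of order `√h`.
  have hyb : inner ℝ y b = 0 := by
    rw [hydef, hb, real_inner_smul_left, inner_semigroup_boundary hβ hΓ hq.2.2, mul_zero]
  have hny : ‖y‖ ^ 2 ≤ Real.exp (-2 * μ * q.1) * ‖x‖ ^ 2 := by
    have e1 : Real.exp (-2 * μ * q.1) = Real.exp (-μ * q.1) ^ 2 := by
      rw [← Real.exp_nat_mul]; push_cast; ring_nf
    rw [hydef, norm_smul, Real.norm_eq_abs, Real.abs_exp, mul_pow, e1]
    have := norm_semigroup_le sbar β q.1 x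
    gcongr
  have hnb : ‖b‖ ^ 2 ≤ Real.exp (|μ| * q.1) ^ 2 * setNorm Γ ^ 2 * (β * q.1) :=
    hb ▸ norm_boundary_sq_le hβ hΓ hq.2.2 hq.1.le
  have hbd := (real_inner_comm d b ▸ real_inner_le_norm d b : inner ℝ b d ≤ ‖d‖ * ‖b‖)
  rw [trajectory_eq, ← hydef, ← hb, ← hd, norm_add_sq_real, norm_add_sq_real, inner_add_left, hyb]
  nlinarith

/-- Half the slope at an intermediate radius times the energy inequality, whose direction survives
because the slope is nonnegative. The energy bound is `O(h)`, so moving the slope to `‖x‖` costs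
`o(h)`. -/
theorem IsTest2.exists_sub_le {sbar β μ : ℝ} (hs : 0 < sbar) (hβ : 0 < β) {Γ Λ : Set ℝ}
    (hΓ : IsCompact Γ) (hΛ : IsCompact Λ) {g : State sbar → ℝ} {g₀ : ℝ → ℝ}
    (hg : IsTest2 sbar g g₀) (x : State sbar) :
    ∃ e : ℝ × (ℝ → State sbar) × (ℝ → ℝ) → ℝ, (e =o[smallTime sbar Γ Λ] fun q => q.1) ∧
      ∀ᶠ q in smallTime sbar Γ Λ,
        g (trajectory sbar β μ x q.2.1 q.2.2 q.1) - g x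
          ≤ (q.1 * (inner ℝ (gradient g x) (-μ • x)
              + radialSlope g₀ ‖x‖ * β * (setNorm Γ ^ 2 / 2))
            + ∫ τ in (0 : ℝ)..q.1, inner ℝ (gradient g x) (q.2.1 τ)) + e q := by
  obtain ⟨ψ, hψ⟩ := hg.exists_profile hs
  obtain ⟨M, hM0, hM⟩ := exists_norm_controlValues_le sbar hΛ
  obtain ⟨e, he, hle⟩ := exists_norm_sq_trajectory_le (μ := μ) hβ hΓ hΛ x
  choose Z hZ0 hZ hZe using fun y : State sbar =>
    hψ.exists_mean_value (norm_nonneg x) (norm_nonneg y)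
  have hzt : Tendsto (fun q : ℝ × (ℝ → State sbar) × (ℝ → ℝ) =>
      radialSlope g₀ (Z (trajectory sbar β μ x q.2.1 q.2.2 q.1))) (smallTime sbar Γ Λ)
      (𝓝 (radialSlope g₀ ‖x‖)) := by
    have h1 : Tendsto (fun q : ℝ × (ℝ → State sbar) × (ℝ → ℝ) =>
        Z (trajectory sbar β μ x q.2.1 q.2.2 q.1)) (smallTime sbar Γ Λ) (𝓝 ‖x‖) := by
      rw [tendsto_iff_norm_sub_tendsto_zero]
      exact squeeze_zero (fun _ => norm_nonneg _) (fun q => hZ _)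
        (tendsto_iff_norm_sub_tendsto_zero.1 (tendsto_trajectory hβ hΓ hΛ x).norm)
    exact (hψ.slope_continuous ‖x‖ (norm_nonneg x)).tendsto.comp
      (tendsto_nhdsWithin_iff.2 ⟨h1, Eventually.of_forall fun q => hZ0 _⟩)
  have hUO : (fun q : ℝ × (ℝ → State sbar) × (ℝ → ℝ) =>
      q.1 * (β * setNorm Γ ^ 2 - 2 * μ * ‖x‖ ^ 2)
        + 2 * ∫ τ in (0 : ℝ)..q.1, inner ℝ x (q.2.1 τ)) =O[smallTime sbar Γ Λ] fun q => q.1 := by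
    refine Asymptotics.IsBigO.add ?_ (Asymptotics.IsBigO.const_mul_left ?_ 2)
    · have := (Asymptotics.isBigO_refl (fun q : ℝ × (ℝ → State sbar) × (ℝ → ℝ) => q.1)
        (smallTime sbar Γ Λ)).const_mul_left (β * setNorm Γ ^ 2 - 2 * μ * ‖x‖ ^ 2)
      exact this.congr_left fun q => mul_comm _ _
    · refine Asymptotics.IsBigO.of_bound (‖x‖ * M) ?_
      filter_upwards [eventually_admissible sbar Γ Λ] with q hq
      have h := intervalIntegral.norm_integral_le_of_norm_le_const (a := 0) (b := q.1)
        (f := fun τ => inner ℝ x (q.2.1 τ)) (C := ‖x‖ * M) (fun τ hτ => by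
          rw [uIoc_of_le hq.1.le] at hτ
          exact (norm_inner_le_norm _ _).trans
            (mul_le_mul_of_nonneg_left (hM _ (hq.2.1.2 τ hτ.1.le)) (norm_nonneg _)))
      rwa [sub_zero] at h
  have hk0 : Tendsto (fun q : ℝ × (ℝ → State sbar) × (ℝ → ℝ) =>
      (radialSlope g₀ (Z (trajectory sbar β μ x q.2.1 q.2.2 q.1)) - radialSlope g₀ ‖x‖) / 2)
      (smallTime sbar Γ Λ) (𝓝 0) := by
    simpa using (hzt.sub_const (radialSlope g₀ ‖x‖)).div_const 2
  have o1 := ((Asymptotics.isLittleO_one_iff ℝ).2 hk0).mul_isBigO hUO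
  have o2 := ((hzt.div_const 2).isBigO_one ℝ).mul_isLittleO he
  simp only [one_mul] at o1 o2
  refine ⟨_, o1.add o2, ?_⟩
  filter_upwards [hle] with q hq
  rw [hψ.eq_norm, hψ.eq_norm, hZe, hψ.gradient_eq]
  simp only [real_inner_smul_left, inner_smul_right, intervalIntegral.integral_const_mul,
    real_inner_self_eq_norm_sq]
  have h1 := mul_le_mul_of_nonneg_left hq (half_pos (one_pos (α := ℝ))).le
  have h2 := mul_le_mul_of_nonneg_left h1
    (hψ.slope_nonneg _ (hZ0 (trajectory sbar β μ x q.2.1 q.2.2 q.1)))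
  linarith

namespace Assumptions

variable {sbar β ρ lam CL : ℝ} (μ : ℝ) {Γ Λ : Set ℝ} {L : State sbar → State sbar → ℝ → ℝ}

/-- The state is frozen at `x` by (L1), the discount by (L2), uniformly in the controls. -/
theorem isLittleO_running (H : Assumptions sbar β ρ lam Γ Λ L CL) (x : State sbar) :
    (fun q : ℝ × (ℝ → State sbar) × (ℝ → ℝ) =>
        (∫ s in (0 : ℝ)..q.1, Real.exp (-ρ * s)
          * L (trajectory sbar β μ x q.2.1 q.2.2 s) (q.2.1 s) (q.2.2 s))
        - ∫ s in (0 : ℝ)..q.1, L x (q.2.1 s) (q.2.2 s))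
      =o[smallTime sbar Γ Λ] fun q => q.1 := by
  have hCL := H.bound_nonneg
  obtain ⟨K, hK0, hK⟩ := exists_bNorm_le (lam := lam) H.sbar_pos.le H.beta_pos H.lam_pos
  have key : (fun q : ℝ × (ℝ → State sbar) × (ℝ → ℝ) => ∫ s in (0 : ℝ)..q.1,
      (Real.exp (-ρ * s) * L (trajectory sbar β μ x q.2.1 q.2.2 s) (q.2.1 s) (q.2.2 s)
        - L x (q.2.1 s) (q.2.2 s))) =o[smallTime sbar Γ Λ] fun q => q.1 := by
    apply isLittleO_integral
    intro ε hε
    have h1 : Tendsto (fun q : ℝ × (ℝ → State sbar) × (ℝ → ℝ) =>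
        CL * (K * ‖trajectory sbar β μ x q.2.1 q.2.2 q.1 - x‖)) (smallTime sbar Γ Λ) (𝓝 0) := by
      have := ((tendsto_iff_norm_sub_tendsto_zero.1 (tendsto_trajectory (μ := μ) H.beta_pos
        H.compact_boundary H.compact_distributed x)).const_mul K).const_mul CL
      simpa using this
    have h2 : Tendsto (fun s => |Real.exp (-ρ * s) - 1| * CL) (𝓝 0) (𝓝 0) := by
      have hc : Continuous fun s => |Real.exp (-ρ * s) - 1| * CL := by fun_prop
      simpa using hc.tendsto 0
    filter_upwards [Eventually.forall_earlier (eventually_abs_le_of_tendsto h1 (half_pos hε)),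
      eventually_forall_earlier_of_tendsto h2 (half_pos hε),
      eventually_admissible sbar Γ Λ] with q hq1 hq2 hadm s hs0 hs
    have hα := hadm.2.1.2 s hs0.le
    have ha := hadm.2.2.2 s hs0.le
    obtain ⟨X, hX⟩ : ∃ X, X = trajectory sbar β μ x q.2.1 q.2.2 s := ⟨_, rfl⟩
    have h3 := (le_abs_self _).trans (hq1 s hs0 hs)
    have h4 := (le_abs_self _).trans (hq2 s hs0.le hs)
    rw [← hX] at h3 ⊢
    have h5 := (H.lipschitz X x _ hα _ ha).trans (mul_le_mul_of_nonneg_left (hK (X - x)) hCL)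
    have h6 := mul_le_mul_of_nonneg_left (H.bounded X _ hα _ ha)
      (abs_nonneg (Real.exp (-ρ * s) - 1))
    have e : Real.exp (-ρ * s) * L X (q.2.1 s) (q.2.2 s) - L x (q.2.1 s) (q.2.2 s)
        = (Real.exp (-ρ * s) - 1) * L X (q.2.1 s) (q.2.2 s)
          + (L X (q.2.1 s) (q.2.2 s) - L x (q.2.1 s) (q.2.2 s)) := by ring
    rw [e]
    refine (abs_add_le _ _).trans ?_
    rw [abs_mul]
    linarith
  refine key.congr' ?_ EventuallyEq.rfl
  filter_upwards [eventually_admissible sbar Γ Λ] with q hq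
  rw [intervalIntegral.integral_sub]
  · rw [intervalIntegrable_iff, uIoc_of_le hq.1.le]
    exact (H.integrableOn_running μ x hq.2.1 hq.2.2).mono_set Ioc_subset_Ioi_self
  · exact H.intervalIntegrable_lagrangian x hq.2.1 hq.2.2 hq.1.le

end Assumptions

/-! ### The value function is a viscosity solution -/

/-- The controls may depend on `h`: uniform expansions can be evaluated along nearly optimal
controls. -/
theorem tendsto_smallTime {sbar : ℝ} {Γ Λ : Set ℝ} {α : ℝ → ℝ → State sbar} {a : ℝ → ℝ → ℝ}
    (hα : ∀ h, α h ∈ distributedControls sbar Λ) (ha : ∀ h, a h ∈ boundaryControls Γ) :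
    Tendsto (fun h => (h, α h, a h)) (𝓝[>] 0) (smallTime sbar Γ Λ) :=
  tendsto_id.prodMk (tendsto_principal.2 (Eventually.of_forall fun h => ⟨hα h, ha h⟩))

theorem nonpos_of_mul_le_isLittleO {c : ℝ} {e : ℝ → ℝ} (he : e =o[𝓝[>] 0] fun h => h)
    (hc : ∀ᶠ h in 𝓝[>] 0, h * c ≤ e h) : c ≤ 0 := by
  refine le_of_forall_pos_le_add fun ε hε => ?_
  obtain ⟨h, h1, h2, h3⟩ := (hc.and
    ((Asymptotics.isLittleO_iff.1 he hε).and self_mem_nhdsWithin)).exists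
  have h3' : 0 < h := h3
  have h4 : h * c ≤ h * (0 + ε) := by
    rw [Real.norm_eq_abs, Real.norm_eq_abs, abs_of_pos h3'] at h2
    linarith [le_abs_self (e h)]
  exact le_of_mul_le_mul_left h4 h3'

/-- The increment of a test function `φ + g` along the trajectories. -/
theorem exists_test_sub_le {sbar β μ lam : ℝ} (hs : 0 < sbar) (hβ : 0 < β) {Γ Λ : Set ℝ}
    (hΓ : IsCompact Γ) (hΛ : IsCompact Λ) {φ g : State sbar → ℝ} {g₀ : ℝ → ℝ}
    (hφ : IsTest1 sbar β lam φ) (hg : IsTest2 sbar g g₀) (x : State sbar) :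
    ∃ e : ℝ × (ℝ → State sbar) × (ℝ → ℝ) → ℝ, (e =o[smallTime sbar Γ Λ] fun q => q.1) ∧
      ∀ᶠ q in smallTime sbar Γ Λ,
        (φ (trajectory sbar β μ x q.2.1 q.2.2 q.1) + g (trajectory sbar β μ x q.2.1 q.2.2 q.1))
            - (φ x + g x)
          ≤ (q.1 * (inner ℝ (opAstar sbar β (gradient φ x)) x
              + inner ℝ (gradient φ x + gradient g x) (-μ • x)
              + radialSlope g₀ ‖x‖ * β * (setNorm Γ ^ 2 / 2))
            + ((∫ τ in (0 : ℝ)..q.1, β * delta0 sbar (gradient φ x) * q.2.2 τ)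
              + ∫ τ in (0 : ℝ)..q.1, inner ℝ (gradient φ x + gradient g x) (q.2.1 τ))) + e q := by
  obtain ⟨e, he, hle⟩ := hg.exists_sub_le (μ := μ) hs hβ hΓ hΛ x
  refine ⟨_, (hφ.isLittleO_sub (μ := μ) hs hβ hΓ hΛ x).add he, ?_⟩
  filter_upwards [hle, eventually_admissible sbar Γ Λ] with q hq hadm
  have h1 : ∫ τ in (0 : ℝ)..q.1, inner ℝ (gradient φ x + gradient g x) (q.2.1 τ)
      = (∫ τ in (0 : ℝ)..q.1, inner ℝ (gradient φ x) (q.2.1 τ))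
        + ∫ τ in (0 : ℝ)..q.1, inner ℝ (gradient g x) (q.2.1 τ) := by
    rw [← intervalIntegral.integral_add (intervalIntegrable_inner_control hΛ _ hadm.2.1 hadm.1.le)
      (intervalIntegrable_inner_control hΛ _ hadm.2.1 hadm.1.le)]
    simp only [inner_add_left]
  rw [h1, inner_add_left]
  linarith

theorem isLittleO_exp_sub_one_mul {sbar : ℝ} {Γ Λ : Set ℝ} (c : ℝ)
    {f : ℝ × (ℝ → State sbar) × (ℝ → ℝ) → ℝ} (hf : Tendsto f (smallTime sbar Γ Λ) (𝓝 0)) :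
    (fun q => (Real.exp (c * q.1) - 1) * f q) =o[smallTime sbar Γ Λ] fun q => q.1 := by
  have h1 : (fun q : ℝ × (ℝ → State sbar) × (ℝ → ℝ) => Real.exp (c * q.1) - 1)
      =O[smallTime sbar Γ Λ] fun q => q.1 := by
    refine ((isLittleO_exp_sub_one c).isBigO.add
      ((Asymptotics.isBigO_refl _ _).const_mul_left c)).congr_left fun q => ?_
    ring
  simpa only [mul_one] using h1.mul_isLittleO ((Asymptotics.isLittleO_one_iff ℝ).2 hf)

theorem tendsto_test_sub {sbar β μ lam : ℝ} (hβ : 0 < β) {Γ Λ : Set ℝ}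
    (hΓ : IsCompact Γ) (hΛ : IsCompact Λ) {φ g : State sbar → ℝ} {g₀ : ℝ → ℝ}
    (hφ : IsTest1 sbar β lam φ) (hg : IsTest2 sbar g g₀) (x : State sbar) :
    Tendsto (fun q : ℝ × (ℝ → State sbar) × (ℝ → ℝ) =>
      (φ (trajectory sbar β μ x q.2.1 q.2.2 q.1) + g (trajectory sbar β μ x q.2.1 q.2.2 q.1))
        - (φ x + g x)) (smallTime sbar Γ Λ) (𝓝 0) := by
  have h := ((hφ.1.continuous.add hg.1.continuous).tendsto x).comp
    (tendsto_trajectory (μ := μ) hβ hΓ hΛ x)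
  simpa using h.sub_const (φ x + g x)

namespace Assumptions

variable {sbar β ρ lam CL : ℝ} (μ : ℝ) {Γ Λ : Set ℝ} {L : State sbar → State sbar → ℝ → ℝ}

theorem hamiltonian_le (H : Assumptions sbar β ρ lam Γ Λ L CL) (x : State sbar) (d : ℝ)
    (p : State sbar) {α : State sbar} (hα : α ∈ controlValues sbar Λ) {a : ℝ} (ha : a ∈ Γ) :
    hamiltonian sbar β Γ Λ L x d p ≤ β * d * a + inner ℝ p α + L x α a := by
  obtain ⟨M, hM0, hM⟩ := exists_norm_controlValues_le sbar H.compact_distributed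
  refine csInf_le ⟨-(|β * d| * setNorm Γ + ‖p‖ * M + CL), ?_⟩ ⟨(α, a), ⟨hα, ha⟩, rfl⟩
  rintro _ ⟨⟨γ, b⟩, ⟨hγ, hb⟩, rfl⟩
  simp only
  have h1 : |β * d * b| ≤ |β * d| * setNorm Γ := by
    rw [abs_mul]
    exact mul_le_mul_of_nonneg_left (abs_le_setNorm H.compact_boundary hb) (abs_nonneg _)
  have h2 := (abs_real_inner_le_norm p γ).trans
    (mul_le_mul_of_nonneg_left (hM γ hγ) (norm_nonneg p))
  have h3 := H.bounded x γ hγ b hb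
  linarith [(abs_le.1 h1).1, (abs_le.1 h2).1, (abs_le.1 h3).1]

theorem le_hamiltonian (H : Assumptions sbar β ρ lam Γ Λ L CL) (x : State sbar) (d : ℝ)
    (p : State sbar) {c : ℝ} (hc : ∀ α ∈ controlValues sbar Λ, ∀ a ∈ Γ,
      c ≤ β * d * a + inner ℝ p α + L x α a) : c ≤ hamiltonian sbar β Γ Λ L x d p := by
  obtain ⟨b, hb⟩ := H.nonempty_distributed
  obtain ⟨a, ha⟩ := H.nonempty_boundary
  refine le_csInf ⟨_, (toL2 sbar (fun _ => b), a), ⟨const_mem_controlValues sbar hb, ha⟩, rfl⟩ ?_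
  rintro _ ⟨⟨γ, b⟩, ⟨hγ, hb⟩, rfl⟩
  exact hc γ hγ b hb

/-- The infimum is taken pointwise in time, so arbitrary time-dependent controls are covered. -/
theorem mul_hamiltonian_le (H : Assumptions sbar β ρ lam Γ Λ L CL) (x : State sbar) (d : ℝ)
    (p : State sbar) {α : ℝ → State sbar} (hα : α ∈ distributedControls sbar Λ) {a : ℝ → ℝ}
    (ha : a ∈ boundaryControls Γ) {h : ℝ} (hh : 0 ≤ h) :
    h * hamiltonian sbar β Γ Λ L x d p ≤ (∫ τ in (0 : ℝ)..h, β * d * a τ)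
      + (∫ τ in (0 : ℝ)..h, inner ℝ p (α τ)) + ∫ τ in (0 : ℝ)..h, L x (α τ) (a τ) := by
  have i1 := (intervalIntegrable_boundaryControl H.compact_boundary ha hh).const_mul (β * d)
  have i2 := intervalIntegrable_inner_control H.compact_distributed p hα hh
  have i3 := H.intervalIntegrable_lagrangian x hα ha hh
  rw [← intervalIntegral.integral_add i1 i2, ← intervalIntegral.integral_add (i1.add i2) i3]
  have h1 : ∫ _ in (0 : ℝ)..h, hamiltonian sbar β Γ Λ L x d p
      = h * hamiltonian sbar β Γ Λ L x d p := by
    rw [intervalIntegral.integral_const, sub_zero, smul_eq_mul]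
  rw [← h1]
  exact intervalIntegral.integral_mono_on hh intervalIntegrable_const ((i1.add i2).add i3)
    fun τ hτ => H.hamiltonian_le x d p (hα.2 τ hτ.1) (ha.2 τ hτ.1)

/-- For fixed `(α, a)`, use the constant controls in the dynamic programming inequality. The maximum
bounds `V(x(h)) - V(x)` above by the increment of `φ + g`. -/
theorem isSubsolution_value (H : Assumptions sbar β ρ lam Γ Λ L CL) :
    IsSubsolution sbar β μ ρ lam Γ Λ L (value sbar β μ ρ Γ Λ L) := by
  refine ⟨H.isRegular_value μ, fun φ g g₀ x hφ hg hmax => ?_⟩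
  have hs := H.sbar_pos
  have hβ := H.beta_pos
  have hΓ := H.compact_boundary
  have hΛ := H.compact_distributed
  rw [sub_le_comm]
  refine H.le_hamiltonian x _ _ fun α hα a ha => ?_
  have hα' := const_mem_distributedControls hα
  have ha' := const_mem_boundaryControls ha
  have ht := tendsto_smallTime (sbar := sbar) (Γ := Γ) (Λ := Λ) (fun _ => hα') (fun _ => ha')
  obtain ⟨e, he, hle⟩ := exists_test_sub_le (μ := μ) hs hβ hΓ hΛ hφ hg x
  have o1 := H.isLittleO_running μ x
  -- The discount multiplies the test increment as well; that product is `O(h)` times a quantity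
  -- tending to `0`.
  have o2 := isLittleO_exp_sub_one_mul (-ρ) (tendsto_test_sub (μ := μ) hβ hΓ hΛ hφ hg x)
  have o3 := (isLittleO_exp_sub_one (sbar := sbar) (Γ := Γ) (Λ := Λ) (-ρ)).const_mul_left
    (value sbar β μ ρ Γ Λ L x)
  have o := (((o1.add o2).add he).add o3).comp_tendsto ht
  rw [← sub_nonpos]
  refine nonpos_of_mul_le_isLittleO o ?_
  filter_upwards [ht.eventually hle, ht.eventually
    ((tendsto_trajectory (μ := μ) hβ hΓ hΛ x).eventually hmax), self_mem_nhdsWithin]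
    with h h1 h2 h3
  have h3' : 0 < h := h3
  have h4 := H.value_le_running_add_value μ x hα' ha' h3'.le
  have h5 := Real.exp_pos (-ρ * h)
  simp only [Function.comp_apply]
  simp only [intervalIntegral.integral_const, sub_zero, smul_eq_mul] at h1 ⊢
  have h6 := mul_le_mul_of_nonneg_left h2 h5.le
  linarith

/-- At a minimum `V(x(h)) - V(x)` is at least minus the increment of `φ + g`, so the same upper
bound applies. The controls are then eliminated through the Hamiltonian at the negated gradient. -/
theorem isSupersolution_value (H : Assumptions sbar β ρ lam Γ Λ L CL) :
    IsSupersolution sbar β μ ρ lam Γ Λ L (value sbar β μ ρ Γ Λ L) := by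
  refine ⟨H.isRegular_value μ, fun φ g g₀ x hφ hg hmin => ?_⟩
  have hs := H.sbar_pos
  have hβ := H.beta_pos
  have hΓ := H.compact_boundary
  have hΛ := H.compact_distributed
  -- The tolerance `h²` vanishes after division by `h`; for `h ≤ 0` any admissible pair serves.
  have hex : ∀ h : ℝ, ∃ α ∈ distributedControls sbar Λ, ∃ a ∈ boundaryControls Γ,
      0 < h → cost sbar β μ ρ L x α a < value sbar β μ ρ Γ Λ L x + h * h := fun h => by
    rcases le_or_gt h 0 with hh | hh
    · obtain ⟨α, hα, a, ha, -⟩ := H.exists_cost_lt μ x one_pos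
      exact ⟨α, hα, a, ha, fun h' => absurd h' (not_lt.2 hh)⟩
    · obtain ⟨α, hα, a, ha, hc⟩ := H.exists_cost_lt μ x (mul_pos hh hh)
      exact ⟨α, hα, a, ha, fun _ => hc⟩
  choose α hα a ha hc using hex
  have ht := tendsto_smallTime hα ha
  obtain ⟨e, he, hle⟩ := exists_test_sub_le (μ := μ) hs hβ hΓ hΛ hφ hg x
  have o1 := H.isLittleO_running μ x
  have o2 := isLittleO_exp_sub_one_mul (-ρ) (tendsto_test_sub (μ := μ) hβ hΓ hΛ hφ hg x)
  have o3 := (isLittleO_exp_sub_one (sbar := sbar) (Γ := Γ) (Λ := Λ) (-ρ)).const_mul_left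
    (value sbar β μ ρ Γ Λ L x)
  have o4 := isLittleO_mul_of_tendsto_zero (g := fun q => q.1) (tendsto_fst_smallTime sbar Γ Λ)
  have o := ((((o2.sub o1).add he).sub o3).add o4).comp_tendsto ht
  rw [ge_iff_le, ← sub_nonpos]
  refine nonpos_of_mul_le_isLittleO o ?_
  filter_upwards [ht.eventually hle, ht.eventually
    ((tendsto_trajectory (μ := μ) hβ hΓ hΛ x).eventually hmin), self_mem_nhdsWithin]
    with h h1 h2 h3
  have h3' : 0 < h := h3
  have h4 := (H.running_add_value_le_cost μ x (hα h) (ha h) h3'.le).trans (hc h h3').le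
  have h5 := Real.exp_pos (-ρ * h)
  have h7 := H.mul_hamiltonian_le x (-delta0 sbar (gradient φ x)) (-(gradient φ x + gradient g x))
    (hα h) (ha h) h3'.le
  simp only [Function.comp_apply]
  have h8 : ∫ τ in (0 : ℝ)..h, β * -delta0 sbar (gradient φ x) * a h τ
      = -∫ τ in (0 : ℝ)..h, β * delta0 sbar (gradient φ x) * a h τ := by
    rw [← intervalIntegral.integral_neg]
    congr 1
    ext τ
    ring
  have h9 : ∫ τ in (0 : ℝ)..h, inner ℝ (-(gradient φ x + gradient g x)) (α h τ)
      = -∫ τ in (0 : ℝ)..h, inner ℝ (gradient φ x + gradient g x) (α h τ) := by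
    rw [← intervalIntegral.integral_neg]
    simp only [inner_neg_left]
  rw [h8, h9] at h7
  have h6 := mul_le_mul_of_nonneg_left h2 h5.le
  linarith

end Assumptions

end TransportHJB

end

theorem mainTheorem1 (sbar β μ ρ lam : ℝ) (hsbar : 0 < sbar) (hβ : 0 < β) (hρ : 0 < ρ)
    (hlam : 0 < lam) (hlam1 : lam < 1)
    (Γ Λ : Set ℝ) (hΓ : IsCompact Γ) (hΓne : Γ.Nonempty) (hΛ : IsCompact Λ) (hΛne : Λ.Nonempty)
    (L : TransportHJB.State sbar → TransportHJB.State sbar → ℝ → ℝ)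
    (hLuc : UniformContinuousOn
      (fun q : TransportHJB.State sbar × TransportHJB.State sbar × ℝ => L q.1 q.2.1 q.2.2)
      (Set.univ ×ˢ TransportHJB.controlValues sbar Λ ×ˢ Γ))
    (CL : ℝ)
    (hL1 : ∀ x y, ∀ α ∈ TransportHJB.controlValues sbar Λ, ∀ a ∈ Γ,
      |L x α a - L y α a| ≤ CL * TransportHJB.bNorm sbar β lam (x - y))
    (hL2 : ∀ x, ∀ α ∈ TransportHJB.controlValues sbar Λ, ∀ a ∈ Γ, |L x α a| ≤ CL) :
    (∃ M : ℝ, ∀ x, |TransportHJB.value sbar β μ ρ Γ Λ L x| ≤ M) ∧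
    TransportHJB.IsBLipschitz sbar β lam (TransportHJB.value sbar β μ ρ Γ Λ L) ∧
    TransportHJB.IsSolution sbar β μ ρ lam Γ Λ L (TransportHJB.value sbar β μ ρ Γ Λ L) := by
  have H : TransportHJB.Assumptions sbar β ρ lam Γ Λ L CL :=
    ⟨hsbar, hβ, hρ, hlam, hΓ, hΓne, hΛ, hΛne, hLuc, hL1, hL2⟩
  exact ⟨⟨_, H.abs_value_le μ⟩, H.isBLipschitz_value μ,
    H.isSubsolution_value μ, H.isSupersolution_value μ⟩
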